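/- **Setting.** Let $\mathcal X$ be a measurable space, let $x\mapsto|\psi(x)\rangle$ be a measurable family of $n$-qubit unit vectors, and let $Q(a,x)=|\langle\psi(a)|\psi(x)\rangle|^2$. Let $D$ be a probability distribution of pairs $(a,b)\in\mathcal X\times[0,1]$ whose regression function is $$c(a):=\mathbb E[b\mid a]=\sum_{i}\alpha_i\,Q(p_i,a)+g(a)$$ for finitely many points $p_i\in\mathcal X$ and reals $\alpha_i$, where $g$ is measurable with values in $[-G,G]$, $G\ge G_0$, $\mathbb E[g(a)^2]\le\varepsilon_g$, and $\sum_{i,j}\alpha_i\alpha_jQ(p_i,p_j)<B$. Here $G_0>0$ is a fixed constant (that is, $G=\Omega(1)$). **Algorithm (Quantum Kernel Alphatron, learning rate $\lambda=1$).** Draw i.i.d. from $D$ training data $(a_1,b_1),\dots,(a_N,b_N)$ and validation data $(x_1,y_1),\dots,(x_M,y_M)$, $N\ge1$. Every entry $Q(a_i,a_j)$ and $Q(a_i,x_j)$ is replaced by the mean $\hat Q$ of the $\pm1$ outcomes of $m$ independent SWAP tests (measurements of the observable SWAP on fresh copies of $|\psi(a_i)\rangle\otimes|\psi(a_j)\rangle$,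 respectively $|\psi(a_i)\rangle\otimes|\psi(x_j)\rangle$). Put $\alpha^1=0\in\mathbb R^N$ and, for $t=1,\dots,T$, $\hat h^t(x)=\sum_i\alpha^t_i\hat Q(a_i,x)$ and $\alpha_i^{t+1}=\alpha_i^t+\frac{1}{N}(b_i-\hat h^t(a_i))$. Output $\hat h^*=\hat h^r$, where $r\in\{1,\dots,T\}$ minimises $\sum_{j=1}^M(\hat h^t(x_j)-y_j)^2$ over $t$. **Errors.** $\hat R(h)=\frac1N\sum_{i=1}^N(h(a_i)-c(a_i))^2$ is the training error. $R(h)=\mathbb E[(h(x)-c(x))^2]$ is the generalization error, the mean being over a new point $x$ and over the $m$ fresh SWAP tests that estimate each $Q(a_i,x)$. **Theorem.** Let $G_0>0$ and $\delta_0\in(0,1)$. There are positive constants $c_T,c_M,c_Q,C$, depending only on $G_0$ and $\delta_0$, and for every $(\psi,D)$ a constant $K=K(\psi,D)>0$, such that for all $\delta\in(0,\delta_0]$, all $N\ge1$ and all $(p_i),(\alpha_i),g,G,B,\varepsilon_g$ as above the algorithm run with $$T=\Big\lceil c_T\sqrt{N/\log(1/\delta)}\Big\rceil,\quad M=\big\lceil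 c_M N\log(T/\delta)\big\rceil,\quad m=\big\lceil c_Q N^{5/2}\big\rceil$$ outputs, with probability at least $1-\delta$ over the data and the SWAP tests (and for every choice of the minimiser $r$), a hypothesis $\hat h^*$ with $$\hat R(\hat h^*)\le C\left(\sqrt{\varepsilon_g}+G\sqrt[4]{\frac{\log(1/\delta)}N}+B\sqrt{\frac{\log(1/\delta)}N}\right),$$ $$R(\hat h^*)\le\hat R(\hat h^*)+K\sqrt{\frac{\log(2/\delta)}N},$$ $$R(\hat h^*)\le C\left(\sqrt{\varepsilon_g}+G\sqrt[4]{\frac{\log(1/\delta)}N}+B\sqrt{\frac{\log(1/\delta)}N}\right)+C\sqrt{\frac{\log(2/\delta)}N}.$$ -/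

import Mathlib

open MeasureTheory

noncomputable section

namespace QKA

/-- Pure-state vectors of `n` qubits (normalisation is a separate hypothesis). -/
abbrev QState (n : ℕ) : Type := EuclideanSpace ℂ (Fin n → Fin 2)

/-- Vectors of the joint system of two `n`-qubit registers. -/
abbrev QPair (n : ℕ) : Type := EuclideanSpace ℂ ((Fin n → Fin 2) × (Fin n → Fin 2))

/-- The product vector `|φ⟩ ⊗ |χ⟩`. -/
def tensor {n : ℕ} (φ χ : QState n) : QPair n :=
  WithLp.toLp 2 fun p => φ p.1 * χ p.2

/-- The operator exchanging the two registers. -/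
def swapOp {n : ℕ} (v : QPair n) : QPair n :=
  WithLp.toLp 2 fun p => v p.swap

/-- The quantum kernel value `|⟨φ|χ⟩|²`. -/
def qKernel {n : ℕ} (φ χ : QState n) : ℝ := ‖inner ℂ φ χ‖ ^ 2

/-- Numerical value of the outcome of one SWAP test: `+1` or `-1`. -/
def sgn (s : Bool) : ℝ := if s then 1 else -1

/-- Born probability of the outcome `s` when the observable SWAP (eigenvalues `±1`, spectral
projections `(1 ± SWAP) / 2`) is measured on `|φ⟩ ⊗ |χ⟩`. -/
def swapProb {n : ℕ} (φ χ : QState n) (s : Bool) : ℝ :=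
  ‖(1 / 2 : ℂ) • (tensor φ χ + (sgn s : ℂ) • swapOp (tensor φ χ))‖ ^ 2

/-- Probability of a sequence of outcomes of `m` independent SWAP tests, each of them on a fresh
copy of `|φ⟩ ⊗ |χ⟩`. -/
def shotsProb {n m : ℕ} (φ χ : QState n) (s : Fin m → Bool) : ℝ :=
  ∏ l, swapProb φ χ (s l)

/-- The kernel estimate computed from `m` SWAP tests: the mean outcome. -/
def kernelEst {m : ℕ} (s : Fin m → Bool) : ℝ := (∑ l, sgn (s l)) / m

/-- `N` labelled training points and `M` labelled validation points. -/
abbrev Data (X : Type*) (N M : ℕ) : Type _ := (Fin N → X × ℝ) × (Fin M → X × ℝ)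

/-- SWAP-test outcomes, `m` for each pair (training point, training point) and `m` for each pair
(training point, validation point). -/
abbrev Shots (N M m : ℕ) : Type :=
  (Fin N → Fin N → Fin m → Bool) × (Fin N → Fin M → Fin m → Bool)

/-- Everything random in one run of the algorithm. -/
abbrev Run (X : Type*) (N M m : ℕ) : Type _ := Data X N M × Shots N M m

/-- Conditional probability of all SWAP-test outcomes given the data: the tests are independent. -/
def runDensity {X : Type*} {n : ℕ} (ψ : X → QState n) {N M m : ℕ} (ω : Run X N M m) : ℝ :=
  (∏ i, ∏ j, shotsProb (ψ (ω.1.1 i).1) (ψ (ω.1.1 j).1) (ω.2.1 i j)) *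
    ∏ i, ∏ j, shotsProb (ψ (ω.1.1 i).1) (ψ (ω.1.2 j).1) (ω.2.2 i j)

/-- The joint law of the data and of the SWAP-test outcomes: the labelled points are i.i.d. with
law `D`, and given the data the outcomes have probability `runDensity`. -/
def runLaw {X : Type*} [MeasurableSpace X] {n : ℕ} (ψ : X → QState n) (D : Measure (X × ℝ))
    (N M m : ℕ) : Measure (Run X N M m) :=
  (((Measure.pi fun _ : Fin N => D).prod (Measure.pi fun _ : Fin M => D)).prod
    (Measure.count : Measure (Shots N M m))).withDensity
      fun ω => ENNReal.ofReal (runDensity ψ ω)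

/-- The Alphatron iteration with kernel matrix `K`, labels `b` and learning rate `lr`.
`weights K b lr t` is the weight vector of the `(t + 1)`-st iteration, starting from zero. -/
def weights {N : ℕ} (K : Fin N → Fin N → ℝ) (b : Fin N → ℝ) (lr : ℝ) : ℕ → Fin N → ℝ
  | 0 => fun _ => 0
  | t + 1 => fun i =>
      weights K b lr t i + lr / N * (b i - ∑ j, weights K b lr t j * K j i)

section Algorithm

variable {X : Type*} {N M m : ℕ}

/-- Weights computed by the algorithm from the training labels and the estimated kernel matrix. -/
def runWeights (lr : ℝ) (ω : Run X N M m) (t : ℕ) : Fin N → ℝ :=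
  weights (fun i j => kernelEst (ω.2.1 i j)) (fun i => (ω.1.1 i).2) lr t

/-- Value of the computed hypothesis at the `i`-th training point. -/
def trainPred (lr : ℝ) (ω : Run X N M m) (t : ℕ) (i : Fin N) : ℝ :=
  ∑ j, runWeights lr ω t j * kernelEst (ω.2.1 j i)

/-- Value of the computed hypothesis at the `j`-th validation point. -/
def valPred (lr : ℝ) (ω : Run X N M m) (t : ℕ) (j : Fin M) : ℝ :=
  ∑ i, runWeights lr ω t i * kernelEst (ω.2.2 i j)

/-- Validation loss of the hypothesis. -/
def valLoss (lr : ℝ) (ω : Run X N M m) (t : ℕ) : ℝ :=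
  ∑ j, (valPred lr ω t j - (ω.1.2 j).2) ^ 2

/-- `r` is an admissible output index of the algorithm with `T` iterations (indexed by
`0, …, T - 1`): a minimiser of the validation loss. -/
def IsOutput (lr : ℝ) (T : ℕ) (ω : Run X N M m) (r : ℕ) : Prop :=
  r < T ∧ ∀ t < T, valLoss lr ω r ≤ valLoss lr ω t

/-- Training error of the hypothesis, with respect to the regression function `c`. -/
def trainErr (lr : ℝ) (c : X → ℝ) (ω : Run X N M m) (t : ℕ) : ℝ :=
  (∑ i, (trainPred lr ω t i - c (ω.1.1 i).1) ^ 2) / N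

/-- Generalization error of the hypothesis, with respect to the regression function `c`: the mean
squared error at a fresh point `x`, where `Q(aᵢ, x)` is again estimated by `m` fresh SWAP tests
for each `i`. -/
def genErr [MeasurableSpace X] {n : ℕ} (ψ : X → QState n) (D : Measure (X × ℝ)) (lr : ℝ)
    (c : X → ℝ) (ω : Run X N M m) (t : ℕ) : ℝ :=
  ∫ z, ∑ s : Fin N → Fin m → Bool,
    (∏ i, shotsProb (ψ (ω.1.1 i).1) (ψ z.1) (s i)) *
      ((∑ i, runWeights lr ω t i * kernelEst (s i)) - c z.1) ^ 2 ∂D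

end Algorithm

/-- The linear combination `x ↦ ∑ᵢ αᵢ Q(pᵢ, x)` of kernel functions. -/
def kernelComb {X : Type*} {n k : ℕ} (ψ : X → QState n) (p : Fin k → X) (α : Fin k → ℝ)
    (x : X) : ℝ :=
  ∑ i, α i * qKernel (ψ (p i)) (ψ x)

/-- The leading error bound `√ε + G (log(1/δ)/N)^(1/4) + B √(log(1/δ)/N)`. -/
def rate (ε G B : ℝ) (N : ℕ) (δ : ℝ) : ℝ :=
  √ε + G * (Real.log (1 / δ) / N) ^ (1 / 4 : ℝ) + B * √(Real.log (1 / δ) / N)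

end QKA

end

/-! Density matrices, read as real unit vectors Ψ(x), have the kernel values as inner products
(`inner_feature`). Up to shot noise the algorithm is therefore gradient descent with unit step for a
least-squares problem in a finite-dimensional Euclidean space, and the target is c = ⟨v, Ψ⟩ + g with
‖v‖² < B. Write L = log(1/δ), η = √(L/N) for the statistical accuracy and ν = 1/√N. The run has T ≈
1/η steps, and m is large enough to make all kernel entries accurate to ην simultaneously. Over T
steps this error accumulates to O(ν) in every prediction (`abs_sum_weights_mul_sub_le`).

Early stopping: ‖v − w_t‖² decreases at each step by half the empirical mean square of ⟨v − w_t, Ψ⟩,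
up to noise (`norm_sub_weightVec_succ_sq_le`). As it starts below B and stays nonnegative, some t <
T has an empirical mean square of the order of the rate, and ‖v − w_s‖² ≤ B for all s ≤ t
(`exists_small_of_descent`, `GoodRun.exists_time`).

Validation: given the training data and the training shots, the iterates are fixed vectors. The
excess loss of w has variance at most its range times its mean, so Bernstein's inequality gives a
relative deviation (`measure_excess_deviation_le`). The remainder is O(ν) because ‖w_t‖² grows only
linearly in t (`norm_weightVec_sq_le`). Hence the selected index r has risk at most three times that
of t, plus O(ν) (`GoodRun.risk_le_of_risk_le`).

Training error of r: if r ≥ t, the residuals have hardly grown since time t, and label noise costs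
O(√η) (`GoodRun.trainErr_le_trainErr`). If r < t, then w_r is still within √B of v, so uniform
concentration of second moments converts its small risk back into a small training error.

Generalization: the third bound comes directly from the risk of w_r plus the variance of the fresh
shots (`genErr_le`). The second bound needs ‖w_r‖ bounded independently of N. This follows from a
spectral gap of the population covariance on the span of the support (`exists_covariance_gap`,
`GoodRun.norm_sq_le_of_gap`), and the gap is what makes K depend on ψ and D.

The vector-valued concentration is Pinelis' inequality (`measure_norm_sum_ge_le`), and all events
are collected in `runLaw_not_concentrated_le`. A rate above one is covered by absolute bounds.
Otherwise G ≥ G₀ lets the rate absorb √η, and δ ≤ δ₀ < 1 gives ν = O(η). -/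

noncomputable section

namespace QKA

/-! ### Concentration inequalities for i.i.d. sums: Pinelis, Chernoff, Bernstein. -/

section Concentration

/-- Convexity of `u ↦ cosh (l √u)`, in the form needed for Pinelis' inequality. -/
theorem cosh_norm_add_le {E : Type*} [NormedAddCommGroup E] [InnerProductSpace ℝ E]
    (l : ℝ) (x y : E) (hy : ‖y‖ ≤ 1) :
    Real.cosh (l * ‖x + y‖) ≤ Real.cosh (l * ‖x‖) * Real.cosh l +
      inner ℝ x y * (Real.sinh (l * ‖x‖) * Real.sinh l / ‖x‖) := by
  set a := ‖x‖ with ha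
  -- τ is the component of y along x, in [-1, 1]. It makes ‖x + y‖² at most the mean of (a + 1)² and
  -- (a − 1)² with weights (1 ± τ)/2. For x = 0 the division convention gives τ = 0, which is
  -- harmless.
  set τ := inner ℝ x y / a with hτ
  have ha0 : 0 ≤ a := norm_nonneg _
  have hxy : inner ℝ x y = a * τ := by
    rcases eq_or_ne a 0 with h | h
    · have : x = 0 := by simpa [ha] using h
      simp [this, h]
    · rw [hτ]; field_simp
  have habs : |τ| ≤ 1 := by
    rw [hτ, abs_div, abs_of_nonneg ha0]
    apply div_le_one_of_le₀ _ ha0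
    calc |inner ℝ x y| ≤ ‖x‖ * ‖y‖ := abs_real_inner_le_norm x y
      _ ≤ a * 1 := by gcongr
      _ = a := mul_one _
  obtain ⟨h1, h2⟩ := abs_le.1 habs
  have hsq : ‖x + y‖ ^ 2 ≤ (1 + τ) / 2 * (a + 1) ^ 2 + (1 - τ) / 2 * (a - 1) ^ 2 := by
    rw [norm_add_sq_real, hxy]
    have : ‖y‖ ^ 2 ≤ 1 := by nlinarith [norm_nonneg y]
    nlinarith
  have key : Real.cosh (l * ‖x + y‖) ≤
      (1 + τ) / 2 * Real.cosh (l * (a + 1)) + (1 - τ) / 2 * Real.cosh (l * (a - 1)) := by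
    -- The convexity is used termwise: cosh has nonnegative coefficients in even powers, and u ↦ u ^
    -- k is convex on u ≥ 0.
    refine hasSum_le (fun k => ?_) (Real.hasSum_cosh (l * ‖x + y‖))
      (((Real.hasSum_cosh (l * (a + 1))).mul_left ((1 + τ) / 2)).add
        ((Real.hasSum_cosh (l * (a - 1))).mul_left ((1 - τ) / 2)))
    have hc := (convexOn_pow (𝕜 := ℝ) k).2 (Set.mem_Ici.2 (sq_nonneg (l * (a + 1))))
      (Set.mem_Ici.2 (sq_nonneg (l * (a - 1)))) (by linarith : 0 ≤ (1 + τ) / 2)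
      (by linarith : 0 ≤ (1 - τ) / 2) (by ring)
    simp only [smul_eq_mul] at hc
    have hp : (l * ‖x + y‖) ^ (2 * k) ≤
        (1 + τ) / 2 * (l * (a + 1)) ^ (2 * k) + (1 - τ) / 2 * (l * (a - 1)) ^ (2 * k) := by
      rw [pow_mul, pow_mul, pow_mul]
      refine le_trans (pow_le_pow_left₀ (by positivity) ?_ k) hc
      have : 0 ≤ l ^ 2 := by positivity
      rw [mul_pow, mul_pow, mul_pow]
      nlinarith
    rw [← mul_div_assoc, ← mul_div_assoc, ← add_div]
    gcongr
  refine key.trans (le_of_eq ?_)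
  have e1 : l * (a + 1) = l * a + l := by ring
  have e2 : l * (a - 1) = l * a - l := by ring
  rw [e1, e2, Real.cosh_add, Real.cosh_sub]
  rcases eq_or_ne a 0 with h | h
  · simp [h]; ring
  · rw [hxy]; field_simp; ring

variable {Z : Type*} [MeasurableSpace Z] (μ : Measure Z) [IsProbabilityMeasure μ]
variable {E : Type*} [NormedAddCommGroup E] [InnerProductSpace ℝ E] [MeasurableSpace E]
  [BorelSpace E] [SecondCountableTopology E]

/-- Integration removes the term linear in Y because Y is centred, and cosh l ≤ exp(l²/2). This is
one step of the supermartingale argument. -/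
theorem lintegral_cosh_norm_add_le (l : ℝ) (Y : Z → E) (hY : Measurable Y)
    (hb : ∀ᵐ z ∂μ, ‖Y z‖ ≤ 1) (h0 : ∀ x : E, ∫ z, inner ℝ x (Y z) ∂μ = 0) (x : E) :
    ∫⁻ z, ENNReal.ofReal (Real.cosh (l * ‖x + Y z‖)) ∂μ ≤
      ENNReal.ofReal (Real.exp (l ^ 2 / 2) * Real.cosh (l * ‖x‖)) := by
  set κ := Real.sinh (l * ‖x‖) * Real.sinh l / ‖x‖
  have hint : Integrable (fun z => inner ℝ x (Y z)) μ := by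
    refine Integrable.of_bound (C := ‖x‖) (by fun_prop) ?_
    filter_upwards [hb] with z hz
    calc ‖inner ℝ x (Y z)‖ ≤ ‖x‖ * ‖Y z‖ := norm_inner_le_norm _ _
      _ ≤ ‖x‖ * 1 := by gcongr
      _ = _ := mul_one _
  have hint2 : Integrable (fun z => Real.cosh (l * ‖x‖) * Real.cosh l + inner ℝ x (Y z) * κ) μ :=
    (integrable_const _).add (hint.mul_const _)
  have hle : ∀ᵐ z ∂μ, Real.cosh (l * ‖x + Y z‖) ≤
      Real.cosh (l * ‖x‖) * Real.cosh l + inner ℝ x (Y z) * κ := by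
    filter_upwards [hb] with z hz using cosh_norm_add_le l x (Y z) hz
  calc ∫⁻ z, ENNReal.ofReal (Real.cosh (l * ‖x + Y z‖)) ∂μ
      ≤ ∫⁻ z, ENNReal.ofReal (Real.cosh (l * ‖x‖) * Real.cosh l + inner ℝ x (Y z) * κ) ∂μ := by
        apply lintegral_mono_ae
        filter_upwards [hle] with z hz using ENNReal.ofReal_le_ofReal hz
    _ = ENNReal.ofReal (∫ z, (Real.cosh (l * ‖x‖) * Real.cosh l + inner ℝ x (Y z) * κ) ∂μ) := by
        rw [ofReal_integral_eq_lintegral_ofReal hint2]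
        filter_upwards [hle] with z hz using (Real.cosh_pos _).le.trans hz
    _ = ENNReal.ofReal (Real.cosh (l * ‖x‖) * Real.cosh l) := by
        rw [integral_add (integrable_const _) (hint.mul_const _), integral_mul_const κ, h0]
        simp
    _ ≤ _ := by
        apply ENNReal.ofReal_le_ofReal
        rw [mul_comm]
        exact mul_le_mul_of_nonneg_right (Real.cosh_le_exp_half_sq l) (Real.cosh_pos _).le

/-- The starting point x is arbitrary so that, in the induction, the first summand can be absorbed
into it while the remaining coordinates are integrated. -/
theorem lintegral_cosh_norm_sum_le (l : ℝ) (Y : Z → E) (hY : Measurable Y)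
    (hb : ∀ᵐ z ∂μ, ‖Y z‖ ≤ 1) (h0 : ∀ x : E, ∫ z, inner ℝ x (Y z) ∂μ = 0) (N : ℕ) (x : E) :
    ∫⁻ z, ENNReal.ofReal (Real.cosh (l * ‖x + ∑ i, Y (z i)‖)) ∂(Measure.pi fun _ : Fin N => μ) ≤
      ENNReal.ofReal (Real.exp (N * (l ^ 2 / 2)) * Real.cosh (l * ‖x‖)) := by
  induction N generalizing x with
  | zero => simp
  | succ N ih =>
    have hmp := (measurePreserving_piFinSuccAbove (fun _ : Fin (N + 1) => μ) 0).symm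
    rw [← hmp.lintegral_comp (by fun_prop), lintegral_prod _ (by fun_prop)]
    have : ∀ z : Z, ∀ z' : Fin N → Z,
        x + ∑ i, Y ((MeasurableEquiv.piFinSuccAbove (fun _ : Fin (N + 1) => Z) 0).symm (z, z') i)
          = (x + Y z) + ∑ i, Y (z' i) := by
      intro z z'
      rw [Fin.sum_univ_succ]
      simp [MeasurableEquiv.piFinSuccAbove, Fin.insertNthEquiv, add_assoc]
    simp only [this]
    calc ∫⁻ z, ∫⁻ z', ENNReal.ofReal (Real.cosh (l * ‖(x + Y z) + ∑ i, Y (z' i)‖))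
          ∂(Measure.pi fun _ : Fin N => μ) ∂μ
        ≤ ∫⁻ z, ENNReal.ofReal (Real.exp (N * (l ^ 2 / 2))) *
            ENNReal.ofReal (Real.cosh (l * ‖x + Y z‖)) ∂μ := by
          refine lintegral_mono fun z => (ih (x + Y z)).trans (le_of_eq ?_)
          rw [ENNReal.ofReal_mul (Real.exp_pos _).le]
      _ ≤ ENNReal.ofReal (Real.exp (N * (l ^ 2 / 2))) *
            ENNReal.ofReal (Real.exp (l ^ 2 / 2) * Real.cosh (l * ‖x‖)) := by
          rw [lintegral_const_mul _ (by fun_prop)]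
          gcongr
          exact lintegral_cosh_norm_add_le μ l Y hY hb h0 x
      _ = _ := by
          rw [← ENNReal.ofReal_mul (Real.exp_pos _).le, ← mul_assoc, ← Real.exp_add]
          congr 3
          push_cast; ring

/-- Hoeffding's inequality for sums of i.i.d. bounded centred vectors (Pinelis). -/
theorem measure_norm_sum_ge_le (Y : Z → E) (hY : Measurable Y) {R : ℝ} (hR : 0 < R)
    (hb : ∀ᵐ z ∂μ, ‖Y z‖ ≤ R) (h0 : ∀ x : E, ∫ z, inner ℝ x (Y z) ∂μ = 0) (N : ℕ)
    {s : ℝ} (hs : 0 ≤ s) :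
    (Measure.pi fun _ : Fin N => μ) {z | N * (R * s) ≤ ‖∑ i, Y (z i)‖} ≤
      ENNReal.ofReal (2 * Real.exp (-(N * s ^ 2 / 2))) := by
  have h := lintegral_cosh_norm_sum_le μ s (fun z => R⁻¹ • Y z) (by fun_prop)
    (by
      filter_upwards [hb] with z hz
      rw [norm_smul, Real.norm_eq_abs, abs_of_pos (inv_pos.2 hR), inv_mul_le_one₀ hR]
      exact hz)
    (by
      intro x
      simp only [inner_smul_right, integral_const_mul, h0, mul_zero]) N 0
  have hm := mul_meas_ge_le_lintegral₀ (μ := Measure.pi fun _ : Fin N => μ)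
    (f := fun z => ENNReal.ofReal (Real.cosh (s * ‖0 + ∑ i, R⁻¹ • Y (z i)‖)))
    (Measurable.aemeasurable (by fun_prop)) (ENNReal.ofReal (Real.exp (N * s ^ 2) / 2))
  -- The threshold uses cosh u ≥ exp(u)/2. Markov's inequality at l = s then leaves exp(N s²/2)
  -- against exp(N s²)/2.
  have hpos : 0 < Real.exp (N * s ^ 2) / 2 := by positivity
  have hsub : {z : Fin N → Z | N * (R * s) ≤ ‖∑ i, Y (z i)‖} ⊆
      {z | ENNReal.ofReal (Real.exp (N * s ^ 2) / 2) ≤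
        ENNReal.ofReal (Real.cosh (s * ‖0 + ∑ i, R⁻¹ • Y (z i)‖))} := by
    intro z hz
    simp only [Set.mem_ofPred_eq] at hz ⊢
    apply ENNReal.ofReal_le_ofReal
    rw [zero_add, ← Finset.smul_sum, norm_smul, Real.norm_eq_abs, abs_of_pos (inv_pos.2 hR)]
    have h1 : (N : ℝ) * s ^ 2 ≤ s * (R⁻¹ * ‖∑ i, Y (z i)‖) := by
      have : (N : ℝ) * s ≤ R⁻¹ * ‖∑ i, Y (z i)‖ := by
        rw [le_inv_mul_iff₀ hR]; linarith
      nlinarith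
    rw [Real.cosh_eq]
    have := Real.exp_le_exp.2 h1
    have := Real.exp_pos (-(s * (R⁻¹ * ‖∑ i, Y (z i)‖)))
    linarith
  refine (measure_mono hsub).trans ?_
  have h2 := hm.trans h
  rw [norm_zero, mul_zero, Real.cosh_zero, mul_one] at h2
  rw [mul_comm, ← ENNReal.le_div_iff_mul_le (Or.inl (by simpa using hpos)) (Or.inl (by simp)),
    ← ENNReal.ofReal_div_of_pos hpos] at h2
  refine h2.trans (ENNReal.ofReal_le_ofReal (le_of_eq ?_))
  rw [div_div_eq_mul_div, div_eq_iff (Real.exp_pos _).ne', mul_assoc, ← Real.exp_add, mul_comm]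
  congr 2
  ring

/-- One-sided exponential-moment bound for an i.i.d. sum. -/
theorem measure_sum_ge_le_of_exp (f : Z → ℝ) (hf : Measurable f) {b : ℝ}
    (hb : ∀ᵐ z ∂μ, |f z| ≤ b) {r : ℝ} (hr : ∫ z, Real.exp (f z) ∂μ ≤ Real.exp r)
    (M : ℕ) (s : ℝ) :
    (Measure.pi fun _ : Fin M => μ) {z | M * r + s ≤ ∑ j, f (z j)} ≤
      ENNReal.ofReal (Real.exp (-s)) := by
  have hint : Integrable (fun z => Real.exp (f z)) μ := by
    refine Integrable.of_bound (C := Real.exp b) (by fun_prop) ?_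
    filter_upwards [hb] with z hz
    rw [Real.norm_eq_abs, abs_of_pos (Real.exp_pos _)]
    exact Real.exp_le_exp.2 ((le_abs_self _).trans hz)
  have hprod : ∀ z : Fin M → Z, Real.exp (∑ j, f (z j)) = ∏ j, Real.exp (f (z j)) :=
    fun z => Real.exp_sum _ _
  have hint' : Integrable (fun z : Fin M → Z => Real.exp (∑ j, f (z j)))
      (Measure.pi fun _ : Fin M => μ) := by
    simp only [hprod]
    exact Integrable.fintype_prod (μ := fun _ : Fin M => μ) fun _ => hint
  have hI : ∫ z : Fin M → Z, Real.exp (∑ j, f (z j)) ∂(Measure.pi fun _ : Fin M => μ) ≤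
      Real.exp (M * r) := by
    simp only [hprod]
    rw [integral_fintype_prod_eq_pow (fun z => Real.exp (f z)), Fintype.card_fin, Real.exp_nat_mul]
    exact pow_le_pow_left₀ (integral_nonneg fun _ => (Real.exp_pos _).le) hr _
  have hm := mul_meas_ge_le_integral_of_nonneg (Filter.Eventually.of_forall fun z : Fin M → Z =>
    (Real.exp_pos (∑ j, f (z j))).le) hint' (Real.exp (M * r + s))
  have hsub : {z : Fin M → Z | M * r + s ≤ ∑ j, f (z j)} ⊆
      {z | Real.exp (M * r + s) ≤ Real.exp (∑ j, f (z j))} := by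
    intro z hz
    exact Real.exp_le_exp.2 hz
  refine (measure_mono hsub).trans ?_
  rw [← ENNReal.ofReal_toReal (measure_ne_top (Measure.pi fun _ : Fin M => μ) _)]
  apply ENNReal.ofReal_le_ofReal
  have := hm.trans hI
  rw [Real.exp_add, mul_assoc, mul_le_iff_le_one_right (Real.exp_pos _)] at this
  rw [Real.exp_neg]
  rw [Measure.real] at this
  rwa [← one_div, le_div_iff₀ (Real.exp_pos _), mul_comm, Real.exp_add]

/-- Relative Bernstein inequality: if `|ζ| ≤ b` and `E ζ² ≤ b E ζ` then the empirical mean of `ζ`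
is within `E ζ / 2 + τ` of `E ζ`. -/
theorem measure_relative_deviation_le (ζ : Z → ℝ) (hζ : Measurable ζ) {b R : ℝ} (hb0 : 0 < b)
    (hb : ∀ᵐ z ∂μ, |ζ z| ≤ b) (hR : ∫ z, ζ z ∂μ = R) (hR2 : ∫ z, ζ z ^ 2 ∂μ ≤ b * R)
    (M : ℕ) (τ : ℝ) :
    (Measure.pi fun _ : Fin M => μ) {z | M * (R / 2 + τ) ≤ |∑ j, ζ (z j) - M * R|} ≤
      ENNReal.ofReal (2 * Real.exp (-(M * τ / (2 * b)))) := by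
  have hint : Integrable ζ μ := Integrable.of_bound (C := b) (by fun_prop) (by simpa using hb)
  have hint2 : Integrable (fun z => ζ z ^ 2) μ := by
    refine Integrable.of_bound (C := b ^ 2) (by fun_prop) ?_
    filter_upwards [hb] with z hz
    rw [Real.norm_eq_abs, abs_pow]
    gcongr
  have hexp : ∀ l : ℝ, |l| ≤ 1 / b → ∫ z, Real.exp (l * ζ z) ∂μ ≤
      Real.exp (l * R + l ^ 2 * (b * R)) := by
    intro l hl
    have hi : Integrable (fun z => 1 + l * ζ z + l ^ 2 * ζ z ^ 2) μ :=
      ((integrable_const _).add (hint.const_mul _)).add (hint2.const_mul _)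
    calc ∫ z, Real.exp (l * ζ z) ∂μ ≤ ∫ z, (1 + l * ζ z + l ^ 2 * ζ z ^ 2) ∂μ := by
          apply integral_mono_of_nonneg (Filter.Eventually.of_forall fun z => (Real.exp_pos _).le) hi
          filter_upwards [hb] with z hz
          have : |l * ζ z| ≤ 1 := by
            rw [abs_mul]
            calc |l| * |ζ z| ≤ 1 / b * b := by gcongr
              _ = 1 := by field_simp
          have := (abs_le.1 (Real.abs_exp_sub_one_sub_id_le this)).2
          nlinarith
      _ = 1 + l * R + l ^ 2 * ∫ z, ζ z ^ 2 ∂μ := by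
          have h1 : Integrable (fun z => 1 + l * ζ z) μ := (integrable_const _).add (hint.const_mul _)
          rw [integral_add h1 (hint2.const_mul _),
            integral_add (integrable_const _) (hint.const_mul _), integral_const_mul,
            integral_const_mul, hR]
          simp
      _ ≤ 1 + l * R + l ^ 2 * (b * R) := by gcongr
      _ ≤ _ := by
          have := Real.add_one_le_exp (l * R + l ^ 2 * (b * R))
          linarith
  -- With this l the quadratic term l² b R equals l R / 2, which is the R / 2 allowed in the
  -- deviation.
  set l := 1 / (2 * b) with hl
  have hl0 : 0 < l := by positivity
  have hl1 : |l| ≤ 1 / b := by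
    rw [abs_of_pos hl0, hl]
    gcongr
    linarith
  have hlb : l * b = 1 / 2 := by rw [hl]; field_simp
  have hbd : ∀ k : ℝ, |k| ≤ 1 / b → ∀ᵐ z ∂μ, |k * ζ z| ≤ 1 := by
    intro k hk
    filter_upwards [hb] with z hz
    rw [abs_mul]
    calc |k| * |ζ z| ≤ 1 / b * b := by gcongr
      _ = 1 := by field_simp
  have hup := measure_sum_ge_le_of_exp μ (fun z => l * ζ z) (by fun_prop) (hbd l hl1) (hexp l hl1)
    M (l * (M * τ))
  have hlo := measure_sum_ge_le_of_exp μ (fun z => -l * ζ z) (by fun_prop)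
    (hbd (-l) (by rwa [abs_neg])) (hexp (-l) (by rwa [abs_neg])) M (l * (M * τ))
  have hsub : {z : Fin M → Z | M * (R / 2 + τ) ≤ |∑ j, ζ (z j) - M * R|} ⊆
      {z | M * (l * R + l ^ 2 * (b * R)) + l * (M * τ) ≤ ∑ j, l * ζ (z j)} ∪
      {z | M * (-l * R + (-l) ^ 2 * (b * R)) + l * (M * τ) ≤ ∑ j, -l * ζ (z j)} := by
    intro z hz
    simp only [Set.mem_ofPred_eq, Set.mem_union, ← Finset.mul_sum] at hz ⊢
    have e : l ^ 2 * (b * R) = l * (R / 2) := by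
      calc l ^ 2 * (b * R) = l * (l * b) * R := by ring
        _ = _ := by rw [hlb]; ring
    rw [neg_sq, e]
    rcases le_abs.1 hz with h | h
    · left
      have := mul_le_mul_of_nonneg_left h hl0.le
      linarith
    · right
      have := mul_le_mul_of_nonneg_left h hl0.le
      linarith
  refine (measure_mono hsub).trans ((measure_union_le _ _).trans ((add_le_add hup hlo).trans ?_))
  rw [← ENNReal.ofReal_add (Real.exp_pos _).le (Real.exp_pos _).le]
  apply ENNReal.ofReal_le_ofReal
  rw [← two_mul]
  apply le_of_eq
  congr 3
  rw [hl]; ring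

end Concentration

/-! ### Density matrices as real feature vectors. -/

section Features

/-- Real feature space of the quantum kernel: real and imaginary parts of the density matrix. -/
abbrev Feature (n : ℕ) : Type :=
  EuclideanSpace ℝ (((Fin n → Fin 2) × (Fin n → Fin 2)) ⊕ ((Fin n → Fin 2) × (Fin n → Fin 2)))

/-- The density matrix `|φ⟩⟨φ|` as a real vector. -/
def feature {n : ℕ} (φ : QState n) : Feature n :=
  WithLp.toLp 2 (Sum.elim (fun p => (φ p.1 * star (φ p.2)).re) (fun p => (φ p.1 * star (φ p.2)).im))

/-- This is tr(|φ⟩⟨φ| |χ⟩⟨χ|) = |⟨φ|χ⟩|². The trace is real, so pairing real and imaginary parts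
separately loses nothing. -/
theorem inner_feature {n : ℕ} (φ χ : QState n) :
    inner ℝ (feature φ) (feature χ) = qKernel φ χ := by
  have h : (qKernel φ χ : ℂ) = ∑ p : (Fin n → Fin 2) × (Fin n → Fin 2),
      star (φ p.1 * star (φ p.2)) * (χ p.1 * star (χ p.2)) := by
    rw [qKernel, Complex.ofReal_pow, ← Complex.mul_conj', PiLp.inner_apply, map_sum,
      Finset.sum_mul_sum, ← Finset.univ_product_univ, Finset.sum_product]
    refine Finset.sum_congr rfl fun i _ => Finset.sum_congr rfl fun j _ => ?_
    simp [mul_comm, mul_left_comm]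
  have h' := congrArg Complex.re h
  rw [Complex.ofReal_re, Complex.re_sum] at h'
  rw [h', PiLp.inner_apply, Fintype.sum_sum_type, ← Finset.sum_add_distrib]
  refine Finset.sum_congr rfl fun p _ => ?_
  simp [feature]
  ring

theorem qKernel_self {n : ℕ} {φ : QState n} (h : ‖φ‖ = 1) : qKernel φ φ = 1 := by
  rw [qKernel, inner_self_eq_norm_sq_to_K, h]; simp

theorem norm_feature {n : ℕ} {φ : QState n} (h : ‖φ‖ = 1) : ‖feature φ‖ = 1 := by
  have := inner_feature φ φ
  rw [qKernel_self h, real_inner_self_eq_norm_sq] at this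
  exact (pow_eq_one_iff_of_nonneg (norm_nonneg _) two_ne_zero).1 this

theorem qKernel_nonneg {n : ℕ} (φ χ : QState n) : 0 ≤ qKernel φ χ := by
  unfold qKernel; positivity

theorem qKernel_le_one {n : ℕ} {φ χ : QState n} (h : ‖φ‖ = 1) (h' : ‖χ‖ = 1) :
    qKernel φ χ ≤ 1 := by
  have := norm_inner_le_norm (𝕜 := ℂ) φ χ
  rw [h, h', mul_one] at this
  exact pow_le_one₀ (norm_nonneg _) this

theorem continuous_feature {n : ℕ} : Continuous (feature (n := n)) := by
  refine (PiLp.continuous_toLp 2 _).comp (continuous_pi fun p => ?_)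
  rcases p with p | p <;> simp only [Sum.elim_inl, Sum.elim_inr] <;> fun_prop

@[fun_prop]
theorem measurable_feature {n : ℕ} : Measurable (feature (n := n)) :=
  continuous_feature.measurable

/-- The rank-one matrix `w wᵀ` as a vector. -/
def outer {ι : Type*} (w : EuclideanSpace ℝ ι) : EuclideanSpace ℝ (ι × ι) :=
  WithLp.toLp 2 fun p => w p.1 * w p.2

/-- Squares of linear functionals become linear in the outer product. A single vector-valued
concentration bound then controls empirical second moments uniformly over all directions. -/
theorem inner_outer {ι : Type*} [Fintype ι] (u w : EuclideanSpace ℝ ι) :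
    inner ℝ (outer u) (outer w) = inner ℝ u w ^ 2 := by
  rw [PiLp.inner_apply, PiLp.inner_apply, sq, Finset.sum_mul_sum, ← Finset.univ_product_univ,
    Finset.sum_product]
  refine Finset.sum_congr rfl fun i _ => Finset.sum_congr rfl fun j _ => ?_
  simp [outer]
  ring

theorem norm_outer {ι : Type*} [Fintype ι] (w : EuclideanSpace ℝ ι) : ‖outer w‖ = ‖w‖ ^ 2 := by
  have := inner_outer w w
  rw [real_inner_self_eq_norm_sq, real_inner_self_eq_norm_sq] at this
  exact (pow_left_inj₀ (norm_nonneg _) (by positivity) two_ne_zero).1 this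

@[fun_prop]
theorem continuous_outer {ι : Type*} [Fintype ι] :
    Continuous (outer (ι := ι)) := by
  refine (PiLp.continuous_toLp 2 _).comp (continuous_pi fun p => ?_)
  fun_prop

@[fun_prop]
theorem measurable_outer {ι : Type*} [Fintype ι] : Measurable (outer (ι := ι)) :=
  continuous_outer.measurable

end Features

/-! ### Statistics of the SWAP test and of the kernel estimate. -/

section SwapTest

theorem abs_sgn (s : Bool) : |sgn s| = 1 := by cases s <;> simp [sgn]

theorem norm_tensor {n : ℕ} (φ χ : QState n) : ‖tensor φ χ‖ = ‖φ‖ * ‖χ‖ := by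
  have : ‖tensor φ χ‖ ^ 2 = (‖φ‖ * ‖χ‖) ^ 2 := by
    rw [mul_pow, EuclideanSpace.norm_sq_eq, EuclideanSpace.norm_sq_eq, EuclideanSpace.norm_sq_eq,
      Finset.sum_mul_sum, ← Finset.univ_product_univ, Finset.sum_product]
    simp [tensor, mul_pow]
  exact (pow_left_inj₀ (norm_nonneg _) (by positivity) two_ne_zero).1 this

theorem norm_swapOp {n : ℕ} (v : QPair n) : ‖swapOp v‖ = ‖v‖ := by
  have : ‖swapOp v‖ ^ 2 = ‖v‖ ^ 2 := by
    rw [EuclideanSpace.norm_sq_eq, EuclideanSpace.norm_sq_eq]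
    exact (Equiv.prodComm _ _).sum_comp fun p => ‖v p‖ ^ 2
  exact (pow_left_inj₀ (norm_nonneg _) (norm_nonneg _) two_ne_zero).1 this

/-- The swap trick: exchanging the registers turns the product inner product into ⟨φ|χ⟩⟨χ|φ⟩. -/
theorem inner_tensor_swapOp {n : ℕ} (φ χ : QState n) :
    inner ℂ (tensor φ χ) (swapOp (tensor φ χ)) = (qKernel φ χ : ℂ) := by
  rw [qKernel, Complex.ofReal_pow, ← Complex.mul_conj', PiLp.inner_apply, PiLp.inner_apply, map_sum,
    Finset.sum_mul_sum, ← Finset.univ_product_univ, Finset.sum_product]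
  refine Finset.sum_congr rfl fun i _ => Finset.sum_congr rfl fun j _ => ?_
  simp [tensor, swapOp]
  ring

/-- Expanding the squared norm, the two diagonal terms are one and the cross term is the swap
expectation. A single outcome therefore has mean exactly Q. -/
theorem swapProb_eq {n : ℕ} {φ χ : QState n} (h : ‖φ‖ = 1) (h' : ‖χ‖ = 1) (s : Bool) :
    swapProb φ χ s = (1 + sgn s * qKernel φ χ) / 2 := by
  rw [swapProb, norm_smul, mul_pow, norm_add_sq (𝕜 := ℂ), norm_smul, norm_swapOp, norm_tensor, h,
    h', inner_smul_right, inner_tensor_swapOp, ← Complex.ofReal_mul]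
  have : ‖(sgn s : ℂ)‖ = 1 := by rw [Complex.norm_real, Real.norm_eq_abs, abs_sgn]
  rw [this, RCLike.re_eq_complex_re, Complex.ofReal_re]
  norm_num
  ring

theorem swapProb_nonneg {n : ℕ} (φ χ : QState n) (s : Bool) : 0 ≤ swapProb φ χ s := by
  unfold swapProb; positivity

theorem sum_swapProb {n : ℕ} {φ χ : QState n} (h : ‖φ‖ = 1) (h' : ‖χ‖ = 1) :
    ∑ s, swapProb φ χ s = 1 := by
  simp only [swapProb_eq h h', Fintype.sum_bool, sgn]
  simp; ring

theorem sum_swapProb_mul_sgn {n : ℕ} {φ χ : QState n} (h : ‖φ‖ = 1) (h' : ‖χ‖ = 1) :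
    ∑ s, swapProb φ χ s * (sgn s - qKernel φ χ) = 0 := by
  simp only [swapProb_eq h h', Fintype.sum_bool, sgn]
  simp; ring

/-- Marginal of a finite product weight at one coordinate. -/
theorem sum_prod_mul_apply {ι κ : Type*} [Fintype ι] [DecidableEq ι] [Fintype κ]
    (p : ι → κ → ℝ) (hp : ∀ i, ∑ x, p i x = 1) (i₀ : ι) (f : κ → ℝ) :
    ∑ s : ι → κ, (∏ i, p i (s i)) * f (s i₀) = ∑ x, p i₀ x * f x := by
  have h := Finset.prod_univ_sum (fun _ : ι => (Finset.univ : Finset κ))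
    (fun i x => p i x * if i = i₀ then f x else 1)
  rw [Fintype.piFinset_univ] at h
  have h1 : ∀ s : ι → κ, (∏ i, p i (s i)) * f (s i₀) =
      ∏ i, (p i (s i) * if i = i₀ then f (s i) else 1) := by
    intro s
    rw [Finset.prod_mul_distrib, Finset.prod_ite_eq' Finset.univ i₀ fun i => f (s i)]
    simp
  rw [Finset.sum_congr rfl fun s _ => h1 s, ← h]
  rw [Finset.prod_eq_single i₀]
  · simp
  · intro i _ hi
    simp [hi, hp]
  · simp

theorem sum_prod_eq_one {ι κ : Type*} [Fintype ι] [DecidableEq ι] [Fintype κ]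
    (p : ι → κ → ℝ) (hp : ∀ i, ∑ x, p i x = 1) : ∑ s : ι → κ, ∏ i, p i (s i) = 1 := by
  have h := Finset.prod_univ_sum (fun _ : ι => (Finset.univ : Finset κ)) p
  rw [Fintype.piFinset_univ] at h
  rw [← h]
  simp [hp]

/-- Exponential moments of a sum of independent centred variables on finite spaces. -/
theorem sum_prod_mul_exp_le {m : ℕ} {κ : Type*} [Fintype κ] (p : κ → ℝ) (hp0 : ∀ x, 0 ≤ p x)
    (hp : ∑ x, p x = 1) (f : κ → ℝ) (hf : ∀ x, |f x| ≤ 1) (hf0 : ∑ x, p x * f x = 0) (l : ℝ) :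
    ∑ s : Fin m → κ, (∏ i, p (s i)) * Real.exp (l * ∑ i, f (s i)) ≤
      Real.exp (m * (l ^ 2 / 2)) := by
  have h := Finset.prod_univ_sum (fun _ : Fin m => (Finset.univ : Finset κ))
    (fun _ x => p x * Real.exp (l * f x))
  rw [Fintype.piFinset_univ] at h
  have h1 : ∀ s : Fin m → κ, (∏ i, p (s i)) * Real.exp (l * ∑ i, f (s i)) =
      ∏ i, (p (s i) * Real.exp (l * f (s i))) := by
    intro s
    rw [Finset.prod_mul_distrib, Finset.mul_sum, Real.exp_sum]
  rw [Finset.sum_congr rfl fun s _ => h1 s, ← h, Finset.prod_const, Finset.card_univ,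
    Fintype.card_fin, Real.exp_nat_mul]
  refine pow_le_pow_left₀ (Finset.sum_nonneg fun x _ => mul_nonneg (hp0 x) (Real.exp_pos _).le) ?_ m
  -- The exponential lies below its chord between −l and l. The sinh term then averages to zero.
  have hx : ∀ x, Real.exp (l * f x) ≤ Real.cosh l + f x * Real.sinh l := by
    intro x
    obtain ⟨h1, h2⟩ := abs_le.1 (hf x)
    have hc := convexOn_exp.2 (Set.mem_univ l) (Set.mem_univ (-l))
      (by linarith : 0 ≤ (1 + f x) / 2) (by linarith : 0 ≤ (1 - f x) / 2) (by ring)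
    simp only [smul_eq_mul] at hc
    rw [Real.cosh_eq, Real.sinh_eq]
    calc Real.exp (l * f x) = Real.exp ((1 + f x) / 2 * l + (1 - f x) / 2 * -l) := by ring_nf
      _ ≤ _ := hc
      _ = _ := by ring
  calc ∑ x, p x * Real.exp (l * f x) ≤ ∑ x, p x * (Real.cosh l + f x * Real.sinh l) :=
        Finset.sum_le_sum fun x _ => mul_le_mul_of_nonneg_left (hx x) (hp0 x)
    _ = (∑ x, p x) * Real.cosh l + (∑ x, p x * f x) * Real.sinh l := by
        rw [Finset.sum_mul, Finset.sum_mul, ← Finset.sum_add_distrib]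
        exact Finset.sum_congr rfl fun x _ => by ring
    _ = Real.cosh l := by rw [hp, hf0]; ring
    _ ≤ _ := Real.cosh_le_exp_half_sq l

theorem shotsProb_nonneg {n m : ℕ} (φ χ : QState n) (s : Fin m → Bool) : 0 ≤ shotsProb φ χ s :=
  Finset.prod_nonneg fun _ _ => swapProb_nonneg _ _ _

theorem sum_shotsProb {n m : ℕ} {φ χ : QState n} (h : ‖φ‖ = 1) (h' : ‖χ‖ = 1) :
    ∑ s : Fin m → Bool, shotsProb φ χ s = 1 :=
  sum_prod_eq_one (fun _ => swapProb φ χ) fun _ => sum_swapProb h h'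

theorem kernelEst_sub {m : ℕ} (hm : 0 < m) (s : Fin m → Bool) (q : ℝ) :
    kernelEst s - q = (∑ l, (sgn (s l) - q)) / m := by
  have : (m : ℝ) ≠ 0 := by positivity
  rw [kernelEst, Finset.sum_sub_distrib]
  simp
  field_simp

/-- Hoeffding bound for the kernel estimate. -/
theorem sum_shotsProb_deviation_le {n m : ℕ} (hm : 0 < m) {φ χ : QState n} (h : ‖φ‖ = 1)
    (h' : ‖χ‖ = 1) {e : ℝ} (he : 0 ≤ e) :
    ∑ s : Fin m → Bool, shotsProb φ χ s * (if e < |kernelEst s - qKernel φ χ| then 1 else 0) ≤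
      2 * Real.exp (-(m * e ^ 2 / 8)) := by
  set q := qKernel φ χ
  have hm0 : (0 : ℝ) < m := by positivity
  -- Centred outcomes are bounded by 2; halving them brings them into [-1, 1]. With exponential
  -- parameter e / 2 this produces the 8 in the exponent.
  set f : Bool → ℝ := fun x => (sgn x - q) / 2 with hf
  have hfb : ∀ x, |f x| ≤ 1 := by
    intro x
    have h0 := qKernel_nonneg φ χ
    have h1 := qKernel_le_one h h'
    rw [hf]
    simp only [abs_le]
    cases x <;> simp only [sgn] <;> simp <;> constructor <;> linarith
  have hf0 : ∑ x, swapProb φ χ x * f x = 0 := by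
    have := sum_swapProb_mul_sgn h h'
    simp only [hf, ← mul_div_assoc, ← Finset.sum_div]
    rw [this, zero_div]
  have hexp := fun l => sum_prod_mul_exp_le (m := m) (swapProb φ χ) (swapProb_nonneg φ χ)
    (sum_swapProb h h') f hfb hf0 l
  have hpt : ∀ s : Fin m → Bool, (if e < |kernelEst s - q| then (1 : ℝ) else 0) ≤
      Real.exp (-(m * (e / 2) ^ 2)) * (Real.exp (e / 2 * ∑ i, f (s i)) +
        Real.exp (-(e / 2) * ∑ i, f (s i))) := by
    intro s
    have hS : ∑ i, f (s i) = m * (kernelEst s - q) / 2 := by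
      rw [kernelEst_sub hm, hf, ← Finset.sum_div]
      field_simp
    split_ifs with hc
    · have key : m * (e / 2) ^ 2 ≤ e / 2 * |∑ i, f (s i)| := by
        rw [hS, abs_div, abs_mul, abs_of_pos hm0]
        have := mul_le_mul_of_nonneg_left hc.le (mul_nonneg he hm0.le)
        simp only [abs_two]
        linarith
      rw [Real.exp_neg, inv_mul_eq_div, le_div_iff₀ (Real.exp_pos _), one_mul]
      have p1 := Real.exp_pos (e / 2 * ∑ i, f (s i))
      have p2 := Real.exp_pos (-(e / 2) * ∑ i, f (s i))
      rcases abs_cases (∑ i, f (s i)) with ⟨ha, _⟩ | ⟨ha, _⟩ <;> rw [ha] at key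
      · linarith [Real.exp_le_exp.2 key]
      · have := Real.exp_le_exp.2 key
        rw [mul_neg, ← neg_mul] at this
        linarith
    · positivity
  calc _ ≤ ∑ s : Fin m → Bool, shotsProb φ χ s *
        (Real.exp (-(m * (e / 2) ^ 2)) * (Real.exp (e / 2 * ∑ i, f (s i)) +
          Real.exp (-(e / 2) * ∑ i, f (s i)))) :=
        Finset.sum_le_sum fun s _ => mul_le_mul_of_nonneg_left (hpt s) (shotsProb_nonneg _ _ _)
    _ = Real.exp (-(m * (e / 2) ^ 2)) *
        (∑ s : Fin m → Bool, shotsProb φ χ s * Real.exp (e / 2 * ∑ i, f (s i)) +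
          ∑ s : Fin m → Bool, shotsProb φ χ s * Real.exp (-(e / 2) * ∑ i, f (s i))) := by
        rw [← Finset.sum_add_distrib, Finset.mul_sum]
        exact Finset.sum_congr rfl fun s _ => by ring
    _ ≤ Real.exp (-(m * (e / 2) ^ 2)) * (Real.exp (m * ((e / 2) ^ 2 / 2)) +
          Real.exp (m * ((-(e / 2)) ^ 2 / 2))) := by
        gcongr
        · exact hexp (e / 2)
        · exact hexp (-(e / 2))
    _ = _ := by
        rw [neg_sq, ← two_mul, mul_left_comm, ← Real.exp_add]
        congr 2
        ring

/-- The estimate is unbiased. -/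
theorem sum_shotsProb_mul_sub {n m : ℕ} (hm : 0 < m) {φ χ : QState n} (h : ‖φ‖ = 1)
    (h' : ‖χ‖ = 1) :
    ∑ s : Fin m → Bool, shotsProb φ χ s * (kernelEst s - qKernel φ χ) = 0 := by
  simp only [kernelEst_sub hm, Finset.sum_div, Finset.mul_sum]
  rw [Finset.sum_comm]
  refine Finset.sum_eq_zero fun l _ => ?_
  have := sum_prod_mul_apply (fun _ : Fin m => swapProb φ χ) (fun _ => sum_swapProb h h') l
    (fun x => (sgn x - qKernel φ χ) / m)
  unfold shotsProb
  rw [this]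
  simp only [← mul_div_assoc, ← Finset.sum_div]
  rw [sum_swapProb_mul_sgn h h', zero_div]

/-- Marginal of a finite product weight at two coordinates. -/
theorem sum_prod_mul_apply_mul_apply {ι κ : Type*} [Fintype ι] [DecidableEq ι] [Fintype κ]
    (p : ι → κ → ℝ) (hp : ∀ i, ∑ x, p i x = 1) {i j : ι} (hij : i ≠ j) (f g : κ → ℝ) :
    ∑ s : ι → κ, (∏ k, p k (s k)) * (f (s i) * g (s j)) =
      (∑ x, p i x * f x) * ∑ x, p j x * g x := by
  have h := Finset.prod_univ_sum (fun _ : ι => (Finset.univ : Finset κ))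
    (fun k x => p k x * ((if k = i then f x else 1) * if k = j then g x else 1))
  rw [Fintype.piFinset_univ] at h
  have h1 : ∀ s : ι → κ, (∏ k, p k (s k)) * (f (s i) * g (s j)) =
      ∏ k, (p k (s k) * ((if k = i then f (s k) else 1) * if k = j then g (s k) else 1)) := by
    intro s
    rw [Finset.prod_mul_distrib, Finset.prod_mul_distrib,
      Finset.prod_ite_eq' Finset.univ i fun k => f (s k),
      Finset.prod_ite_eq' Finset.univ j fun k => g (s k)]
    simp
  rw [Finset.sum_congr rfl fun s _ => h1 s, ← h, ← Finset.prod_subset (Finset.subset_univ {i, j}),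
    Finset.prod_pair hij]
  · simp [hij, hij.symm]
  · intro k _ hk
    simp only [Finset.mem_insert, Finset.mem_singleton, not_or] at hk
    simp [hk.1, hk.2, hp]

/-- The variance of the estimate is at most `1 / m`. -/
theorem sum_shotsProb_mul_sq_le {n m : ℕ} (hm : 0 < m) {φ χ : QState n} (h : ‖φ‖ = 1)
    (h' : ‖χ‖ = 1) :
    ∑ s : Fin m → Bool, shotsProb φ χ s * (kernelEst s - qKernel φ χ) ^ 2 ≤ 1 / m := by
  set q := qKernel φ χ
  have hm0 : (0 : ℝ) < m := by positivity
  have hdiag : ∀ l : Fin m, ∑ s : Fin m → Bool, shotsProb φ χ s *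
      ((sgn (s l) - q) * (sgn (s l) - q)) ≤ 1 := by
    intro l
    have := sum_prod_mul_apply (fun _ : Fin m => swapProb φ χ) (fun _ => sum_swapProb h h') l
      (fun x => (sgn x - q) * (sgn x - q))
    unfold shotsProb
    rw [this]
    simp only [swapProb_eq h h', Fintype.sum_bool, sgn]
    simp only [if_true, Bool.false_eq_true, if_false]
    nlinarith [sq_nonneg q]
  have hoff : ∀ l k : Fin m, l ≠ k → ∑ s : Fin m → Bool, shotsProb φ χ s *
      ((sgn (s l) - q) * (sgn (s k) - q)) = 0 := by
    intro l k hlk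
    have := sum_prod_mul_apply_mul_apply (fun _ : Fin m => swapProb φ χ)
      (fun _ => sum_swapProb h h') hlk (fun x => sgn x - q) (fun x => sgn x - q)
    unfold shotsProb
    rw [this, sum_swapProb_mul_sgn h h', zero_mul]
  have hexp : ∀ s : Fin m → Bool, shotsProb φ χ s * (kernelEst s - q) ^ 2 =
      (∑ l, ∑ k, shotsProb φ χ s * ((sgn (s l) - q) * (sgn (s k) - q))) / m ^ 2 := by
    intro s
    rw [kernelEst_sub hm, div_pow, sq (∑ l, _), Finset.sum_mul_sum, ← mul_div_assoc, Finset.mul_sum]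
    simp only [Finset.mul_sum]
  simp only [hexp, ← Finset.sum_div]
  rw [div_le_div_iff₀ (by positivity) hm0, one_mul]
  have : ∑ s : Fin m → Bool, ∑ l, ∑ k, shotsProb φ χ s * ((sgn (s l) - q) * (sgn (s k) - q)) ≤ m := by
    rw [Finset.sum_comm]
    calc _ ≤ ∑ l : Fin m, (1 : ℝ) := by
          refine Finset.sum_le_sum fun l _ => ?_
          rw [Finset.sum_comm, Finset.sum_eq_single l]
          · exact hdiag l
          · exact fun k _ hk => hoff l k hk.symm
          · simp
      _ = m := by simp
  nlinarith

end SwapTest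

/-! ### Integration against the joint law of data and shots. -/

section RunLaw

variable {X : Type*} {n N M m : ℕ}

/-- Conditional probability of the SWAP-test outcomes for pairs from two lists of points. -/
def blockProb (ψ : X → QState n) (a : Fin N → X × ℝ) (x : Fin M → X × ℝ)
    (s : Fin N → Fin M → Fin m → Bool) : ℝ :=
  ∏ i, ∏ j, shotsProb (ψ (a i).1) (ψ (x j).1) (s i j)

theorem blockProb_nonneg (ψ : X → QState n) (a : Fin N → X × ℝ) (x : Fin M → X × ℝ)
    (s : Fin N → Fin M → Fin m → Bool) : 0 ≤ blockProb ψ a x s :=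
  Finset.prod_nonneg fun _ _ => Finset.prod_nonneg fun _ _ => shotsProb_nonneg _ _ _

theorem sum_blockProb {ψ : X → QState n} (hψ : ∀ x, ‖ψ x‖ = 1) (a : Fin N → X × ℝ)
    (x : Fin M → X × ℝ) : ∑ s : Fin N → Fin M → Fin m → Bool, blockProb ψ a x s = 1 :=
  sum_prod_eq_one (fun i (t : Fin M → Fin m → Bool) =>
    ∏ j, shotsProb (ψ (a i).1) (ψ (x j).1) (t j)) fun i =>
    sum_prod_eq_one (fun j (u : Fin m → Bool) => shotsProb (ψ (a i).1) (ψ (x j).1) u) fun _ =>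
      sum_shotsProb (hψ _) (hψ _)

theorem sum_blockProb_mul {ψ : X → QState n} (hψ : ∀ x, ‖ψ x‖ = 1) (a : Fin N → X × ℝ)
    (x : Fin M → X × ℝ) (c : ℝ) :
    ∑ s : Fin N → Fin M → Fin m → Bool, blockProb ψ a x s * c = c := by
  rw [← Finset.sum_mul, sum_blockProb hψ, one_mul]

theorem sum_blockProb_mul_apply {ψ : X → QState n} (hψ : ∀ x, ‖ψ x‖ = 1) (a : Fin N → X × ℝ)
    (x : Fin M → X × ℝ) (i : Fin N) (j : Fin M) (f : (Fin m → Bool) → ℝ) :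
    ∑ s : Fin N → Fin M → Fin m → Bool, blockProb ψ a x s * f (s i j) =
      ∑ u, shotsProb (ψ (a i).1) (ψ (x j).1) u * f u := by
  have hrow : ∀ i, ∑ t : Fin M → Fin m → Bool,
      ∏ j, shotsProb (ψ (a i).1) (ψ (x j).1) (t j) = 1 := fun i =>
    sum_prod_eq_one (fun j (u : Fin m → Bool) => shotsProb (ψ (a i).1) (ψ (x j).1) u) fun _ =>
      sum_shotsProb (hψ _) (hψ _)
  have h1 := sum_prod_mul_apply (fun i (t : Fin M → Fin m → Bool) =>
    ∏ j, shotsProb (ψ (a i).1) (ψ (x j).1) (t j)) hrow i (fun t => f (t j))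
  have h2 := sum_prod_mul_apply (fun j (u : Fin m → Bool) => shotsProb (ψ (a i).1) (ψ (x j).1) u)
    (fun _ => sum_shotsProb (hψ _) (hψ _)) j f
  exact h1.trans h2

/-- Union bound over all kernel estimates of a block. -/
theorem sum_blockProb_deviation_le (hm : 0 < m) {ψ : X → QState n} (hψ : ∀ x, ‖ψ x‖ = 1)
    (a : Fin N → X × ℝ) (x : Fin M → X × ℝ) {e : ℝ} (he : 0 ≤ e) :
    ∑ s : Fin N → Fin M → Fin m → Bool, blockProb ψ a x s *
      (if ∃ i j, e < |kernelEst (s i j) - qKernel (ψ (a i).1) (ψ (x j).1)| then 1 else 0) ≤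
      N * M * (2 * Real.exp (-(m * e ^ 2 / 8))) := by
  set dev : Fin N → Fin M → (Fin m → Bool) → ℝ := fun i j u =>
    if e < |kernelEst u - qKernel (ψ (a i).1) (ψ (x j).1)| then 1 else 0 with hdev
  have hdev0 : ∀ i j u, 0 ≤ dev i j u := by
    intro i j u
    simp only [hdev]
    split_ifs <;> norm_num
  have hpt : ∀ s : Fin N → Fin M → Fin m → Bool,
      (if ∃ i j, e < |kernelEst (s i j) - qKernel (ψ (a i).1) (ψ (x j).1)| then (1 : ℝ) else 0) ≤
        ∑ i, ∑ j, dev i j (s i j) := by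
    intro s
    split_ifs with h
    · obtain ⟨i, j, h⟩ := h
      have h1 : (1 : ℝ) = dev i j (s i j) := by simp only [hdev]; rw [if_pos h]
      rw [h1]
      exact (Finset.single_le_sum (f := fun j => dev i j (s i j))
        (fun j _ => hdev0 _ _ _) (Finset.mem_univ j)).trans
        (Finset.single_le_sum (f := fun i => ∑ j, dev i j (s i j))
          (fun i _ => Finset.sum_nonneg fun j _ => hdev0 _ _ _) (Finset.mem_univ i))
    · exact Finset.sum_nonneg fun i _ => Finset.sum_nonneg fun j _ => hdev0 _ _ _
  calc _ ≤ ∑ s : Fin N → Fin M → Fin m → Bool, blockProb ψ a x s * ∑ i, ∑ j, dev i j (s i j) :=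
        Finset.sum_le_sum fun s _ => mul_le_mul_of_nonneg_left (hpt s) (blockProb_nonneg _ _ _ _)
    _ = ∑ i, ∑ j, ∑ s : Fin N → Fin M → Fin m → Bool, blockProb ψ a x s * dev i j (s i j) := by
        simp only [Finset.mul_sum]
        rw [Finset.sum_comm]
        exact Finset.sum_congr rfl fun i _ => Finset.sum_comm
    _ ≤ ∑ i : Fin N, ∑ j : Fin M, 2 * Real.exp (-(m * e ^ 2 / 8)) := by
        refine Finset.sum_le_sum fun i _ => Finset.sum_le_sum fun j _ => ?_
        rw [sum_blockProb_mul_apply hψ a x i j]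
        exact sum_shotsProb_deviation_le hm (hψ _) (hψ _) he
    _ = _ := by simp; ring

theorem runDensity_eq (ψ : X → QState n) (ω : Run X N M m) :
    runDensity ψ ω = blockProb ψ ω.1.1 ω.1.1 ω.2.1 * blockProb ψ ω.1.1 ω.1.2 ω.2.2 := rfl

variable [MeasurableSpace X]

theorem measurable_swapProb {Ω : Type*} [MeasurableSpace Ω] {φ χ : Ω → QState n} {s : Ω → Bool}
    (hφ : Measurable φ) (hχ : Measurable χ) (hs : Measurable s) (h : ∀ ω, ‖φ ω‖ = 1)
    (h' : ∀ ω, ‖χ ω‖ = 1) : Measurable fun ω => swapProb (φ ω) (χ ω) (s ω) := by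
  simp only [swapProb_eq (h _) (h' _), ← inner_feature]
  have : Measurable sgn := measurable_of_finite _
  fun_prop

theorem measurable_runDensity {ψ : X → QState n} (hm : Measurable ψ) (hψ : ∀ x, ‖ψ x‖ = 1) :
    Measurable (runDensity ψ : Run X N M m → ℝ) := by
  unfold runDensity shotsProb
  refine Measurable.mul ?_ ?_
  · refine Finset.measurable_fun_prod _ fun i _ => Finset.measurable_fun_prod _ fun j _ =>
      Finset.measurable_fun_prod _ fun l _ => ?_
    exact measurable_swapProb (by fun_prop) (by fun_prop) (by fun_prop) (fun _ => hψ _)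
      fun _ => hψ _
  · refine Finset.measurable_fun_prod _ fun i _ => Finset.measurable_fun_prod _ fun j _ =>
      Finset.measurable_fun_prod _ fun l _ => ?_
    exact measurable_swapProb (by fun_prop) (by fun_prop) (by fun_prop) (fun _ => hψ _)
      fun _ => hψ _

/-- Tonelli, with the counting measure written as finite sums: events can then be bounded
conditionally on the data, or by summing out a block of shots first. -/
theorem runLaw_apply {ψ : X → QState n} (hm : Measurable ψ) (hψ : ∀ x, ‖ψ x‖ = 1)
    (D : Measure (X × ℝ)) [IsProbabilityMeasure D] {A : Set (Run X N M m)}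
    (hA : MeasurableSet A) :
    runLaw ψ D N M m A = ∫⁻ a, ∫⁻ x, ∑ s, ∑ u,
      A.indicator (fun ω => ENNReal.ofReal (runDensity ψ ω)) ((a, x), (s, u))
        ∂(Measure.pi fun _ : Fin M => D) ∂(Measure.pi fun _ : Fin N => D) := by
  have hmeas : Measurable (A.indicator fun ω : Run X N M m => ENNReal.ofReal (runDensity ψ ω)) :=
    (ENNReal.measurable_ofReal.comp (measurable_runDensity hm hψ)).indicator hA
  rw [runLaw, withDensity_apply _ hA, ← lintegral_indicator hA, lintegral_prod _ hmeas.aemeasurable]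
  rw [lintegral_prod]
  · simp only [lintegral_count, tsum_fintype, Fintype.sum_prod_type]
  · exact hmeas.lintegral_prod_right'.aemeasurable

omit [MeasurableSpace X] in
theorem indicator_runDensity {ψ : X → QState n} (A : Set (Run X N M m))
    (a : Fin N → X × ℝ) (x : Fin M → X × ℝ) (s : Fin N → Fin N → Fin m → Bool)
    (u : Fin N → Fin M → Fin m → Bool) :
    A.indicator (fun ω => ENNReal.ofReal (runDensity ψ ω)) ((a, x), (s, u)) =
      ENNReal.ofReal (blockProb ψ a a s * (blockProb ψ a x u *
        A.indicator (fun _ => (1 : ℝ)) ((a, x), (s, u)))) := by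
  by_cases h : ((a, x), (s, u)) ∈ A
  · rw [Set.indicator_of_mem h, Set.indicator_of_mem h, runDensity_eq, mul_one]
  · rw [Set.indicator_of_notMem h, Set.indicator_of_notMem h]; simp

theorem sum_ofReal {α : Type*} [Fintype α] {f : α → ℝ} (hf : ∀ x, 0 ≤ f x) :
    ∑ x, ENNReal.ofReal (f x) = ENNReal.ofReal (∑ x, f x) :=
  (ENNReal.ofReal_sum_of_nonneg fun x _ => hf x).symm

/-- Events whose conditional probability given all data is bounded. -/
theorem runLaw_le_of_shots {ψ : X → QState n} (hm : Measurable ψ) (hψ : ∀ x, ‖ψ x‖ = 1)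
    (D : Measure (X × ℝ)) [IsProbabilityMeasure D] {A : Set (Run X N M m)}
    (hA : MeasurableSet A) {η : ℝ}
    (h : ∀ a x, ∑ s, ∑ u, blockProb ψ a a s * (blockProb ψ a x u *
      A.indicator (fun _ => (1 : ℝ)) ((a, x), (s, u))) ≤ η) :
    runLaw ψ D N M m A ≤ ENNReal.ofReal η := by
  rw [runLaw_apply hm hψ D hA]
  have hpt : ∀ a x, ∑ s, ∑ u, A.indicator (fun ω => ENNReal.ofReal (runDensity ψ ω))
      ((a, x), (s, u)) ≤ ENNReal.ofReal η := by
    intro a x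
    simp only [indicator_runDensity]
    have h0 : ∀ s u, 0 ≤ blockProb ψ a a s * (blockProb ψ a x u *
        A.indicator (fun _ => (1 : ℝ)) ((a, x), (s, u))) := fun s u =>
      mul_nonneg (blockProb_nonneg _ _ _ _) (mul_nonneg (blockProb_nonneg _ _ _ _)
        (Set.indicator_nonneg (fun _ _ => zero_le_one) _))
    simp only [sum_ofReal (h0 _)]
    rw [sum_ofReal fun s => Finset.sum_nonneg fun u _ => h0 s u]
    exact ENNReal.ofReal_le_ofReal (h a x)
  calc _ ≤ ∫⁻ _, ∫⁻ _, ENNReal.ofReal η ∂(Measure.pi fun _ : Fin M => D)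
        ∂(Measure.pi fun _ : Fin N => D) :=
        lintegral_mono fun a => lintegral_mono fun x => hpt a x
    _ = _ := by simp

theorem runLaw_trainShots_le (hm0 : 0 < m) {ψ : X → QState n} (hm : Measurable ψ)
    (hψ : ∀ x, ‖ψ x‖ = 1) (D : Measure (X × ℝ)) [IsProbabilityMeasure D] {e : ℝ} (he : 0 ≤ e) :
    runLaw ψ D N M m {ω | ∃ i j, e < |kernelEst (ω.2.1 i j) -
      qKernel (ψ (ω.1.1 i).1) (ψ (ω.1.1 j).1)|} ≤
      ENNReal.ofReal (N * N * (2 * Real.exp (-(m * e ^ 2 / 8)))) := by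
  have hk : Measurable (kernelEst (m := m)) := measurable_of_finite _
  apply runLaw_le_of_shots hm hψ D
  · simp only [← inner_feature, Set.ofPred_exists]
    refine MeasurableSet.iUnion fun i => MeasurableSet.iUnion fun j =>
      measurableSet_lt measurable_const (by fun_prop)
  · intro a x
    have hind : ∀ (s : Fin N → Fin N → Fin m → Bool) (u : Fin N → Fin M → Fin m → Bool),
        Set.indicator {ω : Run X N M m | ∃ i j, e < |kernelEst (ω.2.1 i j) -
          qKernel (ψ (ω.1.1 i).1) (ψ (ω.1.1 j).1)|} (fun _ => (1 : ℝ)) ((a, x), (s, u)) =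
          if ∃ i j, e < |kernelEst (s i j) - qKernel (ψ (a i).1) (ψ (a j).1)| then 1 else 0 := by
      intro s u
      classical
      rw [Set.indicator_apply]
      congr
    simp only [hind, ← Finset.mul_sum, sum_blockProb_mul hψ]
    exact sum_blockProb_deviation_le hm0 hψ a a he

theorem runLaw_valShots_le (hm0 : 0 < m) {ψ : X → QState n} (hm : Measurable ψ)
    (hψ : ∀ x, ‖ψ x‖ = 1) (D : Measure (X × ℝ)) [IsProbabilityMeasure D] {e : ℝ} (he : 0 ≤ e) :
    runLaw ψ D N M m {ω | ∃ i j, e < |kernelEst (ω.2.2 i j) -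
      qKernel (ψ (ω.1.1 i).1) (ψ (ω.1.2 j).1)|} ≤
      ENNReal.ofReal (N * M * (2 * Real.exp (-(m * e ^ 2 / 8)))) := by
  have hk : Measurable (kernelEst (m := m)) := measurable_of_finite _
  apply runLaw_le_of_shots hm hψ D
  · simp only [← inner_feature, Set.ofPred_exists]
    refine MeasurableSet.iUnion fun i => MeasurableSet.iUnion fun j =>
      measurableSet_lt measurable_const (by fun_prop)
  · intro a x
    have hind : ∀ (s : Fin N → Fin N → Fin m → Bool) (u : Fin N → Fin M → Fin m → Bool),
        Set.indicator {ω : Run X N M m | ∃ i j, e < |kernelEst (ω.2.2 i j) -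
          qKernel (ψ (ω.1.1 i).1) (ψ (ω.1.2 j).1)|} (fun _ => (1 : ℝ)) ((a, x), (s, u)) =
          if ∃ i j, e < |kernelEst (u i j) - qKernel (ψ (a i).1) (ψ (x j).1)| then 1 else 0 := by
      intro s u
      classical
      rw [Set.indicator_apply]
      congr
    simp only [hind, ← Finset.mul_sum, sum_blockProb_mul hψ]
    exact sum_blockProb_deviation_le hm0 hψ a x he

/-- Events that do not involve the validation shots and whose conditional probability given the
training data and the training shots is bounded. -/
theorem runLaw_le_of_validation {ψ : X → QState n} (hm : Measurable ψ) (hψ : ∀ x, ‖ψ x‖ = 1)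
    (D : Measure (X × ℝ)) [IsProbabilityMeasure D]
    {A : (Fin N → X × ℝ) → (Fin N → Fin N → Fin m → Bool) → Set (Fin M → X × ℝ)}
    (hA : MeasurableSet {ω : Run X N M m | ω.1.2 ∈ A ω.1.1 ω.2.1}) {η : ENNReal}
    (h : ∀ a s, (Measure.pi fun _ : Fin M => D) (A a s) ≤ η) :
    runLaw ψ D N M m {ω | ω.1.2 ∈ A ω.1.1 ω.2.1} ≤ η := by
  classical
  rw [runLaw_apply hm hψ D hA]
  have hAs : ∀ a s, MeasurableSet (A a s) := by
    intro a s
    -- The event ignores the validation shots, so its section is obtained by inserting arbitrary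
    -- constant outcomes for them.
    have hι : Measurable fun x : Fin M → X × ℝ =>
        (((a, x), (s, fun _ _ _ => true)) : Run X N M m) := by fun_prop
    exact hι hA
  have hpt : ∀ a x, ∑ s, ∑ u, {ω : Run X N M m | ω.1.2 ∈ A ω.1.1 ω.2.1}.indicator
      (fun ω => ENNReal.ofReal (runDensity ψ ω)) ((a, x), (s, u)) =
      ∑ s, ENNReal.ofReal (blockProb ψ a a s) * (A a s).indicator 1 x := by
    intro a x
    have hind : ∀ (s : Fin N → Fin N → Fin m → Bool) (u : Fin N → Fin M → Fin m → Bool),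
        Set.indicator {ω : Run X N M m | ω.1.2 ∈ A ω.1.1 ω.2.1} (fun _ => (1 : ℝ))
          ((a, x), (s, u)) = (A a s).indicator (fun _ => 1) x := fun s u => rfl
    simp only [indicator_runDensity, hind]
    refine Finset.sum_congr rfl fun s _ => ?_
    rw [sum_ofReal fun u => mul_nonneg (blockProb_nonneg _ _ _ _)
      (mul_nonneg (blockProb_nonneg _ _ _ _) (Set.indicator_nonneg (fun _ _ => zero_le_one) _))]
    rw [← Finset.mul_sum, sum_blockProb_mul hψ]
    by_cases hx : x ∈ A a s
    · simp [hx]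
    · simp [hx]
  simp only [hpt]
  have hin : ∀ a, ∫⁻ x, ∑ s, ENNReal.ofReal (blockProb ψ a a s) * (A a s).indicator 1 x
      ∂(Measure.pi fun _ : Fin M => D) ≤ η := by
    intro a
    rw [lintegral_finsetSum _ fun s _ =>
      ((measurable_one.indicator (hAs a s)).const_mul _)]
    calc _ ≤ ∑ s : Fin N → Fin N → Fin m → Bool, ENNReal.ofReal (blockProb ψ a a s) * η := by
          refine Finset.sum_le_sum fun s _ => ?_
          rw [lintegral_const_mul _ (measurable_one.indicator (hAs a s)),
            lintegral_indicator_one (hAs a s)]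
          gcongr
          exact h a s
      _ = η := by
          rw [← Finset.sum_mul, sum_ofReal fun s => blockProb_nonneg _ _ _ _, sum_blockProb hψ]
          simp
  calc _ ≤ ∫⁻ _, η ∂(Measure.pi fun _ : Fin N => D) := lintegral_mono hin
    _ = η := by simp

/-- Events that involve the training data only. -/
theorem runLaw_train_le {ψ : X → QState n} (hm : Measurable ψ) (hψ : ∀ x, ‖ψ x‖ = 1)
    (D : Measure (X × ℝ)) [IsProbabilityMeasure D] {A : Set (Fin N → X × ℝ)}
    (hA : MeasurableSet A) :
    runLaw ψ D N M m {ω | ω.1.1 ∈ A} ≤ (Measure.pi fun _ : Fin N => D) A := by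
  classical
  have hA' : MeasurableSet {ω : Run X N M m | ω.1.1 ∈ A} :=
    (measurable_fst.comp measurable_fst) hA
  rw [runLaw_apply hm hψ D hA', ← lintegral_indicator_one hA]
  refine lintegral_mono fun a => ?_
  have hpt : ∀ x, ∑ s, ∑ u, {ω : Run X N M m | ω.1.1 ∈ A}.indicator
      (fun ω => ENNReal.ofReal (runDensity ψ ω)) ((a, x), (s, u)) = A.indicator 1 a := by
    intro x
    have hind : ∀ (s : Fin N → Fin N → Fin m → Bool) (u : Fin N → Fin M → Fin m → Bool),
        Set.indicator {ω : Run X N M m | ω.1.1 ∈ A} (fun _ => (1 : ℝ))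
          ((a, x), (s, u)) = A.indicator (fun _ => 1) a := fun s u => rfl
    simp only [indicator_runDensity, hind]
    have h0 : ∀ (s : Fin N → Fin N → Fin m → Bool) (u : Fin N → Fin M → Fin m → Bool),
        0 ≤ blockProb ψ a a s * (blockProb ψ a x u *
        A.indicator (fun _ => (1 : ℝ)) a) := fun s u =>
      mul_nonneg (blockProb_nonneg _ _ _ _) (mul_nonneg (blockProb_nonneg _ _ _ _)
        (Set.indicator_nonneg (fun _ _ => zero_le_one) _))
    rw [Finset.sum_congr rfl fun s _ => sum_ofReal (h0 s),
      sum_ofReal fun s => Finset.sum_nonneg fun u _ => h0 s u]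
    simp only [← Finset.mul_sum, sum_blockProb_mul hψ]
    by_cases ha : a ∈ A <;> simp [ha]
  simp only [hpt]
  simp

/-- Almost sure properties of a labelled point hold for all training points and all validation
points. -/
theorem ae_runLaw (ψ : X → QState n) (D : Measure (X × ℝ)) [IsProbabilityMeasure D]
    {P : X × ℝ → Prop} (hP : ∀ᵐ z ∂D, P z) :
    ∀ᵐ ω ∂(runLaw ψ D N M m), (∀ i, P (ω.1.1 i)) ∧ ∀ j, P (ω.1.2 j) := by
  have h1 : ∀ (k : ℕ), ∀ᵐ z ∂(Measure.pi fun _ : Fin k => D), ∀ i, P (z i) := fun k =>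
    ae_all_iff.2 fun i => (Measure.quasiMeasurePreserving_eval (fun _ : Fin k => D) i).ae hP
  refine (withDensity_absolutelyContinuous _ _).ae_le ?_
  have hf : Measure.QuasiMeasurePreserving (fun ω : Run X N M m => ω.1.1)
      (((Measure.pi fun _ : Fin N => D).prod (Measure.pi fun _ : Fin M => D)).prod
        (Measure.count : Measure (Shots N M m))) (Measure.pi fun _ : Fin N => D) :=
    Measure.quasiMeasurePreserving_fst.comp Measure.quasiMeasurePreserving_fst
  have hs : Measure.QuasiMeasurePreserving (fun ω : Run X N M m => ω.1.2)
      (((Measure.pi fun _ : Fin N => D).prod (Measure.pi fun _ : Fin M => D)).prod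
        (Measure.count : Measure (Shots N M m))) (Measure.pi fun _ : Fin M => D) :=
    Measure.quasiMeasurePreserving_snd.comp Measure.quasiMeasurePreserving_fst
  filter_upwards [hf.ae (h1 N), hs.ae (h1 M)] with ω h h' using ⟨h, h'⟩

end RunLaw

/-! ### Empirical means, root mean squares and vector averages. -/

section Averages

variable {N : ℕ}

/-- Empirical mean. -/
def avg (f : Fin N → ℝ) : ℝ := (∑ i, f i) / N

/-- Root mean square. -/
def rms (f : Fin N → ℝ) : ℝ := √(avg fun i => f i ^ 2)

theorem avg_mono {f g : Fin N → ℝ} (h : ∀ i, f i ≤ g i) : avg f ≤ avg g :=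
  div_le_div_of_nonneg_right (Finset.sum_le_sum fun i _ => h i) (Nat.cast_nonneg N)

theorem avg_nonneg {f : Fin N → ℝ} (h : ∀ i, 0 ≤ f i) : 0 ≤ avg f :=
  div_nonneg (Finset.sum_nonneg fun i _ => h i) (Nat.cast_nonneg N)

theorem avg_add (f g : Fin N → ℝ) : avg (fun i => f i + g i) = avg f + avg g := by
  simp only [avg, Finset.sum_add_distrib, add_div]

theorem avg_sub (f g : Fin N → ℝ) : avg (fun i => f i - g i) = avg f - avg g := by
  simp only [avg, Finset.sum_sub_distrib, sub_div]

theorem avg_mul_left (a : ℝ) (f : Fin N → ℝ) : avg (fun i => a * f i) = a * avg f := by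
  simp only [avg, ← Finset.mul_sum, mul_div_assoc]

theorem avg_const (hN : 0 < N) (a : ℝ) : avg (fun _ : Fin N => a) = a := by
  have : (N : ℝ) ≠ 0 := by positivity
  simp [avg]; field_simp

theorem avg_le_of_le (hN : 0 < N) {f : Fin N → ℝ} {a : ℝ} (h : ∀ i, f i ≤ a) : avg f ≤ a :=
  (avg_mono h).trans (avg_const hN a).le

theorem rms_nonneg (f : Fin N → ℝ) : 0 ≤ rms f := Real.sqrt_nonneg _

theorem rms_sq (f : Fin N → ℝ) : rms f ^ 2 = avg fun i => f i ^ 2 :=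
  Real.sq_sqrt (avg_nonneg fun _ => sq_nonneg _)

/-- Identifying the root mean square with a scaled Euclidean norm gives the triangle and
Cauchy–Schwarz inequalities below. -/
theorem rms_eq_norm (f : Fin N → ℝ) : rms f = ‖(WithLp.toLp 2 f : EuclideanSpace ℝ (Fin N))‖ / √N := by
  rw [rms, avg, Real.sqrt_div' _ (Nat.cast_nonneg N), EuclideanSpace.norm_eq]
  simp

theorem rms_add_le (f g : Fin N → ℝ) : rms (fun i => f i + g i) ≤ rms f + rms g := by
  rw [rms_eq_norm, rms_eq_norm, rms_eq_norm, ← add_div]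
  exact div_le_div_of_nonneg_right (norm_add_le (WithLp.toLp 2 f : EuclideanSpace ℝ (Fin N))
    (WithLp.toLp 2 g)) (Real.sqrt_nonneg _)

theorem rms_neg (f : Fin N → ℝ) : rms (fun i => -f i) = rms f := by simp [rms]

theorem rms_sub_le (f g : Fin N → ℝ) : rms (fun i => f i - g i) ≤ rms f + rms g := by
  simpa only [sub_eq_add_neg, rms_neg] using rms_add_le f fun i => -g i

theorem rms_le_of_abs_le (hN : 0 < N) {f : Fin N → ℝ} {a : ℝ} (ha : 0 ≤ a) (h : ∀ i, |f i| ≤ a) :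
    rms f ≤ a :=
  Real.sqrt_le_iff.2 ⟨ha, avg_le_of_le hN fun i => sq_le_sq' (by linarith [(abs_le.1 (h i)).1])
    (abs_le.1 (h i)).2⟩

theorem abs_avg_mul_le (f g : Fin N → ℝ) : |avg fun i => f i * g i| ≤ rms f * rms g := by
  rw [rms_eq_norm, rms_eq_norm, div_mul_div_comm, Real.mul_self_sqrt (Nat.cast_nonneg N), avg,
    abs_div, Nat.abs_cast]
  refine div_le_div_of_nonneg_right ?_ (Nat.cast_nonneg N)
  have := abs_real_inner_le_norm (WithLp.toLp 2 f : EuclideanSpace ℝ (Fin N)) (WithLp.toLp 2 g)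
  simpa [PiLp.inner_apply, mul_comm] using this

theorem avg_abs_le_rms (hN : 0 < N) (f : Fin N → ℝ) : avg (fun i => |f i|) ≤ rms f := by
  have h := abs_avg_mul_le (fun i => |f i|) fun _ => 1
  have h1 : rms (fun _ : Fin N => (1 : ℝ)) = 1 := by simp [rms, avg_const hN]
  have h2 : rms (fun i => |f i|) = rms f := by simp [rms]
  rw [h1, h2, mul_one] at h
  simpa using (le_abs_self _).trans h

variable {E : Type*} [NormedAddCommGroup E] [InnerProductSpace ℝ E]

/-- Empirical mean of vectors. -/
def vavg (Y : Fin N → E) : E := (N : ℝ)⁻¹ • ∑ i, Y i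

theorem inner_vavg (u : E) (Y : Fin N → E) : inner ℝ u (vavg Y) = avg fun i => inner ℝ u (Y i) := by
  rw [vavg, inner_smul_right, inner_sum, avg, inv_mul_eq_div]

/-- With z the average, ‖z‖² is the mean of f_i ⟨z, Ψ_i⟩, which is at most the mean of (f_i² +
‖z‖²)/2; the ‖z‖² terms are then absorbed. Equivalently, the empirical covariance has norm at most
one, which is why learning rate one is admissible. -/
theorem norm_vavg_sq_le {f : Fin N → ℝ} {Ψ : Fin N → E} (hΨ : ∀ i, ‖Ψ i‖ = 1) :
    ‖vavg fun i => f i • Ψ i‖ ^ 2 ≤ avg fun i => f i ^ 2 := by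
  set z := vavg fun i => f i • Ψ i with hz
  have h1 : ‖z‖ ^ 2 = avg fun i => f i * inner ℝ z (Ψ i) := by
    rw [← real_inner_self_eq_norm_sq]
    conv_lhs => rw [hz, inner_vavg, ← hz]
    simp only [inner_smul_right]
  have h2 : avg (fun i => f i * inner ℝ z (Ψ i)) ≤ avg fun i => (f i ^ 2 + ‖z‖ ^ 2) / 2 := by
    refine avg_mono fun i => ?_
    have h3 : inner ℝ z (Ψ i) ^ 2 ≤ ‖z‖ ^ 2 := by
      have := abs_real_inner_le_norm z (Ψ i)
      rw [hΨ, mul_one] at this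
      exact sq_le_sq' (by linarith [(abs_le.1 this).1]) (abs_le.1 this).2
    nlinarith [sq_nonneg (f i - inner ℝ z (Ψ i))]
  rcases Nat.eq_zero_or_pos N with h0 | hN
  · subst h0
    simp [hz, vavg, avg]
  · have h4 : avg (fun i => (f i ^ 2 + ‖z‖ ^ 2) / 2) = ((avg fun i => f i ^ 2) + ‖z‖ ^ 2) / 2 := by
      have : (fun i => (f i ^ 2 + ‖z‖ ^ 2) / 2) = fun i => (1 / 2 : ℝ) * (f i ^ 2 + ‖z‖ ^ 2) := by
        funext i; ring
      rw [this, avg_mul_left, avg_add, avg_const hN]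
      ring
    linarith

theorem vavg_add (Y Y' : Fin N → E) : vavg (fun i => Y i + Y' i) = vavg Y + vavg Y' := by
  simp only [vavg, Finset.sum_add_distrib, smul_add]

end Averages

/-! ### The Alphatron iteration as perturbed gradient descent. -/

section Iteration

variable {N : ℕ} {E : Type*} [NormedAddCommGroup E] [InnerProductSpace ℝ E]

/-- Residual of the Alphatron iteration with learning rate one. -/
def residual (K : Fin N → Fin N → ℝ) (b : Fin N → ℝ) (t : ℕ) (i : Fin N) : ℝ :=
  b i - ∑ j, weights K b 1 t j * K j i

theorem weights_succ (K : Fin N → Fin N → ℝ) (b : Fin N → ℝ) (t : ℕ) (i : Fin N) :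
    weights K b 1 (t + 1) i = weights K b 1 t i + (N : ℝ)⁻¹ * residual K b t i := by
  rw [weights, residual, one_div]

/-- The weight vector in feature space. -/
def weightVec (Ψ : Fin N → E) (α : Fin N → ℝ) : E := ∑ j, α j • Ψ j

theorem inner_weightVec (Ψ : Fin N → E) (α : Fin N → ℝ) (x : E) :
    inner ℝ (weightVec Ψ α) x = ∑ j, α j * inner ℝ (Ψ j) x := by
  simp only [weightVec, sum_inner, real_inner_smul_left]

/-- In feature space the update adds the averaged features weighted by the residuals. The estimated
kernel enters only through the residuals; the feature vectors are exact. -/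
theorem weightVec_succ (Ψ : Fin N → E) (K : Fin N → Fin N → ℝ) (b : Fin N → ℝ) (t : ℕ) :
    weightVec Ψ (weights K b 1 (t + 1)) =
      weightVec Ψ (weights K b 1 t) + vavg fun i => residual K b t i • Ψ i := by
  simp only [weightVec, vavg, weights_succ, add_smul, Finset.sum_add_distrib, Finset.smul_sum,
    smul_smul]

theorem residual_succ (K : Fin N → Fin N → ℝ) (b : Fin N → ℝ) (t : ℕ) (i : Fin N) :
    residual K b (t + 1) i = residual K b t i - avg fun j => residual K b t j * K j i := by
  simp only [residual, weights_succ, avg, add_mul, Finset.sum_add_distrib, Finset.sum_div]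
  rw [← sub_sub]
  congr 1
  refine Finset.sum_congr rfl fun j _ => ?_
  ring

variable {Ψ : Fin N → E} {K : Fin N → Fin N → ℝ} {b : Fin N → ℝ} {e : ℝ}

/-- With exact kernel values the residual is multiplied by I − Gram/N, a contraction because Gram/N
lies between 0 and I. An entrywise error e perturbs each coordinate by at most e times the mean
absolute residual. -/
theorem rms_residual_succ_le (hN : 0 < N) (hΨ : ∀ i, ‖Ψ i‖ = 1)
    (hK : ∀ i j, |K i j - inner ℝ (Ψ i) (Ψ j)| ≤ e) (t : ℕ) :
    rms (residual K b (t + 1)) ≤ (1 + e) * rms (residual K b t) := by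
  set ρ := residual K b t
  set z := vavg fun i => ρ i • Ψ i with hz
  set d : Fin N → ℝ := fun i => avg fun j => ρ j * (K j i - inner ℝ (Ψ j) (Ψ i)) with hd
  have he : 0 ≤ e := (abs_nonneg _).trans (hK ⟨0, hN⟩ ⟨0, hN⟩)
  have h1 : residual K b (t + 1) = fun i => (ρ i - inner ℝ z (Ψ i)) - d i := by
    funext i
    have : inner ℝ z (Ψ i) = avg fun j => ρ j * inner ℝ (Ψ j) (Ψ i) := by
      rw [real_inner_comm, hz, inner_vavg]
      simp only [inner_smul_right, real_inner_comm]
    rw [residual_succ, this, hd]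
    simp only [mul_sub, avg_sub]
    ring
  have h2 : rms (fun i => ρ i - inner ℝ z (Ψ i)) ≤ rms ρ := by
    apply Real.sqrt_le_sqrt
    have hz2 : ‖z‖ ^ 2 = avg fun i => ρ i * inner ℝ z (Ψ i) := by
      rw [← real_inner_self_eq_norm_sq]
      conv_lhs => rw [hz, inner_vavg, ← hz]
      simp only [inner_smul_right]
    have hq : avg (fun i => inner ℝ z (Ψ i) ^ 2) ≤ ‖z‖ ^ 2 := by
      refine avg_le_of_le hN fun i => ?_
      have := abs_real_inner_le_norm z (Ψ i)
      rw [hΨ, mul_one] at this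
      exact sq_le_sq' (by linarith [(abs_le.1 this).1]) (abs_le.1 this).2
    have hexp : (fun i => (ρ i - inner ℝ z (Ψ i)) ^ 2) =
        fun i => (ρ i ^ 2 - 2 * (ρ i * inner ℝ z (Ψ i))) + inner ℝ z (Ψ i) ^ 2 := by
      funext i; ring
    rw [hexp, avg_add, avg_sub, avg_mul_left, ← hz2]
    nlinarith [sq_nonneg ‖z‖]
  have h3 : rms d ≤ e * rms ρ := by
    refine rms_le_of_abs_le hN (mul_nonneg he (rms_nonneg _)) fun i => ?_
    calc |d i| ≤ avg fun j => |ρ j * (K j i - inner ℝ (Ψ j) (Ψ i))| := by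
          rw [hd]
          simp only [avg]
          rw [abs_div, Nat.abs_cast]
          exact div_le_div_of_nonneg_right (Finset.abs_sum_le_sum_abs _ _) (Nat.cast_nonneg N)
      _ ≤ avg fun j => e * |ρ j| := by
          refine avg_mono fun j => ?_
          rw [abs_mul, mul_comm]
          exact mul_le_mul_of_nonneg_right (hK j i) (abs_nonneg _)
      _ ≤ e * rms ρ := by
          rw [avg_mul_left]
          exact mul_le_mul_of_nonneg_left (avg_abs_le_rms hN ρ) he
  rw [h1]
  linarith [rms_sub_le (fun i => ρ i - inner ℝ z (Ψ i)) d]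

theorem rms_residual_add_le (hN : 0 < N) (hΨ : ∀ i, ‖Ψ i‖ = 1)
    (hK : ∀ i j, |K i j - inner ℝ (Ψ i) (Ψ j)| ≤ e) (t s : ℕ) :
    rms (residual K b (t + s)) ≤ Real.exp (s * e) * rms (residual K b t) := by
  induction s with
  | zero => simp
  | succ s ih =>
    have he : 0 ≤ e := (abs_nonneg _).trans (hK ⟨0, hN⟩ ⟨0, hN⟩)
    calc rms (residual K b (t + s + 1)) ≤ (1 + e) * rms (residual K b (t + s)) :=
          rms_residual_succ_le hN hΨ hK _
      _ ≤ Real.exp e * (Real.exp (s * e) * rms (residual K b t)) := by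
          gcongr
          · exact rms_nonneg _
          · linarith [Real.add_one_le_exp e]
      _ = _ := by
          rw [← mul_assoc, ← Real.exp_add]
          congr 2
          push_cast; ring

/-- The initial residual is the label vector, of root mean square at most one, and the accumulated
growth is at most exp(1) < 3. -/
theorem rms_residual_le (hN : 0 < N) (hΨ : ∀ i, ‖Ψ i‖ = 1)
    (hK : ∀ i j, |K i j - inner ℝ (Ψ i) (Ψ j)| ≤ e) (hb : ∀ i, b i ∈ Set.Icc (0 : ℝ) 1) {t : ℕ}
    (ht : t * e ≤ 1) : rms (residual K b t) ≤ 3 := by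
  have h := rms_residual_add_le (b := b) hN hΨ hK 0 t
  have h0 : rms (residual K b 0) ≤ 1 := by
    refine rms_le_of_abs_le hN zero_le_one fun i => ?_
    simp only [residual, weights, zero_mul, Finset.sum_const_zero, sub_zero]
    exact abs_le.2 ⟨by linarith [(hb i).1], (hb i).2⟩
  rw [zero_add] at h
  have h1 : Real.exp (t * e) ≤ 3 :=
    (Real.exp_le_exp.2 ht).trans (by linarith [Real.exp_one_lt_d9])
  calc _ ≤ Real.exp (t * e) * rms (residual K b 0) := h
    _ ≤ 3 * 1 := by gcongr; exact rms_nonneg _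
    _ = 3 := by norm_num

/-- The growth factor exp(se) ≤ 1 + 2se has square at most 1 + 8se, and the squared residual is at
most 9; hence 72. -/
theorem avg_residual_sq_mono (hN : 0 < N) (hΨ : ∀ i, ‖Ψ i‖ = 1)
    (hK : ∀ i j, |K i j - inner ℝ (Ψ i) (Ψ j)| ≤ e) (hb : ∀ i, b i ∈ Set.Icc (0 : ℝ) 1) {t r : ℕ}
    (htr : t ≤ r) (hr : r * e ≤ 1) :
    avg (fun i => residual K b r i ^ 2) ≤ avg (fun i => residual K b t i ^ 2) + 72 * (r * e) := by
  have he : 0 ≤ e := (abs_nonneg _).trans (hK ⟨0, hN⟩ ⟨0, hN⟩)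
  obtain ⟨s, rfl⟩ := Nat.exists_eq_add_of_le htr
  have hcast : (((t + s : ℕ)) : ℝ) = t + s := by push_cast; ring
  rw [hcast] at hr ⊢
  have hte : 0 ≤ (t : ℝ) * e := by positivity
  have hse : 0 ≤ (s : ℝ) * e := by positivity
  have ht3 := rms_residual_le (b := b) hN hΨ hK hb (t := t) (by nlinarith)
  have h := rms_residual_add_le (b := b) hN hΨ hK t s
  have h1 : Real.exp (s * e) ≤ 1 + 2 * (s * e) := by
    have habs : |(s : ℝ) * e| ≤ 1 := by rw [abs_of_nonneg hse]; nlinarith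
    have := (abs_le.1 (Real.abs_exp_sub_one_sub_id_le habs)).2
    have h2 : (s : ℝ) * e ≤ 1 := by nlinarith
    nlinarith
  rw [← rms_sq, ← rms_sq]
  have hr0 := rms_nonneg (residual K b t)
  have h2 : rms (residual K b (t + s)) ≤ (1 + 2 * (s * e)) * rms (residual K b t) :=
    h.trans (mul_le_mul_of_nonneg_right h1 hr0)
  have h3 := pow_le_pow_left₀ (rms_nonneg _) h2 2
  have h4 : rms (residual K b t) ^ 2 ≤ 9 := by nlinarith
  have h5 : (s : ℝ) * e ≤ 1 := by nlinarith
  have h6 : (1 + 2 * (s * e)) ^ 2 ≤ 1 + 8 * (s * e) := by nlinarith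
  calc _ ≤ _ := h3
    _ = (1 + 2 * (s * e)) ^ 2 * rms (residual K b t) ^ 2 := by ring
    _ ≤ (1 + 8 * (s * e)) * rms (residual K b t) ^ 2 := by gcongr
    _ = rms (residual K b t) ^ 2 + 8 * (s * e) * rms (residual K b t) ^ 2 := by ring
    _ ≤ rms (residual K b t) ^ 2 + 8 * (s * e) * 9 := by gcongr
    _ ≤ _ := by nlinarith

/-- Each step adds at most the mean absolute residual, hence at most 3. This ℓ¹ bound is what
multiplies the kernel error in a prediction and the shot variance in the generalization error. -/
theorem sum_abs_weights_le (hN : 0 < N) (hΨ : ∀ i, ‖Ψ i‖ = 1)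
    (hK : ∀ i j, |K i j - inner ℝ (Ψ i) (Ψ j)| ≤ e) (hb : ∀ i, b i ∈ Set.Icc (0 : ℝ) 1) {t : ℕ}
    (ht : t * e ≤ 1) : ∑ j, |weights K b 1 t j| ≤ 3 * t := by
  have he : 0 ≤ e := (abs_nonneg _).trans (hK ⟨0, hN⟩ ⟨0, hN⟩)
  induction t with
  | zero => simp [weights]
  | succ t ih =>
    push_cast at ht ⊢
    have ht' : t * e ≤ 1 := by nlinarith
    have h1 : ∑ j, |weights K b 1 (t + 1) j| ≤
        ∑ j, |weights K b 1 t j| + avg fun j => |residual K b t j| := by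
      rw [avg, Finset.sum_div, ← Finset.sum_add_distrib]
      refine Finset.sum_le_sum fun j _ => ?_
      rw [weights_succ]
      refine (abs_add_le _ _).trans (le_of_eq ?_)
      rw [abs_mul, abs_of_nonneg (inv_nonneg.2 (Nat.cast_nonneg (α := ℝ) N)), inv_mul_eq_div]
    linarith [ih ht', avg_abs_le_rms hN (residual K b t), rms_residual_le (b := b) hN hΨ hK hb ht']

/-- Predictions made with kernel estimates are close to those made with exact kernel values. -/
theorem abs_sum_weights_mul_sub_le (hN : 0 < N) (hΨ : ∀ i, ‖Ψ i‖ = 1)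
    (hK : ∀ i j, |K i j - inner ℝ (Ψ i) (Ψ j)| ≤ e) (hb : ∀ i, b i ∈ Set.Icc (0 : ℝ) 1) {t : ℕ}
    (ht : t * e ≤ 1) {k : Fin N → ℝ} {x : E} (hk : ∀ j, |k j - inner ℝ (Ψ j) x| ≤ e) :
    |∑ j, weights K b 1 t j * k j - inner ℝ (weightVec Ψ (weights K b 1 t)) x| ≤ 3 * (t * e) := by
  have he : 0 ≤ e := (abs_nonneg _).trans (hK ⟨0, hN⟩ ⟨0, hN⟩)
  rw [inner_weightVec, ← Finset.sum_sub_distrib]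
  calc _ ≤ ∑ j, |weights K b 1 t j * k j - weights K b 1 t j * inner ℝ (Ψ j) x| :=
        Finset.abs_sum_le_sum_abs _ _
    _ ≤ ∑ j, |weights K b 1 t j| * e := by
        refine Finset.sum_le_sum fun j _ => ?_
        rw [← mul_sub, abs_mul]
        exact mul_le_mul_of_nonneg_left (hk j) (abs_nonneg _)
    _ ≤ 3 * t * e := by
        rw [← Finset.sum_mul]
        exact mul_le_mul_of_nonneg_right (sum_abs_weights_le hN hΨ hK hb ht) he
    _ = _ := by ring

/-- Linear growth of ‖w‖² improves on the quadratic growth implied by the ℓ¹ bound. If d is the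
prediction defect and ρ the residual, then ⟨w, Ψ⟩ = b − d − ρ, so the increment 2ρ⟨w, Ψ⟩ + ρ² is
2ρ(b − d) − ρ² ≤ (b − d)² ≤ 16. -/
theorem norm_weightVec_sq_le (hN : 0 < N) (hΨ : ∀ i, ‖Ψ i‖ = 1)
    (hK : ∀ i j, |K i j - inner ℝ (Ψ i) (Ψ j)| ≤ e) (hb : ∀ i, b i ∈ Set.Icc (0 : ℝ) 1) {t : ℕ}
    (ht : t * e ≤ 1) : ‖weightVec Ψ (weights K b 1 t)‖ ^ 2 ≤ 16 * t := by
  have he : 0 ≤ e := (abs_nonneg _).trans (hK ⟨0, hN⟩ ⟨0, hN⟩)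
  induction t with
  | zero => simp [weights, weightVec]
  | succ t ih =>
    push_cast at ht ⊢
    have ht' : t * e ≤ 1 := by nlinarith
    set w := weightVec Ψ (weights K b 1 t) with hw
    have h1 := norm_vavg_sq_le (f := residual K b t) hΨ
    have h2 : inner ℝ w (vavg fun i => residual K b t i • Ψ i) =
        avg fun i => residual K b t i * inner ℝ w (Ψ i) := by
      rw [inner_vavg]; simp only [inner_smul_right]
    have h3 : avg (fun i => 2 * (residual K b t i * inner ℝ w (Ψ i)) + residual K b t i ^ 2) ≤ 16 := by
      refine avg_le_of_le hN fun i => ?_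
      have hp := abs_le.1 (abs_sum_weights_mul_sub_le hN hΨ hK hb ht' (k := fun j => K j i)
        (x := Ψ i) fun j => hK j i)
      set d := ∑ j, weights K b 1 t j * K j i - inner ℝ w (Ψ i) with hd
      have hr : residual K b t i = b i - inner ℝ w (Ψ i) - d := by rw [residual, hd]; ring
      have : inner ℝ w (Ψ i) = b i - d - residual K b t i := by rw [hr]; ring
      rw [this]
      have hbd : (b i - d) ^ 2 ≤ 16 := by
        have := hb i
        nlinarith [this.1, this.2, hp.1, hp.2]
      nlinarith [sq_nonneg (residual K b t i - (b i - d))]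
    rw [avg_add, avg_mul_left] at h3
    rw [weightVec_succ, norm_add_sq_real, ← hw, h2]
    linarith [ih ht']

/-- One step of the iteration brings the weight vector closer to `v`, up to noise, as long as the
empirical error is large. -/
theorem norm_sub_weightVec_succ_sq_le (hΨ : ∀ i, ‖Ψ i‖ = 1) (v : E)
    {g c : Fin N → ℝ} (hc : ∀ i, c i = inner ℝ v (Ψ i) + g i) (t : ℕ) (d : Fin N → ℝ)
    (hd : ∀ i, d i = ∑ j, weights K b 1 t j * K j i - inner ℝ (weightVec Ψ (weights K b 1 t)) (Ψ i)) :
    ‖v - weightVec Ψ (weights K b 1 (t + 1))‖ ^ 2 ≤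
      ‖v - weightVec Ψ (weights K b 1 t)‖ ^ 2 -
        (avg fun i => inner ℝ (v - weightVec Ψ (weights K b 1 t)) (Ψ i) ^ 2) / 2 +
        2 * (avg fun i => (g i - d i) ^ 2) + 5 * ‖vavg fun i => (b i - c i) • Ψ i‖ ^ 2 +
        2 * ‖v - weightVec Ψ (weights K b 1 t)‖ * ‖vavg fun i => (b i - c i) • Ψ i‖ := by
  set w := weightVec Ψ (weights K b 1 t) with hw
  set u := v - w with hu
  set ξ := vavg fun i => (b i - c i) • Ψ i
  set p : Fin N → ℝ := fun i => (g i - d i) + inner ℝ u (Ψ i) with hp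
  set P := vavg fun i => p i • Ψ i
  have hρ : ∀ i, residual K b t i = (b i - c i) + p i := by
    intro i
    rw [hp, residual]
    simp only [hd, hc, hu, inner_sub_left]
    ring
  have hstep : v - weightVec Ψ (weights K b 1 (t + 1)) = u - (ξ + P) := by
    rw [weightVec_succ, ← vavg_add]
    simp only [hρ, add_smul]
    rw [hu]
    abel
  have hP : ‖P‖ ^ 2 ≤ avg fun i => p i ^ 2 := norm_vavg_sq_le hΨ
  have hin : inner ℝ u P = avg fun i => p i * inner ℝ u (Ψ i) := by
    rw [inner_vavg]; simp only [inner_smul_right]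
  -- The unequal split keeps the coefficient of ‖P‖² below the 2 supplied by the cross term −2⟨u,
  -- P⟩. After absorbing the bias, half of the mean square of ⟨u, Ψ⟩ survives as the decrease.
  have hsum : ‖ξ + P‖ ^ 2 ≤ 5 * ‖ξ‖ ^ 2 + 5 / 4 * ‖P‖ ^ 2 := by
    have := norm_add_le ξ P
    have h2 := pow_le_pow_left₀ (norm_nonneg _) this 2
    nlinarith [sq_nonneg (4 * ‖ξ‖ - ‖P‖)]
  have hpt : 5 / 4 * (avg fun i => p i ^ 2) - 2 * (avg fun i => p i * inner ℝ u (Ψ i)) ≤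
      2 * (avg fun i => (g i - d i) ^ 2) - 1 / 2 * (avg fun i => inner ℝ u (Ψ i) ^ 2) := by
    rw [← avg_mul_left, ← avg_mul_left, ← avg_mul_left, ← avg_mul_left, ← avg_sub, ← avg_sub]
    refine avg_mono fun i => ?_
    rw [hp]
    nlinarith [sq_nonneg ((g i - d i) - inner ℝ u (Ψ i)), sq_nonneg (g i - d i)]
  have hux : -(‖u‖ * ‖ξ‖) ≤ inner ℝ u ξ := (abs_le.1 (abs_real_inner_le_norm u ξ)).1
  rw [hstep, norm_sub_sq_real, inner_add_right, hin]
  linarith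

/-- A potential that decreases as long as an error is large bounds the error at some time. -/
theorem exists_small_of_descent {U q : ℕ → ℝ} {B κ : ℝ} {T : ℕ} (hT : 0 < T) (hU : ∀ t, 0 ≤ U t)
    (h0 : U 0 ≤ B) (hstep : ∀ t < T, U t ≤ B → U (t + 1) ≤ U t - q t / 2 + κ) :
    ∃ t < T, q t / 2 ≤ κ + B / T ∧ ∀ s ≤ t, U s ≤ B := by
  by_contra! hcon
  have hT0 : (0 : ℝ) < T := by positivity
  have hB : 0 ≤ B := (hU 0).trans h0
  -- If no good time exists, the potential loses B/T at every step. It thus never leaves the region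
  -- U ≤ B where the descent hypothesis is available.
  have key : ∀ t ≤ T, (∀ s ≤ t, U s ≤ B - s * (B / T)) := by
    intro t
    induction t with
    | zero => intro _ s hs; rw [Nat.le_zero.1 hs]; simpa using h0
    | succ t ih =>
      intro ht s hs
      have ih' := ih (by omega)
      rcases Nat.lt_or_ge s (t + 1) with h | h
      · exact ih' s (by omega)
      · have hst : s = t + 1 := by omega
        subst hst
        have hall : ∀ s ≤ t, U s ≤ B := fun s hs => (ih' s hs).trans (by
          have : 0 ≤ (s : ℝ) * (B / T) := by positivity
          linarith)
        have hlt : κ + B / T < q t / 2 := by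
          by_contra! hq
          obtain ⟨s, hs, hs'⟩ := hcon t (by omega) hq
          exact absurd (hall s hs) (not_le.2 hs')
        have := hstep t (by omega) (hall t le_rfl)
        have := ih' t le_rfl
        push_cast
        linarith
  -- The last step is repeated with its strict inequality: it takes U strictly below B − T · (B/T) =
  -- 0.
  obtain ⟨t, rfl⟩ : ∃ t, T = t + 1 := ⟨T - 1, by omega⟩
  have hall : ∀ s ≤ t, U s ≤ B := fun s hs => (key t (by omega) s hs).trans (by
    have : 0 ≤ (s : ℝ) * (B / ((t + 1 : ℕ) : ℝ)) := by positivity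
    linarith)
  have hlt : κ + B / ((t + 1 : ℕ) : ℝ) < q t / 2 := by
    by_contra! hq
    obtain ⟨s, hs, hs'⟩ := hcon t (by omega) hq
    exact absurd (hall s hs) (not_le.2 hs')
  have h1 := hstep t (by omega) (hall t le_rfl)
  have h2 := key t (by omega) t le_rfl
  have h3 : B - t * (B / ((t + 1 : ℕ) : ℝ)) - B / ((t + 1 : ℕ) : ℝ) = 0 := by
    push_cast; field_simp; ring
  linarith [hU (t + 1)]

end Iteration

/-! ### Population quantities, the covariance gap and the excess loss. -/

section Population

section Centred

variable {Z : Type*} [MeasurableSpace Z] (μ : Measure Z) [IsProbabilityMeasure μ]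
variable {E : Type*} [NormedAddCommGroup E] [InnerProductSpace ℝ E] [MeasurableSpace E]
  [BorelSpace E] [SecondCountableTopology E]

/-- Hoeffding's inequality for the empirical mean of bounded vectors. -/
theorem measure_vavg_sub_integral_le [CompleteSpace E] (Y : Z → E) (hY : Measurable Y) {R : ℝ}
    (hR : 0 < R) (hb : ∀ᵐ z ∂μ, ‖Y z‖ ≤ R) {N : ℕ} (hN : 0 < N) {s : ℝ} (hs : 0 ≤ s) :
    (Measure.pi fun _ : Fin N => μ) {z | 2 * R * s < ‖vavg (fun i => Y (z i)) - ∫ z, Y z ∂μ‖} ≤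
      ENNReal.ofReal (2 * Real.exp (-(N * s ^ 2 / 2))) := by
  have hint : Integrable Y μ := Integrable.of_bound hY.aestronglyMeasurable R hb
  have hmean : ‖∫ z, Y z ∂μ‖ ≤ R := by
    have := norm_integral_le_of_norm_le_const hb
    simpa using this
  have hN0 : (0 : ℝ) < N := by positivity
  -- Subtracting the mean at most doubles the bound R.
  refine (measure_mono ?_).trans (measure_norm_sum_ge_le μ (fun z => Y z - ∫ z, Y z ∂μ)
    (by fun_prop) (R := 2 * R) (by positivity) ?_ ?_ N hs)
  · intro z hz
    simp only [Set.mem_ofPred_eq] at hz ⊢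
    have : ∑ i, (Y (z i) - ∫ z, Y z ∂μ) = (N : ℝ) • (vavg (fun i => Y (z i)) - ∫ z, Y z ∂μ) := by
      rw [vavg, smul_sub, smul_smul, mul_inv_cancel₀ hN0.ne', one_smul, Finset.sum_sub_distrib]
      simp [Nat.cast_smul_eq_nsmul]
    rw [this, norm_smul, Real.norm_of_nonneg hN0.le]
    exact mul_le_mul_of_nonneg_left hz.le hN0.le
  · filter_upwards [hb] with z hz
    linarith [norm_sub_le (Y z) (∫ z, Y z ∂μ)]
  · intro x
    simp only [inner_sub_right]
    rw [integral_sub (hint.const_inner x) (integrable_const _), integral_inner hint]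
    simp

/-- The label noise is already centred and bounded by one, so no factor is lost to centring. -/
theorem measure_vavg_le_of_centred (Y : Z → E) (hY : Measurable Y) (hb : ∀ᵐ z ∂μ, ‖Y z‖ ≤ 1)
    (h0 : ∀ x : E, ∫ z, inner ℝ x (Y z) ∂μ = 0) {N : ℕ} (hN : 0 < N) {s : ℝ} (hs : 0 ≤ s) :
    (Measure.pi fun _ : Fin N => μ) {z | s < ‖vavg fun i => Y (z i)‖} ≤
      ENNReal.ofReal (2 * Real.exp (-(N * s ^ 2 / 2))) := by
  have hN0 : (0 : ℝ) < N := by positivity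
  refine (measure_mono ?_).trans (measure_norm_sum_ge_le μ Y hY one_pos hb h0 N hs)
  intro z hz
  simp only [Set.mem_ofPred_eq, vavg, norm_smul, norm_inv, Real.norm_natCast] at hz ⊢
  rw [lt_inv_mul_iff₀ hN0] at hz
  linarith

end Centred

/-- On the span of the support, the population covariance is bounded below. -/
theorem exists_covariance_gap {Z : Type*} [MeasurableSpace Z] (μ : Measure Z)
    [IsProbabilityMeasure μ] {E : Type*} [NormedAddCommGroup E] [InnerProductSpace ℝ E]
    [FiniteDimensional ℝ E] [MeasurableSpace E] [BorelSpace E] (Ψ : Z → E) (hΨ : Measurable Ψ)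
    (hb : ∀ z, ‖Ψ z‖ = 1) :
    ∃ (σ : ℝ) (S : Submodule ℝ E), 0 < σ ∧ (∀ᵐ z ∂μ, Ψ z ∈ S) ∧
      ∀ w ∈ S, σ * ‖w‖ ^ 2 ≤ ∫ z, inner ℝ w (Ψ z) ^ 2 ∂μ := by
  have hbd : ∀ w z, |inner ℝ w (Ψ z)| ≤ ‖w‖ := by
    intro w z
    simpa [hb] using abs_real_inner_le_norm w (Ψ z)
  have hint : ∀ w, Integrable (fun z => inner ℝ w (Ψ z) ^ 2) μ := by
    intro w
    refine Integrable.of_bound (C := ‖w‖ ^ 2) (Measurable.aestronglyMeasurable (by fun_prop)) (Filter.Eventually.of_forall fun z => ?_)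
    rw [Real.norm_eq_abs, abs_pow]
    exact pow_le_pow_left₀ (abs_nonneg _) (hbd w z) 2
  -- The kernel of the covariance: directions almost surely orthogonal to the features. The subspace
  -- sought is its orthogonal complement.
  let Z₀ : Submodule ℝ E :=
    { carrier := {w | ∀ᵐ z ∂μ, inner ℝ w (Ψ z) = 0}
      add_mem' := by
        intro u w hu hw
        change ∀ᵐ z ∂μ, inner ℝ u (Ψ z) = 0 at hu
        change ∀ᵐ z ∂μ, inner ℝ w (Ψ z) = 0 at hw
        change ∀ᵐ z ∂μ, inner ℝ (u + w) (Ψ z) = 0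
        filter_upwards [hu, hw] with z h1 h2
        rw [inner_add_left, h1, h2, add_zero]
      zero_mem' := by
        change ∀ᵐ z ∂μ, inner ℝ (0 : E) (Ψ z) = 0
        exact Filter.Eventually.of_forall fun z => inner_zero_left _
      smul_mem' := by
        intro a w hw
        change ∀ᵐ z ∂μ, inner ℝ w (Ψ z) = 0 at hw
        change ∀ᵐ z ∂μ, inner ℝ (a • w) (Ψ z) = 0
        filter_upwards [hw] with z h
        rw [real_inner_smul_left, h, mul_zero] }
  have hS : ∀ᵐ z ∂μ, Ψ z ∈ Z₀ᗮ := by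
    -- A finite spanning set turns "for each w, almost surely" into "almost surely, for all w".
    obtain ⟨s, hs⟩ : ∃ s : Finset E, Submodule.span ℝ (s : Set E) = Z₀ :=
      (IsNoetherian.noetherian Z₀)
    have h1 : ∀ᵐ z ∂μ, ∀ w ∈ s, inner ℝ w (Ψ z) = 0 := by
      refine (Finset.eventually_all s).2 fun w hw => ?_
      have : w ∈ Z₀ := hs ▸ Submodule.subset_span hw
      exact this
    filter_upwards [h1] with z hz
    rw [← hs, Submodule.mem_orthogonal]
    intro u hu
    refine Submodule.span_induction (p := fun u _ => inner ℝ u (Ψ z) = 0) (fun w hw => hz w hw)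
      (inner_zero_left _) (fun u w _ _ h1 h2 => by rw [inner_add_left, h1, h2, add_zero])
      (fun a w _ h => by rw [real_inner_smul_left, h, mul_zero]) hu
  have hcont : Continuous fun w => ∫ z, inner ℝ w (Ψ z) ^ 2 ∂μ := by
    rw [continuous_iff_continuousAt]
    intro w₀
    refine continuousAt_of_dominated (bound := fun _ => (‖w₀‖ + 1) ^ 2)
      (Filter.Eventually.of_forall fun w => by fun_prop) ?_ (integrable_const _)
      (Filter.Eventually.of_forall fun z => by fun_prop)
    filter_upwards [Metric.ball_mem_nhds w₀ one_pos] with w hw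
    refine Filter.Eventually.of_forall fun z => ?_
    rw [Real.norm_eq_abs, abs_pow]
    refine pow_le_pow_left₀ (abs_nonneg _) ((hbd w z).trans ?_) 2
    have := norm_le_norm_add_norm_sub' w w₀
    rw [mem_ball_iff_norm] at hw
    linarith
  have hpos : ∀ w ∈ Z₀ᗮ, w ≠ 0 → 0 < ∫ z, inner ℝ w (Ψ z) ^ 2 ∂μ := by
    intro w hw hw0
    refine lt_of_le_of_ne (integral_nonneg fun z => sq_nonneg _) fun h => hw0 ?_
    have h1 := (integral_eq_zero_iff_of_nonneg (fun z => sq_nonneg _) (hint w)).1 h.symm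
    have h2 : w ∈ Z₀ := by
      change ∀ᵐ z ∂μ, inner ℝ w (Ψ z) = 0
      filter_upwards [h1] with z hz
      simpa using hz
    have := Submodule.inner_right_of_mem_orthogonal h2 hw
    simpa using this
  have hcomp : IsCompact ((Z₀ᗮ : Set E) ∩ Metric.sphere 0 1) :=
    (isCompact_sphere 0 1).inter_left (Submodule.closed_of_finiteDimensional _)
  -- The gap is the minimum of a positive continuous function on a compact unit sphere. If that
  -- sphere is empty the subspace is trivial and any positive constant serves.
  rcases ((Z₀ᗮ : Set E) ∩ Metric.sphere 0 1).eq_empty_or_nonempty with hem | hne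
  · refine ⟨1, Z₀ᗮ, one_pos, hS, fun w hw => ?_⟩
    have hw0 : w = 0 := by
      by_contra h
      have : (‖w‖⁻¹ • w) ∈ (Z₀ᗮ : Set E) ∩ Metric.sphere 0 1 :=
        ⟨Submodule.smul_mem _ _ hw, by simp [norm_smul, h]⟩
      rw [hem] at this
      exact this
    simp [hw0]
  · obtain ⟨w₀, hw₀, hmin⟩ := hcomp.exists_isMinOn hne hcont.continuousOn
    have hw₀0 : w₀ ≠ 0 := by
      rintro rfl
      simpa using hw₀.2
    refine ⟨_, Z₀ᗮ, hpos w₀ hw₀.1 hw₀0, hS, fun w hw => ?_⟩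
    rcases eq_or_ne w 0 with rfl | h
    · simp
    · have h1 := hmin (a := ‖w‖⁻¹ • w)
        ⟨Submodule.smul_mem _ _ hw, by simp [norm_smul, h]⟩
      simp only [Set.mem_ofPred_eq, real_inner_smul_left, mul_pow, integral_const_mul] at h1
      have hn : 0 < ‖w‖ := norm_pos_iff.2 h
      calc _ ≤ (‖w‖⁻¹ ^ 2 * ∫ z, inner ℝ w (Ψ z) ^ 2 ∂μ) * ‖w‖ ^ 2 := by gcongr
        _ = _ := by field_simp

section Regression

variable {X : Type*} [MeasurableSpace X] {D : Measure (X × ℝ)} [IsProbabilityMeasure D]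
  {c : X → ℝ}

theorem ae_regression_mem_Icc (hy : ∀ᵐ z ∂D, z.2 ∈ Set.Icc (0 : ℝ) 1)
    (hc : D[fun z => z.2 | MeasurableSpace.comap Prod.fst inferInstance] =ᵐ[D] fun z => c z.1) :
    ∀ᵐ z ∂D, c z.1 ∈ Set.Icc (0 : ℝ) 1 := by
  have hle : MeasurableSpace.comap Prod.fst inferInstance ≤
    (inferInstance : MeasurableSpace (X × ℝ)) := measurable_fst.comap_le
  have hint : Integrable (fun z : X × ℝ => z.2) D := by
    refine Integrable.of_bound (C := 1) (Measurable.aestronglyMeasurable (by fun_prop)) ?_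
    filter_upwards [hy] with z hz
    exact abs_le.2 ⟨by linarith [hz.1], hz.2⟩
  have h0 : (0 : X × ℝ → ℝ) ≤ᵐ[D]
      D[fun z => z.2 | MeasurableSpace.comap Prod.fst inferInstance] :=
    condExp_nonneg (by filter_upwards [hy] with z hz using hz.1)
  have h1 := condExp_mono (m := MeasurableSpace.comap Prod.fst inferInstance) hint
    (integrable_const (1 : ℝ)) (by filter_upwards [hy] with z hz using hz.2)
  rw [condExp_const hle] at h1
  filter_upwards [h0, h1, hc] with z hz0 hz1 hz
  rw [hz] at hz0 hz1
  exact ⟨hz0, hz1⟩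

/-- The pull-out property of conditional expectation: functions of the point are orthogonal to the
label noise. -/
theorem integral_mul_sub_regression (hy : ∀ᵐ z ∂D, z.2 ∈ Set.Icc (0 : ℝ) 1)
    (hc : D[fun z => z.2 | MeasurableSpace.comap Prod.fst inferInstance] =ᵐ[D] fun z => c z.1)
    {f : X → ℝ} (hf : Measurable f) {A : ℝ} (hA : ∀ᵐ z ∂D, |f z.1| ≤ A) :
    ∫ z, f z.1 * (z.2 - c z.1) ∂D = 0 := by
  have hle : MeasurableSpace.comap Prod.fst inferInstance ≤
    (inferInstance : MeasurableSpace (X × ℝ)) := measurable_fst.comap_le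
  have hint : Integrable (fun z : X × ℝ => z.2) D := by
    refine Integrable.of_bound (C := 1) (Measurable.aestronglyMeasurable (by fun_prop)) ?_
    filter_upwards [hy] with z hz
    exact abs_le.2 ⟨by linarith [hz.1], hz.2⟩
  have hfy : Integrable (fun z : X × ℝ => f z.1 * z.2) D :=
    hint.bdd_mul (c := A) (Measurable.aestronglyMeasurable (by fun_prop)) (by simpa using hA)
  have hcint : Integrable (fun z : X × ℝ => c z.1) D :=
    integrable_condExp.congr hc
  have hfc : Integrable (fun z : X × ℝ => f z.1 * c z.1) D :=
    hcint.bdd_mul (c := A) (Measurable.aestronglyMeasurable (by fun_prop)) (by simpa using hA)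
  have hsm : StronglyMeasurable[MeasurableSpace.comap Prod.fst inferInstance]
      (fun z : X × ℝ => f z.1) :=
    (hf.comp (comap_measurable Prod.fst)).stronglyMeasurable
  have h1 := condExp_mul_of_stronglyMeasurable_left hsm hfy hint
  have h2 : ∫ z, f z.1 * z.2 ∂D = ∫ z, f z.1 * c z.1 ∂D := by
    rw [← integral_condExp hle]
    refine integral_congr_ae (h1.trans ?_)
    filter_upwards [hc] with z hz
    simp only [Pi.mul_apply, hz]
  simp only [mul_sub]
  rw [integral_sub hfy hfc, h2, sub_self]

end Regression

section Risk

variable {X : Type*} [MeasurableSpace X] (D : Measure (X × ℝ)) [IsProbabilityMeasure D]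
variable {ι : Type*} [Fintype ι] {Ψ : X → EuclideanSpace ℝ ι} {c : X → ℝ}

/-- Second moment of a linear functional of the features. -/
def popSq (Ψ : X → EuclideanSpace ℝ ι) (u : EuclideanSpace ℝ ι) : ℝ :=
  ∫ z, inner ℝ u (Ψ z.1) ^ 2 ∂D

/-- Mean squared error of a linear hypothesis. -/
def popRisk (Ψ : X → EuclideanSpace ℝ ι) (c : X → ℝ) (w : EuclideanSpace ℝ ι) : ℝ :=
  ∫ z, (inner ℝ w (Ψ z.1) - c z.1) ^ 2 ∂D

/-- Excess loss of a linear hypothesis at a labelled point. -/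
def excess (Ψ : X → EuclideanSpace ℝ ι) (c : X → ℝ) (w : EuclideanSpace ℝ ι) (z : X × ℝ) : ℝ :=
  (inner ℝ w (Ψ z.1) - z.2) ^ 2 - (c z.1 - z.2) ^ 2

omit [IsProbabilityMeasure D] in
theorem popRisk_nonneg (w : EuclideanSpace ℝ ι) : 0 ≤ popRisk D Ψ c w :=
  integral_nonneg fun _ => sq_nonneg _

omit [MeasurableSpace X] in
theorem abs_inner_feature_le (hΨ1 : ∀ x, ‖Ψ x‖ = 1) (w : EuclideanSpace ℝ ι) (x : X) :
    |inner ℝ w (Ψ x)| ≤ ‖w‖ := by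
  simpa [hΨ1] using abs_real_inner_le_norm w (Ψ x)

theorem integrable_inner_sq (hΨ : Measurable Ψ) (hΨ1 : ∀ x, ‖Ψ x‖ = 1)
    (u : EuclideanSpace ℝ ι) : Integrable (fun z => inner ℝ u (Ψ z.1) ^ 2) D := by
  refine Integrable.of_bound (C := ‖u‖ ^ 2) (Measurable.aestronglyMeasurable (by fun_prop)) (Filter.Eventually.of_forall fun z => ?_)
  rw [Real.norm_eq_abs, abs_pow]
  exact pow_le_pow_left₀ (abs_nonneg _) (abs_inner_feature_le hΨ1 u z.1) 2

variable {D}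

theorem integrable_risk (hΨ : Measurable Ψ) (hΨ1 : ∀ x, ‖Ψ x‖ = 1) (hcm : Measurable c)
    (hc : ∀ᵐ z ∂D, c z.1 ∈ Set.Icc (0 : ℝ) 1) (w : EuclideanSpace ℝ ι) :
    Integrable (fun z => (inner ℝ w (Ψ z.1) - c z.1) ^ 2) D := by
  refine Integrable.of_bound (C := (‖w‖ + 1) ^ 2) (Measurable.aestronglyMeasurable (by fun_prop)) ?_
  filter_upwards [hc] with z hz
  rw [Real.norm_eq_abs, abs_pow]
  refine pow_le_pow_left₀ (abs_nonneg _) ((abs_sub _ _).trans ?_) 2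
  exact add_le_add (abs_inner_feature_le hΨ1 w z.1) (abs_le.2 ⟨by linarith [hz.1], hz.2⟩)

theorem integrable_sq_of_abs_le {g : X → ℝ} (hg : Measurable g) {G : ℝ} (hG : ∀ x, |g x| ≤ G) :
    Integrable (fun z => g z.1 ^ 2) D := by
  refine Integrable.of_bound (C := G ^ 2) (Measurable.aestronglyMeasurable (by fun_prop)) (Filter.Eventually.of_forall fun z => ?_)
  rw [Real.norm_eq_abs, abs_pow]
  exact pow_le_pow_left₀ (abs_nonneg _) (hG z.1) 2

theorem popRisk_le_popSq (hΨ : Measurable Ψ) (hΨ1 : ∀ x, ‖Ψ x‖ = 1) (v : EuclideanSpace ℝ ι)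
    {g : X → ℝ} (hg : Measurable g) {G : ℝ} (hG : ∀ x, |g x| ≤ G)
    (hcv : ∀ x, c x = inner ℝ v (Ψ x) + g x) (w : EuclideanSpace ℝ ι) :
    popRisk D Ψ c w ≤ 2 * popSq D Ψ (v - w) + 2 * ∫ z, g z.1 ^ 2 ∂D := by
  rw [popRisk, popSq, ← integral_const_mul, ← integral_const_mul,
    ← integral_add ((integrable_inner_sq D hΨ hΨ1 _).const_mul _)
      ((integrable_sq_of_abs_le hg hG).const_mul _)]
  refine integral_mono_of_nonneg (Filter.Eventually.of_forall fun z => sq_nonneg _)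
    (((integrable_inner_sq D hΨ hΨ1 _).const_mul _).add
      ((integrable_sq_of_abs_le hg hG).const_mul _)) (Filter.Eventually.of_forall fun z => ?_)
  simp only [hcv, inner_sub_left]
  nlinarith [sq_nonneg (inner ℝ v (Ψ z.1) - inner ℝ w (Ψ z.1) - g z.1)]

theorem popSq_le_popRisk (hΨ : Measurable Ψ) (hΨ1 : ∀ x, ‖Ψ x‖ = 1) (hcm : Measurable c)
    (hc : ∀ᵐ z ∂D, c z.1 ∈ Set.Icc (0 : ℝ) 1) (v : EuclideanSpace ℝ ι)
    {g : X → ℝ} (hg : Measurable g) {G : ℝ} (hG : ∀ x, |g x| ≤ G)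
    (hcv : ∀ x, c x = inner ℝ v (Ψ x) + g x) (w : EuclideanSpace ℝ ι) :
    popSq D Ψ (v - w) ≤ 2 * popRisk D Ψ c w + 2 * ∫ z, g z.1 ^ 2 ∂D := by
  rw [popRisk, popSq, ← integral_const_mul, ← integral_const_mul,
    ← integral_add ((integrable_risk hΨ hΨ1 hcm hc _).const_mul _)
      ((integrable_sq_of_abs_le hg hG).const_mul _)]
  refine integral_mono_of_nonneg (Filter.Eventually.of_forall fun z => sq_nonneg _)
    (((integrable_risk hΨ hΨ1 hcm hc _).const_mul _).add
      ((integrable_sq_of_abs_le hg hG).const_mul _)) (Filter.Eventually.of_forall fun z => ?_)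
  simp only [hcv, inner_sub_left]
  nlinarith [sq_nonneg (inner ℝ v (Ψ z.1) - inner ℝ w (Ψ z.1) + 2 * g z.1)]

omit [MeasurableSpace X] in
theorem norm_outer_feature (hΨ1 : ∀ x, ‖Ψ x‖ = 1) (x : X) : ‖outer (Ψ x)‖ = 1 := by
  rw [norm_outer, hΨ1, one_pow]

theorem integrable_outer (hΨ : Measurable Ψ) (hΨ1 : ∀ x, ‖Ψ x‖ = 1) :
    Integrable (fun z => outer (Ψ z.1)) D :=
  Integrable.of_bound (C := 1) (Measurable.aestronglyMeasurable (by fun_prop))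
    (Filter.Eventually.of_forall fun z => (norm_outer_feature hΨ1 z.1).le)

/-- The linearisation by outer products, at the population level; its empirical counterpart appears
in the next proof. -/
theorem popSq_eq_inner (hΨ : Measurable Ψ) (hΨ1 : ∀ x, ‖Ψ x‖ = 1) (u : EuclideanSpace ℝ ι) :
    popSq D Ψ u = inner ℝ (outer u) (∫ z, outer (Ψ z.1) ∂D) := by
  rw [← integral_inner (integrable_outer hΨ hΨ1)]
  simp only [inner_outer, popSq]

/-- Deviation of the empirical second moment, uniformly in the linear functional. -/
theorem abs_avg_sq_sub_popSq_le (hΨ : Measurable Ψ) (hΨ1 : ∀ x, ‖Ψ x‖ = 1) {N : ℕ}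
    (a : Fin N → X × ℝ) {s : ℝ}
    (hs : ‖vavg (fun i => outer (Ψ (a i).1)) - ∫ z, outer (Ψ z.1) ∂D‖ ≤ s)
    (u : EuclideanSpace ℝ ι) :
    |(avg fun i => inner ℝ u (Ψ (a i).1) ^ 2) - popSq D Ψ u| ≤ s * ‖u‖ ^ 2 := by
  have h1 : (avg fun i => inner ℝ u (Ψ (a i).1) ^ 2) =
      inner ℝ (outer u) (vavg fun i => outer (Ψ (a i).1)) := by
    rw [inner_vavg]; simp only [inner_outer]
  rw [h1, popSq_eq_inner hΨ hΨ1, ← inner_sub_right]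
  refine (abs_real_inner_le_norm _ _).trans ?_
  rw [norm_outer, mul_comm]
  gcongr

/-- Deviation of the empirical risk, uniformly in the hypothesis. -/
theorem popRisk_le_avg (hΨ : Measurable Ψ) (hΨ1 : ∀ x, ‖Ψ x‖ = 1) (hcm : Measurable c)
    (hc : ∀ᵐ z ∂D, c z.1 ∈ Set.Icc (0 : ℝ) 1) {N : ℕ} (a : Fin N → X × ℝ) {s : ℝ}
    (h2 : ‖vavg (fun i => outer (Ψ (a i).1)) - ∫ z, outer (Ψ z.1) ∂D‖ ≤ s)
    (h1 : ‖vavg (fun i => c (a i).1 • Ψ (a i).1) - ∫ z, c z.1 • Ψ z.1 ∂D‖ ≤ s)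
    (h0 : ‖vavg (fun i => c (a i).1 ^ 2) - ∫ z, c z.1 ^ 2 ∂D‖ ≤ s) (w : EuclideanSpace ℝ ι) :
    popRisk D Ψ c w ≤ (avg fun i => (inner ℝ w (Ψ (a i).1) - c (a i).1) ^ 2) +
      s * (‖w‖ + 1) ^ 2 := by
  have hcb : ∀ᵐ z ∂D, |c z.1| ≤ 1 := by
    filter_upwards [hc] with z hz using abs_le.2 ⟨by linarith [hz.1], hz.2⟩
  have hi1 : Integrable (fun z => c z.1 • Ψ z.1) D := by
    refine Integrable.of_bound (C := 1) (Measurable.aestronglyMeasurable (by fun_prop)) ?_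
    filter_upwards [hcb] with z hz
    rwa [norm_smul, hΨ1, mul_one, Real.norm_eq_abs]
  have hi0 : Integrable (fun z => c z.1 ^ 2) D := by
    refine Integrable.of_bound (C := 1) (Measurable.aestronglyMeasurable (by fun_prop)) ?_
    filter_upwards [hcb] with z hz
    rw [Real.norm_eq_abs, abs_pow]
    exact pow_le_one₀ (abs_nonneg _) hz
  have hpop : popRisk D Ψ c w = popSq D Ψ w - 2 * inner ℝ w (∫ z, c z.1 • Ψ z.1 ∂D) +
      ∫ z, c z.1 ^ 2 ∂D := by
    have hi1' : Integrable (fun z => inner ℝ w (c z.1 • Ψ z.1)) D := hi1.const_inner w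
    have hi2 : Integrable (fun z => inner ℝ w (Ψ z.1) ^ 2 - 2 * inner ℝ w (c z.1 • Ψ z.1)) D :=
      (integrable_inner_sq D hΨ hΨ1 w).sub (hi1'.const_mul 2)
    rw [popSq, ← integral_inner hi1, ← integral_const_mul,
      ← integral_sub (integrable_inner_sq D hΨ hΨ1 w) (hi1'.const_mul 2),
      ← integral_add hi2 hi0, popRisk]
    refine integral_congr_ae (Filter.Eventually.of_forall fun z => ?_)
    simp only [inner_smul_right]
    ring
  have hemp : (avg fun i => (inner ℝ w (Ψ (a i).1) - c (a i).1) ^ 2) =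
      (avg fun i => inner ℝ w (Ψ (a i).1) ^ 2) - 2 * inner ℝ w (vavg fun i => c (a i).1 • Ψ (a i).1) +
        avg fun i => c (a i).1 ^ 2 := by
    rw [inner_vavg, ← avg_mul_left, ← avg_sub, ← avg_add]
    congr 1
    funext i
    simp only [inner_smul_right]
    ring
  have e2 := (abs_le.1 (abs_avg_sq_sub_popSq_le hΨ hΨ1 a h2 w)).1
  have e1 : |inner ℝ w (vavg (fun i => c (a i).1 • Ψ (a i).1) - ∫ z, c z.1 • Ψ z.1 ∂D)| ≤ ‖w‖ * s :=
    (abs_real_inner_le_norm _ _).trans (by gcongr)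
  rw [inner_sub_right] at e1
  have e1' := (abs_le.1 e1).2
  have hv : vavg (fun i => c (a i).1 ^ 2) = avg fun i => c (a i).1 ^ 2 := by
    rw [vavg, avg, smul_eq_mul, inv_mul_eq_div]
  rw [hv, Real.norm_eq_abs] at h0
  have e0 := (abs_le.1 h0).1
  rw [hpop, hemp]
  linarith

-- The first factor squared integrates to the risk and the second is bounded. Hence the second
-- moment of the excess is at most its range times the risk, as relative Bernstein requires.
omit [MeasurableSpace X] in
theorem excess_eq (w : EuclideanSpace ℝ ι) (z : X × ℝ) :
    excess Ψ c w z = (inner ℝ w (Ψ z.1) - c z.1) * (inner ℝ w (Ψ z.1) + c z.1 - 2 * z.2) := by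
  rw [excess]; ring

omit [MeasurableSpace X] in
theorem abs_excess_aux (hΨ1 : ∀ x, ‖Ψ x‖ = 1) {z : X × ℝ} (hy : z.2 ∈ Set.Icc (0 : ℝ) 1)
    (hc : c z.1 ∈ Set.Icc (0 : ℝ) 1) (w : EuclideanSpace ℝ ι) :
    |inner ℝ w (Ψ z.1) - c z.1| ≤ ‖w‖ + 2 ∧ |inner ℝ w (Ψ z.1) + c z.1 - 2 * z.2| ≤ ‖w‖ + 2 := by
  have h := abs_le.1 (abs_inner_feature_le hΨ1 w z.1)
  constructor <;> rw [abs_le] <;> constructor <;> linarith [hy.1, hy.2, hc.1, hc.2, h.1, h.2]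

@[fun_prop]
theorem measurable_excess (hΨ : Measurable Ψ) (hcm : Measurable c) (w : EuclideanSpace ℝ ι) :
    Measurable (excess Ψ c w) := by
  unfold excess; fun_prop

/-- The cross term is a function of the point times the label noise, so it integrates to zero. -/
theorem integral_excess (hΨ : Measurable Ψ) (hΨ1 : ∀ x, ‖Ψ x‖ = 1) (hcm : Measurable c)
    (hy : ∀ᵐ z ∂D, z.2 ∈ Set.Icc (0 : ℝ) 1) (hc : ∀ᵐ z ∂D, c z.1 ∈ Set.Icc (0 : ℝ) 1)
    (hce : D[fun z => z.2 | MeasurableSpace.comap Prod.fst inferInstance] =ᵐ[D] fun z => c z.1)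
    (w : EuclideanSpace ℝ ι) : ∫ z, excess Ψ c w z ∂D = popRisk D Ψ c w := by
  have hf : ∀ᵐ z ∂D, |inner ℝ w (Ψ z.1) - c z.1| ≤ ‖w‖ + 2 := by
    filter_upwards [hy, hc] with z h1 h2 using (abs_excess_aux hΨ1 h1 h2 w).1
  have h0 := integral_mul_sub_regression (f := fun x => inner ℝ w (Ψ x) - c x) hy hce
    (by fun_prop) hf
  have hint : Integrable (fun z => (inner ℝ w (Ψ z.1) - c z.1) * (z.2 - c z.1)) D := by
    refine Integrable.of_bound (C := (‖w‖ + 2) * 1) (Measurable.aestronglyMeasurable (by fun_prop)) ?_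
    filter_upwards [hf, hy, hc] with z h1 h2 h3
    rw [norm_mul]
    refine mul_le_mul h1 ?_ (norm_nonneg _) (by positivity)
    exact abs_le.2 ⟨by linarith [h2.1, h3.2], by linarith [h2.2, h3.1]⟩
  have : ∀ z, excess Ψ c w z = (inner ℝ w (Ψ z.1) - c z.1) ^ 2 -
      2 * ((inner ℝ w (Ψ z.1) - c z.1) * (z.2 - c z.1)) := by
    intro z; rw [excess_eq]; ring
  simp only [this]
  rw [integral_sub (integrable_risk hΨ hΨ1 hcm hc w) (hint.const_mul 2), integral_const_mul, h0,
    popRisk, mul_zero, sub_zero]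

/-- Relative deviation of the validation excess loss of a fixed hypothesis. -/
theorem measure_excess_deviation_le (hΨ : Measurable Ψ) (hΨ1 : ∀ x, ‖Ψ x‖ = 1)
    (hcm : Measurable c) (hy : ∀ᵐ z ∂D, z.2 ∈ Set.Icc (0 : ℝ) 1)
    (hc : ∀ᵐ z ∂D, c z.1 ∈ Set.Icc (0 : ℝ) 1)
    (hce : D[fun z => z.2 | MeasurableSpace.comap Prod.fst inferInstance] =ᵐ[D] fun z => c z.1)
    (w : EuclideanSpace ℝ ι) {M : ℕ} (hM : 0 < M) (l : ℝ) :
    (Measure.pi fun _ : Fin M => D) {x | popRisk D Ψ c w / 2 + 2 * (‖w‖ + 2) ^ 2 * l / M <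
      |(avg fun j => excess Ψ c w (x j)) - popRisk D Ψ c w|} ≤
      ENNReal.ofReal (2 * Real.exp (-l)) := by
  have hM0 : (0 : ℝ) < M := by positivity
  have hb : ∀ᵐ z ∂D, |excess Ψ c w z| ≤ (‖w‖ + 2) ^ 2 := by
    filter_upwards [hy, hc] with z h1 h2
    obtain ⟨h3, h4⟩ := abs_excess_aux hΨ1 h1 h2 w
    rw [excess_eq, abs_mul, sq]
    exact mul_le_mul h3 h4 (abs_nonneg _) (by positivity)
  have hsq : ∫ z, excess Ψ c w z ^ 2 ∂D ≤ (‖w‖ + 2) ^ 2 * popRisk D Ψ c w := by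
    rw [popRisk, ← integral_const_mul]
    refine integral_mono_of_nonneg (Filter.Eventually.of_forall fun z => sq_nonneg _)
      ((integrable_risk hΨ hΨ1 hcm hc w).const_mul _) ?_
    filter_upwards [hy, hc] with z h1 h2
    have h4 := (abs_excess_aux hΨ1 h1 h2 w).2
    rw [excess_eq, mul_pow, mul_comm]
    gcongr ?_ * _
    exact sq_le_sq' (by linarith [(abs_le.1 h4).1]) (abs_le.1 h4).2
  have h := measure_relative_deviation_le D (excess Ψ c w) (by fun_prop (disch := assumption))
    (by positivity) hb (integral_excess hΨ hΨ1 hcm hy hc hce w) hsq M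
    (2 * (‖w‖ + 2) ^ 2 * l / M)
  refine (measure_mono ?_).trans (h.trans (le_of_eq ?_))
  · intro x hx
    simp only [Set.mem_ofPred_eq, avg] at hx ⊢
    have e : ∑ j, excess Ψ c w (x j) - M * popRisk D Ψ c w =
        M * ((∑ j, excess Ψ c w (x j)) / M - popRisk D Ψ c w) := by field_simp
    rw [e, abs_mul, abs_of_pos hM0]
    exact mul_le_mul_of_nonneg_left hx.le hM0.le
  · congr 3
    have : (‖w‖ + 2) ≠ 0 := by positivity
    field_simp

end Risk

end Population

/-! ### Deterministic analysis on the good event. -/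

section Deterministic

/-- A realisation of the algorithm, in feature space, for which all concentration events hold:
`η` is the statistical accuracy, `ν = N ^ (-1/2)`, and `R`, `P` stand for the population risk and
the population second moment. -/
structure GoodRun {N M : ℕ} {E : Type*} [NormedAddCommGroup E] [InnerProductSpace ℝ E]
    (Ψ : Fin N → E) (K : Fin N → Fin N → ℝ) (b c g : Fin N → ℝ)
    (Χ : Fin M → E) (k : Fin N → Fin M → ℝ) (y cv : Fin M → ℝ) (v : E) (R P : E → ℝ) (T : ℕ)
    (η ν C₁ τ ε G B : ℝ) : Prop where
  hN : 0 < N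
  hM : 0 < M
  hη : 0 < η
  hν0 : 0 < ν
  hν1 : ν ≤ 1
  hC₁ : 0 ≤ C₁
  hτ : 0 ≤ τ
  hΨ : ∀ i, ‖Ψ i‖ = 1
  hK : ∀ i j, |K i j - inner ℝ (Ψ i) (Ψ j)| ≤ η * ν
  hk : ∀ i j, |k i j - inner ℝ (Ψ i) (Χ j)| ≤ η * ν
  hb : ∀ i, b i ∈ Set.Icc (0 : ℝ) 1
  hc : ∀ i, c i ∈ Set.Icc (0 : ℝ) 1
  hy : ∀ j, y j ∈ Set.Icc (0 : ℝ) 1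
  hcv : ∀ j, cv j ∈ Set.Icc (0 : ℝ) 1
  hcg : ∀ i, c i = inner ℝ v (Ψ i) + g i
  hT : ∀ t < T, t * η ≤ 1
  hT' : 1 ≤ T * η
  hv : ‖v‖ ^ 2 ≤ B
  hR : ∀ w, 0 ≤ R w
  noise : ‖vavg fun i => (b i - c i) • Ψ i‖ ≤ C₁ * η
  bias : (avg fun i => g i ^ 2) ≤ ε + 2 * G ^ 2 * (C₁ * η)
  second : ∀ u, |(avg fun i => inner ℝ u (Ψ i) ^ 2) - P u| ≤ 2 * (C₁ * η) * ‖u‖ ^ 2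
  hRP : ∀ w, R w ≤ 2 * P (v - w) + 2 * ε
  hPR : ∀ w, P (v - w) ≤ 2 * R w + 2 * ε
  valid : ∀ t < T, |(avg fun j => (inner ℝ (weightVec Ψ (weights K b 1 t)) (Χ j) - y j) ^ 2 -
      (cv j - y j) ^ 2) - R (weightVec Ψ (weights K b 1 t))| ≤
      R (weightVec Ψ (weights K b 1 t)) / 2 + τ * ν

namespace GoodRun

variable {N M : ℕ} {E : Type*} [NormedAddCommGroup E] [InnerProductSpace ℝ E]
    {Ψ : Fin N → E} {K : Fin N → Fin N → ℝ} {b c g : Fin N → ℝ}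
    {Χ : Fin M → E} {k : Fin N → Fin M → ℝ} {y cv : Fin M → ℝ} {v : E} {R P : E → ℝ} {T : ℕ}
    {η ν C₁ τ ε G B : ℝ}

/-- Kernel entries are accurate to ην and t ≤ 1/η, so the accumulated error is at most ν whatever
the iterate. -/
theorem time_mul_error (h : GoodRun Ψ K b c g Χ k y cv v R P T η ν C₁ τ ε G B) {t : ℕ} (ht : t < T) :
    t * (η * ν) ≤ ν := by
  rw [← mul_assoc]
  exact mul_le_of_le_one_left h.hν0.le (h.hT t ht)

theorem time_mul_error_le_one (h : GoodRun Ψ K b c g Χ k y cv v R P T η ν C₁ τ ε G B) {t : ℕ}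
    (ht : t < T) : t * (η * ν) ≤ 1 :=
  (h.time_mul_error ht).trans h.hν1

/-- Difference between the prediction and the exact linear functional at a training point. -/
theorem abs_trainDefect_le (h : GoodRun Ψ K b c g Χ k y cv v R P T η ν C₁ τ ε G B) {t : ℕ}
    (ht : t < T) (i : Fin N) :
    |∑ j, weights K b 1 t j * K j i - inner ℝ (weightVec Ψ (weights K b 1 t)) (Ψ i)| ≤ 3 * ν :=
  (abs_sum_weights_mul_sub_le h.hN h.hΨ h.hK h.hb (h.time_mul_error_le_one ht)
    fun j => h.hK j i).trans (by linarith [h.time_mul_error ht])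

theorem abs_valDefect_le (h : GoodRun Ψ K b c g Χ k y cv v R P T η ν C₁ τ ε G B) {t : ℕ}
    (ht : t < T) (i : Fin M) :
    |∑ j, weights K b 1 t j * k j i - inner ℝ (weightVec Ψ (weights K b 1 t)) (Χ i)| ≤ 3 * ν :=
  (abs_sum_weights_mul_sub_le h.hN h.hΨ h.hK h.hb (h.time_mul_error_le_one ht)
    fun j => h.hk j i).trans (by linarith [h.time_mul_error ht])

theorem avg_bias_sq_le (h : GoodRun Ψ K b c g Χ k y cv v R P T η ν C₁ τ ε G B) {t : ℕ}
    (ht : t < T) :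
    (avg fun i => (g i - (∑ j, weights K b 1 t j * K j i -
      inner ℝ (weightVec Ψ (weights K b 1 t)) (Ψ i))) ^ 2) ≤
      2 * ε + 4 * C₁ * (G ^ 2 * η) + 18 * ν := by
  have h1 : (avg fun i => (g i - (∑ j, weights K b 1 t j * K j i -
      inner ℝ (weightVec Ψ (weights K b 1 t)) (Ψ i))) ^ 2) ≤
      avg fun i => 2 * g i ^ 2 + 18 * ν := by
    refine avg_mono fun i => ?_
    have hd := h.abs_trainDefect_le ht i
    set d := ∑ j, weights K b 1 t j * K j i - inner ℝ (weightVec Ψ (weights K b 1 t)) (Ψ i)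
    have hd2 : d ^ 2 ≤ (3 * ν) ^ 2 := sq_le_sq' (by linarith [(abs_le.1 hd).1]) (abs_le.1 hd).2
    have hν2 : ν ^ 2 ≤ ν := by nlinarith [h.hν0, h.hν1]
    nlinarith [sq_nonneg (g i + d)]
  rw [avg_add, avg_const h.hN, avg_mul_left] at h1
  linarith [h.bias]

/-- Combines ‖w_t‖ ≤ 4√t with tη ≤ 1. It makes the correlation of an iterate with the label noise
O(√η), the source of the fourth-root term that needs G ≥ G₀. -/
theorem abs_norm_le (h : GoodRun Ψ K b c g Χ k y cv v R P T η ν C₁ τ ε G B) {t : ℕ} (ht : t < T) :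
    ‖weightVec Ψ (weights K b 1 t)‖ * η ≤ 4 * √η := by
  have h1 := norm_weightVec_sq_le h.hN h.hΨ h.hK h.hb (h.time_mul_error_le_one ht)
  have h2 := h.hT t ht
  have h3 : (‖weightVec Ψ (weights K b 1 t)‖ * √η) ^ 2 ≤ 4 ^ 2 := by
    rw [mul_pow, Real.sq_sqrt h.hη.le]
    nlinarith [h.hη]
  have h4 := (abs_le_of_sq_le_sq' h3 (by norm_num)).2
  have h5 : √η * √η = η := Real.mul_self_sqrt h.hη.le
  calc _ = (‖weightVec Ψ (weights K b 1 t)‖ * √η) * √η := by rw [mul_assoc, h5]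
    _ ≤ 4 * √η := by gcongr

/-- Some iterate has small empirical error, and all iterates up to it stay close to `v`. -/
theorem exists_time (h : GoodRun Ψ K b c g Χ k y cv v R P T η ν C₁ τ ε G B) {ρ a : ℝ}
    (hε : ε ≤ ρ) (hGη : G ^ 2 * η ≤ ρ) (hBη : B * η ≤ ρ) (hηa : η ≤ a * ρ)
    (hη2 : η ^ 2 ≤ a * ρ) (hνa : ν ≤ a * ρ) :
    ∃ t < T, (avg fun i => inner ℝ (v - weightVec Ψ (weights K b 1 t)) (Ψ i) ^ 2) ≤
      (2 * (4 + 9 * C₁ + 36 * a + 5 * C₁ ^ 2 * a + C₁ * a) + 2) * ρ ∧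
      ∀ s ≤ t, ‖v - weightVec Ψ (weights K b 1 s)‖ ^ 2 ≤ B := by
  have hT0 : 0 < T := by
    rcases Nat.eq_zero_or_pos T with h0 | h0
    · have := h.hT'
      rw [h0] at this
      norm_num at this
    · exact h0
  have hB : 0 ≤ B := (sq_nonneg _).trans h.hv
  -- T is at least 1/η, so spreading the initial potential over all steps costs at most Bη per step.
  have hT1 : B / T ≤ ρ := by
    refine le_trans ?_ hBη
    rw [div_le_iff₀ (by positivity)]
    nlinarith [h.hT']
  obtain ⟨t, ht, hq, hs⟩ := exists_small_of_descent
    (U := fun t => ‖v - weightVec Ψ (weights K b 1 t)‖ ^ 2)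
    (q := fun t => avg fun i => inner ℝ (v - weightVec Ψ (weights K b 1 t)) (Ψ i) ^ 2)
    (B := B) (κ := (4 + 9 * C₁ + 36 * a + 5 * C₁ ^ 2 * a + C₁ * a) * ρ) hT0
    (fun t => sq_nonneg _) (by simpa [weightVec, weights] using h.hv) (by
      intro t ht hU
      have h1 := norm_sub_weightVec_succ_sq_le (K := K) (b := b) h.hΨ v h.hcg t _ (fun i => rfl)
      have h2 := h.avg_bias_sq_le ht
      set ξ := ‖vavg fun i => (b i - c i) • Ψ i‖
      set u := ‖v - weightVec Ψ (weights K b 1 t)‖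
      have hξ0 : 0 ≤ ξ := norm_nonneg _
      have hξ : ξ ≤ C₁ * η := h.noise
      have h3 : ξ ^ 2 ≤ C₁ ^ 2 * (a * ρ) := by
        calc ξ ^ 2 ≤ (C₁ * η) ^ 2 := pow_le_pow_left₀ hξ0 hξ 2
          _ = C₁ ^ 2 * η ^ 2 := by ring
          _ ≤ _ := by gcongr
      -- A linear bound in B, from u² ≤ B, lets the noise term be charged to η and Bη, both
      -- controlled by ρ.
      have hu : 2 * u ≤ 1 + B := by nlinarith [sq_nonneg (u - 1)]
      have h4 : 2 * u * ξ ≤ C₁ * (a * ρ) + C₁ * ρ := by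
        calc 2 * u * ξ ≤ (1 + B) * (C₁ * η) := by gcongr
          _ = C₁ * η + C₁ * (B * η) := by ring
          _ ≤ _ := by
            have := h.hC₁
            gcongr
      have h5 : C₁ * (G ^ 2 * η) ≤ C₁ * ρ := mul_le_mul_of_nonneg_left hGη h.hC₁
      nlinarith)
  refine ⟨t, ht, ?_, hs⟩
  linarith

/-- The minimiser is chosen with estimated kernel values. Passing to exact linear functionals costs
3ν in root mean square on each side. -/
theorem rms_val_le (h : GoodRun Ψ K b c g Χ k y cv v R P T η ν C₁ τ ε G B) {r t : ℕ} (hr : r < T)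
    (ht : t < T) (hrt : ∑ j, (∑ i, weights K b 1 r i * k i j - y j) ^ 2 ≤
      ∑ j, (∑ i, weights K b 1 t i * k i j - y j) ^ 2) :
    rms (fun j => inner ℝ (weightVec Ψ (weights K b 1 r)) (Χ j) - y j) ≤
      rms (fun j => inner ℝ (weightVec Ψ (weights K b 1 t)) (Χ j) - y j) + 6 * ν := by
  have hd : ∀ s < T, rms (fun j => ∑ i, weights K b 1 s i * k i j -
      inner ℝ (weightVec Ψ (weights K b 1 s)) (Χ j)) ≤ 3 * ν := fun s hs =>
    rms_le_of_abs_le h.hM (by linarith [h.hν0]) (h.abs_valDefect_le hs)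
  have h1 := rms_sub_le (fun j => ∑ i, weights K b 1 r i * k i j - y j)
    (fun j => ∑ i, weights K b 1 r i * k i j - inner ℝ (weightVec Ψ (weights K b 1 r)) (Χ j))
  have h2 := rms_add_le (fun j => inner ℝ (weightVec Ψ (weights K b 1 t)) (Χ j) - y j)
    (fun j => ∑ i, weights K b 1 t i * k i j - inner ℝ (weightVec Ψ (weights K b 1 t)) (Χ j))
  have h3 : rms (fun j => ∑ i, weights K b 1 r i * k i j - y j) ≤
      rms (fun j => ∑ i, weights K b 1 t i * k i j - y j) := by
    refine Real.sqrt_le_sqrt (div_le_div_of_nonneg_right hrt (Nat.cast_nonneg M))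
  have e1 : (fun j => ∑ i, weights K b 1 r i * k i j - y j -
      (∑ i, weights K b 1 r i * k i j - inner ℝ (weightVec Ψ (weights K b 1 r)) (Χ j))) =
      fun j => inner ℝ (weightVec Ψ (weights K b 1 r)) (Χ j) - y j := by
    funext j; ring
  have e2 : (fun j => inner ℝ (weightVec Ψ (weights K b 1 t)) (Χ j) - y j +
      (∑ i, weights K b 1 t i * k i j - inner ℝ (weightVec Ψ (weights K b 1 t)) (Χ j))) =
      fun j => ∑ i, weights K b 1 t i * k i j - y j := by
    funext j; ring
  rw [e1] at h1
  rw [e2] at h2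
  linarith [hd r hr, hd t ht]

theorem avg_bayes_le (h : GoodRun Ψ K b c g Χ k y cv v R P T η ν C₁ τ ε G B) :
    0 ≤ (avg fun j => (cv j - y j) ^ 2) ∧ (avg fun j => (cv j - y j) ^ 2) ≤ 1 := by
  refine ⟨avg_nonneg fun _ => sq_nonneg _, avg_le_of_le h.hM fun j => ?_⟩
  have h1 := h.hy j
  have h2 := h.hcv j
  nlinarith [h1.1, h1.2, h2.1, h2.2]

theorem valid' (h : GoodRun Ψ K b c g Χ k y cv v R P T η ν C₁ τ ε G B) {t : ℕ} (ht : t < T) :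
    |rms (fun j => inner ℝ (weightVec Ψ (weights K b 1 t)) (Χ j) - y j) ^ 2 -
      (avg fun j => (cv j - y j) ^ 2) - R (weightVec Ψ (weights K b 1 t))| ≤
      R (weightVec Ψ (weights K b 1 t)) / 2 + τ * ν := by
  rw [rms_sq, ← avg_sub]
  exact h.valid t ht

/-- Comparison with the zero hypothesis at time 0: the validation root mean square is at most 1 + 6ν
≤ 7, and relative deviation doubles 7². -/
theorem risk_le_const (h : GoodRun Ψ K b c g Χ k y cv v R P T η ν C₁ τ ε G B) {r : ℕ} (hr : r < T)
    (hmin : ∀ t < T, ∑ j, (∑ i, weights K b 1 r i * k i j - y j) ^ 2 ≤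
      ∑ j, (∑ i, weights K b 1 t i * k i j - y j) ^ 2) :
    R (weightVec Ψ (weights K b 1 r)) ≤ 98 + 2 * τ := by
  have hT0 : 0 < T := by omega
  have h1 := h.rms_val_le hr hT0 (hmin 0 hT0)
  have h2 : rms (fun j => inner ℝ (weightVec Ψ (weights K b 1 0)) (Χ j) - y j) ≤ 1 := by
    refine rms_le_of_abs_le h.hM zero_le_one fun j => ?_
    have := h.hy j
    simp only [weightVec, weights, zero_smul, Finset.sum_const_zero, inner_zero_left, zero_sub,
      abs_neg]
    exact abs_le.2 ⟨by linarith [this.1], this.2⟩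
  have h3 := (abs_le.1 (h.valid' hr)).1
  have h4 : rms (fun j => inner ℝ (weightVec Ψ (weights K b 1 r)) (Χ j) - y j) ^ 2 ≤ 7 ^ 2 :=
    pow_le_pow_left₀ (rms_nonneg _) (by linarith [h.hν1]) 2
  have h5 := h.avg_bayes_le.1
  have h6 : τ * ν ≤ τ := mul_le_of_le_one_right h.hτ h.hν1
  linarith

/-- The validation step selects an iterate whose risk is comparable to that of any other one. -/
theorem risk_le_of_risk_le (h : GoodRun Ψ K b c g Χ k y cv v R P T η ν C₁ τ ε G B) {r t : ℕ}
    (hr : r < T) (ht : t < T) (hrt : ∑ j, (∑ i, weights K b 1 r i * k i j - y j) ^ 2 ≤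
      ∑ j, (∑ i, weights K b 1 t i * k i j - y j) ^ 2) {κ : ℝ}
    (hκ : R (weightVec Ψ (weights K b 1 t)) ≤ κ) :
    R (weightVec Ψ (weights K b 1 r)) ≤
      3 * R (weightVec Ψ (weights K b 1 t)) + (28 * τ + 36 * κ + 96) * ν := by
  have h1 := h.rms_val_le hr ht hrt
  have h2 := (abs_le.1 (h.valid' hr)).1
  have h3 := (abs_le.1 (h.valid' ht)).2
  have h5 := h.avg_bayes_le
  have h6 : τ * ν ≤ τ := mul_le_of_le_one_right h.hτ h.hν1
  set V := rms fun j => inner ℝ (weightVec Ψ (weights K b 1 t)) (Χ j) - y j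
  set V' := rms fun j => inner ℝ (weightVec Ψ (weights K b 1 r)) (Χ j) - y j
  have hV0 : 0 ≤ V := rms_nonneg _
  have hV'0 : 0 ≤ V' := rms_nonneg _
  have hκ0 : 0 ≤ κ := (h.hR _).trans hκ
  have hV2 : V ^ 2 ≤ 3 / 2 * κ + τ + 1 := by linarith
  -- The right side is at least one, so a bound on the square also bounds V itself. This avoids a
  -- square root in the constants.
  have hV : V ≤ 3 / 2 * κ + τ + 1 := by
    have := h.hτ
    nlinarith
  have h7 : V' ^ 2 ≤ V ^ 2 + (12 * (3 / 2 * κ + τ + 1) + 36) * ν := by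
    have hν := h.hν0
    have hν2 : ν ^ 2 ≤ ν := by nlinarith [h.hν1]
    calc V' ^ 2 ≤ (V + 6 * ν) ^ 2 := pow_le_pow_left₀ hV'0 h1 2
      _ = V ^ 2 + 12 * V * ν + 36 * ν ^ 2 := by ring
      _ ≤ V ^ 2 + 12 * (3 / 2 * κ + τ + 1) * ν + 36 * ν := by gcongr
      _ = _ := by ring
  nlinarith

theorem trainErr_le_const (h : GoodRun Ψ K b c g Χ k y cv v R P T η ν C₁ τ ε G B) {t : ℕ}
    (ht : t < T) : rms (fun i => ∑ j, weights K b 1 t j * K j i - c i) ≤ 4 := by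
  have h1 := rms_residual_le (b := b) h.hN h.hΨ h.hK h.hb (h.time_mul_error_le_one ht)
  have h2 : rms (fun i => b i - c i) ≤ 1 := rms_le_of_abs_le h.hN zero_le_one fun i =>
    abs_le.2 ⟨by linarith [(h.hb i).1, (h.hc i).2], by linarith [(h.hb i).2, (h.hc i).1]⟩
  have h3 := rms_sub_le (fun i => b i - c i) (residual K b t)
  have e : (fun i => b i - c i - residual K b t i) =
      fun i => ∑ j, weights K b 1 t j * K j i - c i := by
    funext i; rw [residual]; ring
  rw [e] at h3
  linarith

/-- The training error hardly increases after any given time. -/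
theorem trainErr_le_trainErr (h : GoodRun Ψ K b c g Χ k y cv v R P T η ν C₁ τ ε G B) {r t : ℕ}
    (hr : r < T) (htr : t ≤ r) :
    (avg fun i => (∑ j, weights K b 1 r j * K j i - c i) ^ 2) ≤
      (avg fun i => (∑ j, weights K b 1 t j * K j i - c i) ^ 2) + 84 * ν + 16 * C₁ * √η := by
  have ht : t < T := by omega
  have h1 := avg_residual_sq_mono (b := b) h.hN h.hΨ h.hK h.hb htr (h.time_mul_error_le_one hr)
  have h1' := h.time_mul_error hr
  set ξ := vavg fun i => (b i - c i) • Ψ i with hξ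
  -- Since the prediction is b minus the residual, the error against c equals the squared residual
  -- plus a constant plus 2(b − c) times the prediction. Only the correlation with the noise and the
  -- kernel defect vary with time besides the residual.
  have key : ∀ s, (avg fun i => (∑ j, weights K b 1 s j * K j i - c i) ^ 2) =
      (avg fun i => residual K b s i ^ 2) + ((avg fun i => (b i - c i) ^ 2) -
        2 * (avg fun i => (b i - c i) * b i)) + 2 * inner ℝ (weightVec Ψ (weights K b 1 s)) ξ +
        2 * (avg fun i => (b i - c i) * (∑ j, weights K b 1 s j * K j i -
          inner ℝ (weightVec Ψ (weights K b 1 s)) (Ψ i))) := by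
    intro s
    rw [hξ, inner_vavg]
    simp only [← avg_mul_left, ← avg_add, ← avg_sub, inner_smul_right]
    congr 1
    funext i
    rw [residual]
    ring
  have hin : ∀ s < T, |inner ℝ (weightVec Ψ (weights K b 1 s)) ξ| ≤ 4 * C₁ * √η := by
    intro s hs
    calc _ ≤ ‖weightVec Ψ (weights K b 1 s)‖ * ‖ξ‖ := abs_real_inner_le_norm _ _
      _ ≤ ‖weightVec Ψ (weights K b 1 s)‖ * (C₁ * η) := by gcongr; exact h.noise
      _ = C₁ * (‖weightVec Ψ (weights K b 1 s)‖ * η) := by ring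
      _ ≤ C₁ * (4 * √η) := mul_le_mul_of_nonneg_left (h.abs_norm_le hs) h.hC₁
      _ = _ := by ring
  have hdef : ∀ s < T, |avg fun i => (b i - c i) * (∑ j, weights K b 1 s j * K j i -
      inner ℝ (weightVec Ψ (weights K b 1 s)) (Ψ i))| ≤ 3 * ν := by
    intro s hs
    refine (abs_avg_mul_le _ _).trans ?_
    have e1 : rms (fun i => b i - c i) ≤ 1 := rms_le_of_abs_le h.hN zero_le_one fun i =>
      abs_le.2 ⟨by linarith [(h.hb i).1, (h.hc i).2], by linarith [(h.hb i).2, (h.hc i).1]⟩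
    have e2 := rms_le_of_abs_le h.hN (by linarith [h.hν0]) (h.abs_trainDefect_le hs)
    calc _ ≤ 1 * (3 * ν) := mul_le_mul e1 e2 (rms_nonneg _) zero_le_one
      _ = _ := one_mul _
  rw [key r, key t]
  linarith [(abs_le.1 (hin r hr)).2, (abs_le.1 (hin t ht)).1, (abs_le.1 (hdef r hr)).2,
    (abs_le.1 (hdef t ht)).1]

theorem trainErr_le_of_avg (h : GoodRun Ψ K b c g Χ k y cv v R P T η ν C₁ τ ε G B) {t : ℕ}
    (ht : t < T) :
    (avg fun i => (∑ j, weights K b 1 t j * K j i - c i) ^ 2) ≤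
      2 * (avg fun i => inner ℝ (v - weightVec Ψ (weights K b 1 t)) (Ψ i) ^ 2) +
        2 * (2 * ε + 4 * C₁ * (G ^ 2 * η) + 18 * ν) := by
  refine le_trans ?_ (add_le_add le_rfl (mul_le_mul_of_nonneg_left (h.avg_bias_sq_le ht) zero_le_two))
  rw [← avg_mul_left, ← avg_mul_left, ← avg_add]
  refine avg_mono fun i => ?_
  rw [h.hcg, inner_sub_left]
  set p := ∑ j, weights K b 1 t j * K j i
  set q := inner ℝ (weightVec Ψ (weights K b 1 t)) (Ψ i)
  nlinarith [sq_nonneg ((inner ℝ v (Ψ i) - q) - (g i - (p - q)))]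

/-- Risk and training error of the selected iterate. -/
theorem risk_and_trainErr_le (h : GoodRun Ψ K b c g Χ k y cv v R P T η ν C₁ τ ε G B) {r : ℕ}
    (hr : r < T) (hmin : ∀ t < T, ∑ j, (∑ i, weights K b 1 r i * k i j - y j) ^ 2 ≤
      ∑ j, (∑ i, weights K b 1 t i * k i j - y j) ^ 2) {ρ a κ₁ κ₂ κ₃ : ℝ} (ha : 0 ≤ a)
    (hρ : ρ ≤ 1) (hε0 : 0 ≤ ε)
    (hε : ε ≤ ρ) (hGη : G ^ 2 * η ≤ ρ) (hBη : B * η ≤ ρ) (hηa : η ≤ a * ρ)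
    (hη2 : η ^ 2 ≤ a * ρ) (hsη : √η ≤ a * ρ) (hνa : ν ≤ a * ρ)
    (hκ₁ : κ₁ = 4 + 9 * C₁ + 36 * a + 5 * C₁ ^ 2 * a + C₁ * a)
    (hκ₂ : κ₂ = 4 * κ₁ + 6 + 4 * C₁)
    (hκ₃ : κ₃ = 3 * κ₂ + (28 * τ + 36 * κ₂ + 96) * a) :
    R (weightVec Ψ (weights K b 1 r)) ≤ κ₃ * ρ ∧
      (avg fun i => (∑ j, weights K b 1 r j * K j i - c i) ^ 2) ≤
        (5 * κ₁ + 4 * κ₃ + 4 * C₁ + 4 + 84 * a + 16 * C₁ * a) * ρ := by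
  have hρ0 : 0 ≤ ρ := hε0.trans hε
  have hC₁ := h.hC₁
  have hτ := h.hτ
  obtain ⟨t, ht, hq, hs⟩ := h.exists_time hε hGη hBη hηa hη2 hνa
  rw [← hκ₁] at hq
  have hκ₁0 : 0 ≤ κ₁ := by rw [hκ₁]; positivity
  have hκ₂0 : 0 ≤ κ₂ := by rw [hκ₂]; positivity
  have hκ₃0 : 0 ≤ κ₃ := by rw [hκ₃]; positivity
  have hη := h.hη
  have hB2 : ∀ s ≤ t, 2 * (C₁ * η) * ‖v - weightVec Ψ (weights K b 1 s)‖ ^ 2 ≤ 2 * C₁ * ρ := by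
    intro s hst
    calc _ ≤ 2 * (C₁ * η) * B := by gcongr; exact hs s hst
      _ = 2 * C₁ * (B * η) := by ring
      _ ≤ _ := by gcongr
  have hRt : R (weightVec Ψ (weights K b 1 t)) ≤ κ₂ * ρ := by
    have h1 := (abs_le.1 (h.second (v - weightVec Ψ (weights K b 1 t)))).1
    have h2 := h.hRP (weightVec Ψ (weights K b 1 t))
    rw [hκ₂]
    linarith [hB2 t le_rfl]
  have hRr : R (weightVec Ψ (weights K b 1 r)) ≤ κ₃ * ρ := by
    have h1 := h.risk_le_of_risk_le hr ht (hmin t ht) (κ := κ₂) (by nlinarith)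
    have h2 : (28 * τ + 36 * κ₂ + 96) * ν ≤ (28 * τ + 36 * κ₂ + 96) * (a * ρ) := by gcongr
    rw [hκ₃]
    linarith
  refine ⟨hRr, ?_⟩
  have hG1 : C₁ * (G ^ 2 * η) ≤ C₁ * ρ := mul_le_mul_of_nonneg_left hGη hC₁
  have hbias : 2 * (2 * ε + 4 * C₁ * (G ^ 2 * η) + 18 * ν) ≤ κ₁ * ρ := by
    have p1 : 0 ≤ C₁ * ρ := by positivity
    have p2 : 0 ≤ C₁ ^ 2 * a * ρ := by positivity
    have p3 : 0 ≤ C₁ * a * ρ := by positivity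
    rw [hκ₁]
    linarith
  have p1 : 0 ≤ κ₁ * ρ := by positivity
  have p3 : 0 ≤ κ₃ * ρ := by positivity
  have p4 : 0 ≤ C₁ * ρ := by positivity
  have p5 : 0 ≤ a * ρ := by positivity
  have p6 : 0 ≤ C₁ * a * ρ := by positivity
  -- After the good time, near-monotonicity of the training error applies. Before it, ‖v − w_r‖² ≤ B
  -- still holds, so the small risk transfers back to the empirical second moment.
  rcases le_or_gt t r with htr | htr
  · have h1 := h.trainErr_le_trainErr hr htr
    have h2 := h.trainErr_le_of_avg ht
    have h3 : C₁ * √η ≤ C₁ * (a * ρ) := by gcongr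
    linarith
  · have h1 := h.trainErr_le_of_avg hr
    have h2 := (abs_le.1 (h.second (v - weightVec Ψ (weights K b 1 r)))).2
    have h3 := h.hPR (weightVec Ψ (weights K b 1 r))
    have h4 := hB2 r htr.le
    linarith

/-- Weight vectors in a subspace on which the population second moment is coercive are bounded. -/
theorem norm_sq_le_of_gap (h : GoodRun Ψ K b c g Χ k y cv v R P T η ν C₁ τ ε G B) {t : ℕ}
    (ht : t < T) {σ : ℝ} (hσ : 0 < σ)
    (hgap : σ * ‖weightVec Ψ (weights K b 1 t)‖ ^ 2 ≤ P (weightVec Ψ (weights K b 1 t))) :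
    ‖weightVec Ψ (weights K b 1 t)‖ ^ 2 ≤ (98 + 64 * C₁) / σ := by
  set w := weightVec Ψ (weights K b 1 t) with hw
  have hC₁ := h.hC₁
  rw [le_div_iff₀ hσ]
  -- For small η the empirical covariance inherits half of the gap, and the predictions have root
  -- mean square at most 1 + 3 + 3 = 7. For large η, the bound ‖w_t‖² ≤ 16t with tη ≤ 1 already
  -- suffices.
  rcases le_or_gt (2 * (C₁ * η)) (σ / 2) with hc | hc
  · have h1 := (abs_le.1 (h.second w)).1
    have h2 : rms (fun i => inner ℝ w (Ψ i)) ≤ 7 := by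
      have e1 := rms_residual_le (b := b) h.hN h.hΨ h.hK h.hb (h.time_mul_error_le_one ht)
      have e2 : rms (fun i => ∑ j, weights K b 1 t j * K j i - inner ℝ w (Ψ i)) ≤ 3 :=
        rms_le_of_abs_le h.hN (by norm_num) fun i =>
          (h.abs_trainDefect_le ht i).trans (by linarith [h.hν1])
      have e3 : rms b ≤ 1 := rms_le_of_abs_le h.hN zero_le_one fun i =>
        abs_le.2 ⟨by linarith [(h.hb i).1], (h.hb i).2⟩
      have e4 := rms_sub_le b (residual K b t)
      have e5 := rms_sub_le (fun i => b i - residual K b t i)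
        (fun i => ∑ j, weights K b 1 t j * K j i - inner ℝ w (Ψ i))
      have e : (fun i => b i - residual K b t i -
          (∑ j, weights K b 1 t j * K j i - inner ℝ w (Ψ i))) = fun i => inner ℝ w (Ψ i) := by
        funext i; rw [residual]; ring
      rw [e] at e5
      linarith
    have h3 := pow_le_pow_left₀ (rms_nonneg _) h2 2
    rw [rms_sq] at h3
    have h4 : 2 * (C₁ * η) * ‖w‖ ^ 2 ≤ σ / 2 * ‖w‖ ^ 2 := by gcongr
    linarith
  · have h1 := norm_weightVec_sq_le h.hN h.hΨ h.hK h.hb (h.time_mul_error_le_one ht)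
    have h2 := h.hT t ht
    have h3 : 0 ≤ ‖w‖ ^ 2 := sq_nonneg _
    calc ‖w‖ ^ 2 * σ ≤ ‖w‖ ^ 2 * (4 * (C₁ * η)) := by gcongr; linarith
      _ ≤ (16 * t) * (4 * (C₁ * η)) := by
          have := h.hη
          gcongr
      _ = 64 * C₁ * (t * η) := by ring
      _ ≤ 64 * C₁ * 1 := by gcongr
      _ ≤ _ := by linarith

/-- The empirical error of the exact linear functional against the training error. -/
theorem avg_clean_le (h : GoodRun Ψ K b c g Χ k y cv v R P T η ν C₁ τ ε G B) {t : ℕ}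
    (ht : t < T) :
    (avg fun i => (inner ℝ (weightVec Ψ (weights K b 1 t)) (Ψ i) - c i) ^ 2) ≤
      (avg fun i => (∑ j, weights K b 1 t j * K j i - c i) ^ 2) + 33 * ν := by
  have h1 := h.trainErr_le_const ht
  have h2 := rms_le_of_abs_le h.hN (by linarith [h.hν0]) (h.abs_trainDefect_le ht)
  have h3 := rms_sub_le (fun i => ∑ j, weights K b 1 t j * K j i - c i)
    (fun i => ∑ j, weights K b 1 t j * K j i - inner ℝ (weightVec Ψ (weights K b 1 t)) (Ψ i))
  have e : (fun i => ∑ j, weights K b 1 t j * K j i - c i -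
      (∑ j, weights K b 1 t j * K j i - inner ℝ (weightVec Ψ (weights K b 1 t)) (Ψ i))) =
      fun i => inner ℝ (weightVec Ψ (weights K b 1 t)) (Ψ i) - c i := by
    funext i; ring
  rw [e] at h3
  rw [← rms_sq, ← rms_sq]
  have h4 := rms_nonneg fun i => ∑ j, weights K b 1 t j * K j i - c i
  have hν0 := h.hν0
  have hν2 : ν ^ 2 ≤ ν := by nlinarith [h.hν1]
  calc _ ≤ (rms (fun i => ∑ j, weights K b 1 t j * K j i - c i) + 3 * ν) ^ 2 :=
        pow_le_pow_left₀ (rms_nonneg _) (by linarith) 2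
    _ = rms (fun i => ∑ j, weights K b 1 t j * K j i - c i) ^ 2 +
        6 * rms (fun i => ∑ j, weights K b 1 t j * K j i - c i) * ν + 9 * ν ^ 2 := by ring
    _ ≤ rms (fun i => ∑ j, weights K b 1 t j * K j i - c i) ^ 2 + 6 * 4 * ν + 9 * ν := by gcongr
    _ = _ := by ring

end GoodRun

end Deterministic

/-! ### Fresh shots in the generalization error. -/

section GeneralizationError

/-- Unbiasedness removes the cross term. The fluctuation is bounded by Cauchy–Schwarz with weights
|α_i| and single-entry variances at most 1/m, so cross-covariances between different i need not be
evaluated. -/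
theorem sum_shotsProb_mul_sq_sub_le {n m N : ℕ} (hm : 0 < m) {φ : Fin N → QState n} {χ : QState n}
    (hφ : ∀ i, ‖φ i‖ = 1) (hχ : ‖χ‖ = 1) (α : Fin N → ℝ) (a : ℝ) :
    ∑ s : Fin N → Fin m → Bool, (∏ i, shotsProb (φ i) χ (s i)) *
      ((∑ i, α i * kernelEst (s i)) - a) ^ 2 ≤
      ((∑ i, α i * qKernel (φ i) χ) - a) ^ 2 + (∑ i, |α i|) ^ 2 / m := by
  set h := (∑ i, α i * qKernel (φ i) χ) - a with hh
  set d : (i : Fin N) → (Fin m → Bool) → ℝ := fun i u => kernelEst u - qKernel (φ i) χ with hd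
  have hone : ∀ i, ∑ u : Fin m → Bool, shotsProb (φ i) χ u = 1 := fun i => sum_shotsProb (hφ i) hχ
  have hp0 : ∀ s : Fin N → Fin m → Bool, 0 ≤ ∏ i, shotsProb (φ i) χ (s i) := fun s =>
    Finset.prod_nonneg fun i _ => shotsProb_nonneg _ _ _
  have hpt : ∀ s : Fin N → Fin m → Bool, ((∑ i, α i * kernelEst (s i)) - a) ^ 2 ≤
      h ^ 2 + 2 * h * (∑ i, α i * d i (s i)) + (∑ i, |α i|) * ∑ i, |α i| * d i (s i) ^ 2 := by
    intro s
    have e : (∑ i, α i * kernelEst (s i)) - a = h + ∑ i, α i * d i (s i) := by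
      simp only [hh, hd, mul_sub, Finset.sum_sub_distrib]
      ring
    have hcs : (∑ i, α i * d i (s i)) ^ 2 ≤ (∑ i, |α i|) * ∑ i, |α i| * d i (s i) ^ 2 := by
      refine Finset.sum_sq_le_sum_mul_sum_of_sq_le_mul _ (fun i _ => abs_nonneg _)
        (fun i _ => by positivity) fun i _ => le_of_eq ?_
      rw [mul_pow, ← sq_abs (α i)]
      ring
    rw [e]
    linarith
  calc _ ≤ ∑ s : Fin N → Fin m → Bool, (∏ i, shotsProb (φ i) χ (s i)) *
        (h ^ 2 + 2 * h * (∑ i, α i * d i (s i)) + (∑ i, |α i|) * ∑ i, |α i| * d i (s i) ^ 2) :=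
        Finset.sum_le_sum fun s _ => mul_le_mul_of_nonneg_left (hpt s) (hp0 s)
    _ = (∑ s : Fin N → Fin m → Bool, ∏ i, shotsProb (φ i) χ (s i)) * h ^ 2 +
        2 * h * (∑ i, α i * ∑ s : Fin N → Fin m → Bool,
          (∏ i, shotsProb (φ i) χ (s i)) * d i (s i)) +
        (∑ i, |α i|) * ∑ i, |α i| * ∑ s : Fin N → Fin m → Bool,
          (∏ i, shotsProb (φ i) χ (s i)) * d i (s i) ^ 2 := by
        have e1 : ∀ β : Fin N → ℝ, ∀ f : Fin N → (Fin m → Bool) → ℝ,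
            ∑ i, β i * ∑ s : Fin N → Fin m → Bool, (∏ i, shotsProb (φ i) χ (s i)) * f i (s i) =
            ∑ s : Fin N → Fin m → Bool, (∏ i, shotsProb (φ i) χ (s i)) * ∑ i, β i * f i (s i) := by
          intro β f
          simp only [Finset.mul_sum]
          rw [Finset.sum_comm]
          exact Finset.sum_congr rfl fun s _ => Finset.sum_congr rfl fun i _ => by ring
        rw [e1 α d, e1 (fun i => |α i|) fun i u => d i u ^ 2, Finset.sum_mul, Finset.mul_sum,
          Finset.mul_sum, ← Finset.sum_add_distrib, ← Finset.sum_add_distrib]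
        exact Finset.sum_congr rfl fun s _ => by ring
    _ ≤ 1 * h ^ 2 + 2 * h * 0 + (∑ i, |α i|) * ∑ i, |α i| * (1 / m) := by
        refine add_le_add (add_le_add (le_of_eq ?_) (le_of_eq ?_)) ?_
        · rw [sum_prod_eq_one (fun i => shotsProb (φ i) χ) hone]
        · congr 1
          refine Finset.sum_eq_zero fun i _ => ?_
          rw [sum_prod_mul_apply (fun i => shotsProb (φ i) χ) hone i (d i),
            sum_shotsProb_mul_sub hm (hφ i) hχ, mul_zero]
        · refine mul_le_mul_of_nonneg_left (Finset.sum_le_sum fun i _ =>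
            mul_le_mul_of_nonneg_left ?_ (abs_nonneg _)) (Finset.sum_nonneg fun i _ => abs_nonneg _)
          rw [sum_prod_mul_apply (fun i => shotsProb (φ i) χ) hone i fun u => d i u ^ 2]
          exact sum_shotsProb_mul_sq_le hm (hφ i) hχ
    _ = _ := by rw [← Finset.sum_mul]; ring

/-- The weight vector of a run in feature space. -/
def runVec {X : Type*} {n N M m : ℕ} (ψ : X → QState n) (ω : Run X N M m) (t : ℕ) : Feature n :=
  weightVec (fun i => feature (ψ (ω.1.1 i).1)) (runWeights 1 ω t)

theorem genErr_le {X : Type*} [MeasurableSpace X] {n N M m : ℕ} (hm : 0 < m) {ψ : X → QState n}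
    (hψm : Measurable ψ) (hψ : ∀ x, ‖ψ x‖ = 1) (D : Measure (X × ℝ)) [IsProbabilityMeasure D]
    {c : X → ℝ} (hcm : Measurable c) (hc : ∀ᵐ z ∂D, c z.1 ∈ Set.Icc (0 : ℝ) 1)
    (ω : Run X N M m) (t : ℕ) :
    genErr ψ D 1 c ω t ≤ popRisk D (fun x => feature (ψ x)) c (runVec ψ ω t) +
      (∑ i, |runWeights 1 ω t i|) ^ 2 / m := by
  have hint := integrable_risk (D := D) (Ψ := fun x => feature (ψ x)) (by fun_prop)
    (fun x => norm_feature (hψ x)) hcm hc (runVec ψ ω t)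
  have e : popRisk D (fun x => feature (ψ x)) c (runVec ψ ω t) +
      (∑ i, |runWeights 1 ω t i|) ^ 2 / m =
      ∫ z, ((inner ℝ (runVec ψ ω t) (feature (ψ z.1)) - c z.1) ^ 2 +
        (∑ i, |runWeights 1 ω t i|) ^ 2 / m) ∂D := by
    rw [integral_add hint (integrable_const _)]
    simp [popRisk]
  rw [e, genErr]
  refine integral_mono_of_nonneg (Filter.Eventually.of_forall fun z => ?_)
    (hint.add (integrable_const _)) (Filter.Eventually.of_forall fun z => ?_)
  · exact Finset.sum_nonneg fun s _ => mul_nonneg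
      (Finset.prod_nonneg fun i _ => shotsProb_nonneg _ _ _) (sq_nonneg _)
  · have := sum_shotsProb_mul_sq_sub_le hm (φ := fun i => ψ (ω.1.1 i).1) (fun i => hψ _) (hψ z.1)
      (runWeights 1 ω t) (c z.1)
    simp only [runVec, inner_weightVec, inner_feature]
    exact this

end GeneralizationError

/-! ### Probabilities of the individual bad events. -/

section Events

variable {X : Type*} [MeasurableSpace X] {n N M m : ℕ} {ψ : X → QState n}

theorem runLaw_vavg_le (hψm : Measurable ψ) (hψ : ∀ x, ‖ψ x‖ = 1) (D : Measure (X × ℝ))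
    [IsProbabilityMeasure D] {E : Type*} [NormedAddCommGroup E] [InnerProductSpace ℝ E]
    [MeasurableSpace E] [BorelSpace E] [SecondCountableTopology E] [CompleteSpace E]
    (Y : X × ℝ → E) (hY : Measurable Y) {R : ℝ} (hR : 0 < R) (hb : ∀ᵐ z ∂D, ‖Y z‖ ≤ R)
    (hN : 0 < N) {s : ℝ} (hs : 0 ≤ s) :
    runLaw ψ D N M m {ω | 2 * R * s < ‖vavg (fun i => Y (ω.1.1 i)) - ∫ z, Y z ∂D‖} ≤
      ENNReal.ofReal (2 * Real.exp (-(N * s ^ 2 / 2))) := by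
  refine (runLaw_train_le hψm hψ D
    (A := {a | 2 * R * s < ‖vavg (fun i => Y (a i)) - ∫ z, Y z ∂D‖}) ?_).trans
    (measure_vavg_sub_integral_le D Y hY hR hb hN hs)
  unfold vavg
  exact measurableSet_lt measurable_const (by fun_prop)

theorem runLaw_noise_le (hψm : Measurable ψ) (hψ : ∀ x, ‖ψ x‖ = 1) {D : Measure (X × ℝ)}
    [IsProbabilityMeasure D] {c : X → ℝ} (hcm : Measurable c)
    (hy : ∀ᵐ z ∂D, z.2 ∈ Set.Icc (0 : ℝ) 1) (hc : ∀ᵐ z ∂D, c z.1 ∈ Set.Icc (0 : ℝ) 1)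
    (hce : D[fun z => z.2 | MeasurableSpace.comap Prod.fst inferInstance] =ᵐ[D] fun z => c z.1)
    (hN : 0 < N) {s : ℝ} (hs : 0 ≤ s) :
    runLaw ψ D N M m {ω | s < ‖vavg fun i => ((ω.1.1 i).2 - c (ω.1.1 i).1) •
      feature (ψ (ω.1.1 i).1)‖} ≤ ENNReal.ofReal (2 * Real.exp (-(N * s ^ 2 / 2))) := by
  refine (runLaw_train_le hψm hψ D (A := {a | s < ‖vavg fun i => ((a i).2 - c (a i).1) •
      feature (ψ (a i).1)‖}) ?_).trans
    (measure_vavg_le_of_centred D (fun z => (z.2 - c z.1) • feature (ψ z.1)) (by fun_prop) ?_ ?_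
      hN hs)
  · unfold vavg
    exact measurableSet_lt measurable_const (by fun_prop)
  · filter_upwards [hy, hc] with z h1 h2
    rw [norm_smul, norm_feature (hψ _), mul_one, Real.norm_eq_abs, abs_le]
    constructor <;> linarith [h1.1, h1.2, h2.1, h2.2]
  · intro u
    have := integral_mul_sub_regression (f := fun x => inner ℝ u (feature (ψ x))) hy hce
      (by fun_prop) (A := ‖u‖) (Filter.Eventually.of_forall fun z =>
        abs_inner_feature_le (fun x => norm_feature (hψ x)) u z.1)
    simp only [inner_smul_right]
    rw [← this]
    exact integral_congr_ae (Filter.Eventually.of_forall fun z => mul_comm _ _)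

theorem measurable_weights {Ω : Type*} [MeasurableSpace Ω] {K : Ω → Fin N → Fin N → ℝ}
    {b : Ω → Fin N → ℝ} (hK : ∀ i j, Measurable fun ω => K ω i j)
    (hb : ∀ i, Measurable fun ω => b ω i) (lr : ℝ) (t : ℕ) (i : Fin N) :
    Measurable fun ω => weights (K ω) (b ω) lr t i := by
  induction t generalizing i with
  | zero => exact measurable_const
  | succ t ih =>
    simp only [weights]
    fun_prop

theorem measurable_runVec (hψm : Measurable ψ) (t : ℕ) :
    Measurable fun ω : Run X N M m => runVec ψ ω t := by
  have hk : Measurable (kernelEst (m := m)) := measurable_of_finite _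
  have hw : ∀ i, Measurable fun ω : Run X N M m => runWeights 1 ω t i := fun i =>
    measurable_weights (K := fun (ω : Run X N M m) i j => kernelEst (ω.2.1 i j))
      (b := fun ω i => (ω.1.1 i).2)
      (fun i j => by fun_prop) (fun i => by fun_prop) 1 t i
  unfold runVec weightVec
  fun_prop

theorem measurable_popRisk {ι : Type*} [Fintype ι] (D : Measure (X × ℝ)) [IsProbabilityMeasure D]
    {Ψ : X → EuclideanSpace ℝ ι} (hΨ : Measurable Ψ) {c : X → ℝ} (hcm : Measurable c) :
    Measurable (popRisk D Ψ c) := by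
  refine (StronglyMeasurable.integral_prod_right (f := fun w (z : X × ℝ) =>
    (inner ℝ w (Ψ z.1) - c z.1) ^ 2) (Measurable.stronglyMeasurable ?_)).measurable
  unfold Function.uncurry
  fun_prop

/-- Validation is reliable for all iterates simultaneously. -/
theorem runLaw_validation_le (hψm : Measurable ψ) (hψ : ∀ x, ‖ψ x‖ = 1) {D : Measure (X × ℝ)}
    [IsProbabilityMeasure D] {c : X → ℝ} (hcm : Measurable c)
    (hy : ∀ᵐ z ∂D, z.2 ∈ Set.Icc (0 : ℝ) 1) (hc : ∀ᵐ z ∂D, c z.1 ∈ Set.Icc (0 : ℝ) 1)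
    (hce : D[fun z => z.2 | MeasurableSpace.comap Prod.fst inferInstance] =ᵐ[D] fun z => c z.1)
    (hM : 0 < M) (T : ℕ) (l : ℝ) :
    runLaw ψ D N M m {ω | ∃ t < T, popRisk D (fun x => feature (ψ x)) c (runVec ψ ω t) / 2 +
      2 * (‖runVec ψ ω t‖ + 2) ^ 2 * l / M <
      |(avg fun j => excess (fun x => feature (ψ x)) c (runVec ψ ω t) (ω.1.2 j)) -
        popRisk D (fun x => feature (ψ x)) c (runVec ψ ω t)|} ≤
      ENNReal.ofReal (T * (2 * Real.exp (-l))) := by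
  have hΨ : Measurable fun x => feature (ψ x) := by fun_prop
  have hset : {ω : Run X N M m | ∃ t < T,
      popRisk D (fun x => feature (ψ x)) c (runVec ψ ω t) / 2 +
      2 * (‖runVec ψ ω t‖ + 2) ^ 2 * l / M <
      |(avg fun j => excess (fun x => feature (ψ x)) c (runVec ψ ω t) (ω.1.2 j)) -
        popRisk D (fun x => feature (ψ x)) c (runVec ψ ω t)|} =
      ⋃ t ∈ Finset.range T, {ω : Run X N M m |
      popRisk D (fun x => feature (ψ x)) c (runVec ψ ω t) / 2 +
      2 * (‖runVec ψ ω t‖ + 2) ^ 2 * l / M <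
      |(avg fun j => excess (fun x => feature (ψ x)) c (runVec ψ ω t) (ω.1.2 j)) -
        popRisk D (fun x => feature (ψ x)) c (runVec ψ ω t)|} := by
    ext ω
    simp
  rw [hset]
  refine (measure_biUnion_finset_le _ _).trans ?_
  have hone : ∀ t ∈ Finset.range T, runLaw ψ D N M m {ω : Run X N M m |
      popRisk D (fun x => feature (ψ x)) c (runVec ψ ω t) / 2 +
      2 * (‖runVec ψ ω t‖ + 2) ^ 2 * l / M <
      |(avg fun j => excess (fun x => feature (ψ x)) c (runVec ψ ω t) (ω.1.2 j)) -
        popRisk D (fun x => feature (ψ x)) c (runVec ψ ω t)|} ≤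
      ENNReal.ofReal (2 * Real.exp (-l)) := by
    intro t _
    refine runLaw_le_of_validation hψm hψ D (A := fun a s => {x |
      popRisk D (fun x => feature (ψ x)) c (weightVec (fun i => feature (ψ (a i).1))
        (weights (fun i j => kernelEst (s i j)) (fun i => (a i).2) 1 t)) / 2 +
      2 * (‖weightVec (fun i => feature (ψ (a i).1))
        (weights (fun i j => kernelEst (s i j)) (fun i => (a i).2) 1 t)‖ + 2) ^ 2 * l / M <
      |(avg fun j => excess (fun x => feature (ψ x)) c (weightVec (fun i => feature (ψ (a i).1))
        (weights (fun i j => kernelEst (s i j)) (fun i => (a i).2) 1 t)) (x j)) -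
        popRisk D (fun x => feature (ψ x)) c (weightVec (fun i => feature (ψ (a i).1))
        (weights (fun i j => kernelEst (s i j)) (fun i => (a i).2) 1 t))|}) ?_ fun a s =>
      measure_excess_deviation_le hΨ (fun x => norm_feature (hψ x)) hcm hy hc hce _ hM l
    have hw := measurable_runVec (N := N) (M := M) (m := m) hψm t
    have hR := (measurable_popRisk D hΨ hcm).comp hw
    change MeasurableSet {ω : Run X N M m |
      popRisk D (fun x => feature (ψ x)) c (runVec ψ ω t) / 2 +
      2 * (‖runVec ψ ω t‖ + 2) ^ 2 * l / M <
      |(avg fun j => excess (fun x => feature (ψ x)) c (runVec ψ ω t) (ω.1.2 j)) -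
        popRisk D (fun x => feature (ψ x)) c (runVec ψ ω t)|}
    unfold avg excess
    refine measurableSet_lt ?_ ?_
    · exact (hR.div_const 2).add (by fun_prop)
    · refine Measurable.abs (Measurable.sub ?_ hR)
      fun_prop
  refine (Finset.sum_le_sum hone).trans (le_of_eq ?_)
  rw [Finset.sum_const, Finset.card_range, nsmul_eq_mul, ENNReal.ofReal_mul (Nat.cast_nonneg T),
    ENNReal.ofReal_natCast]

end Events

/-! ### Numerical consequences of the parameter choices. -/

section Numerics

/-- Each bad event may cost δ/8, and 2 exp(−3) ≤ 1/8 is the reason for the additive 3 in the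
exponents. -/
theorem two_mul_exp_neg_le {δ x : ℝ} (hδ : 0 < δ) (hx : Real.log (1 / δ) + 3 ≤ x) :
    2 * Real.exp (-x) ≤ δ / 8 := by
  have h1 : Real.exp (-x) ≤ Real.exp (-(Real.log (1 / δ) + 3)) := Real.exp_le_exp.2 (by linarith)
  have h2 : Real.exp (-(Real.log (1 / δ) + 3)) = δ * Real.exp (-3) := by
    rw [neg_add, Real.exp_add, one_div, Real.log_inv, neg_neg, Real.exp_log hδ]
  have h3 : Real.exp (-3) ≤ 1 / 16 := by
    rw [Real.exp_neg, ← one_div]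
    apply one_div_le_one_div_of_le (by norm_num)
    have h4 : Real.exp 3 = Real.exp 1 ^ 3 := by rw [← Real.exp_nat_mul]; norm_num
    rw [h4]
    have := Real.exp_one_gt_d9
    calc (16 : ℝ) ≤ 2.7 ^ 3 := by norm_num
      _ ≤ _ := by gcongr; linarith
  rw [h2] at h1
  nlinarith

set_option maxHeartbeats 1000000 in
/-- The number of iterations, validation points and shots for given `N` and `δ`. -/
theorem parameter_bounds {δ₀ δ : ℝ} (hδ₀ : 0 < δ₀) (hδ₁ : δ₀ < 1) (hδ : 0 < δ) (hδδ : δ ≤ δ₀)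
    {N : ℕ} (hN : 1 ≤ N) {L₀ b cQ L : ℝ} (hL₀ : L₀ = Real.log (1 / δ₀)) (hb : b = 1 / √L₀)
    (hcQ : cQ = 8 * (2 + (10 + b) / L₀)) (hL : L = Real.log (1 / δ)) {T M m : ℕ}
    (hT : T = ⌈√(N / L)⌉₊) (hM : M = ⌈N * Real.log (T / δ)⌉₊)
    (hm : m = ⌈cQ * (N : ℝ) ^ (5 / 2 : ℝ)⌉₊) :
    0 < L₀ ∧ L₀ ≤ L ∧ 0 < √(L / N) ∧ 0 < T ∧ 0 < M ∧ 0 < m ∧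
    1 / √N ≤ b * √(L / N) ∧ (∀ t < T, t * √(L / N) ≤ 1) ∧ 1 ≤ T * √(L / N) ∧
    N * N * (2 * Real.exp (-(m * (√(L / N) * (1 / √N)) ^ 2 / 8))) ≤ δ / 8 ∧
    N * M * (2 * Real.exp (-(m * (√(L / N) * (1 / √N)) ^ 2 / 8))) ≤ δ / 8 ∧
    Real.log (16 * T / δ) / M ≤ (1 + 3 / L₀) * (1 / N) ∧
    T * (2 * Real.exp (-Real.log (16 * T / δ))) ≤ δ / 8 ∧
    (∀ t < T, (t : ℝ) / N ≤ b * (1 / √N)) ∧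
    (∀ t < T, (3 * t : ℝ) ^ 2 / m ≤ 9 / L₀ * (1 / √N)) := by
  have hL₀p : 0 < L₀ := by
    rw [hL₀]
    exact Real.log_pos (by rw [lt_div_iff₀ hδ₀]; linarith)
  have hLL : L₀ ≤ L := by
    rw [hL₀, hL]
    exact Real.log_le_log (by positivity) (one_div_le_one_div_of_le hδ hδδ)
  have hLp : 0 < L := hL₀p.trans_le hLL
  have hN1 : (1 : ℝ) ≤ N := by exact_mod_cast hN
  have hN0 : (0 : ℝ) < N := by linarith
  have hb0 : 0 < b := by rw [hb]; positivity
  have hs0 : 0 < √(N : ℝ) := Real.sqrt_pos.2 hN0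
  have hs1 : 1 ≤ √(N : ℝ) := Real.one_le_sqrt.2 hN1
  have hss : √(N : ℝ) * √N = N := Real.mul_self_sqrt hN0.le
  set η := √(L / N) with hη
  have hη0 : 0 < η := Real.sqrt_pos.2 (by positivity)
  have hηe : η = √L / √N := by rw [hη, Real.sqrt_div hLp.le]
  have hηsq : η ^ 2 = L / N := Real.sq_sqrt (by positivity)
  have hinv : √(N / L) = 1 / η := by
    rw [hη, one_div, ← Real.sqrt_inv, inv_div]
  have hTp : 0 < T := by
    rw [hT]; exact Nat.ceil_pos.2 (Real.sqrt_pos.2 (by positivity))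
  have hT1 : (1 : ℝ) ≤ T := by exact_mod_cast hTp
  -- T is the ceiling of 1/η, so every index strictly below T is strictly below 1/η itself.
  have hTη : ∀ t < T, t * η ≤ 1 := by
    intro t ht
    rw [hT, Nat.lt_ceil, hinv, lt_div_iff₀ hη0] at ht
    exact ht.le
  have hTη' : 1 ≤ T * η := by
    have := Nat.le_ceil √(N / L)
    rw [← hT, hinv, div_le_iff₀ hη0] at this
    exact this
  have hlogT : Real.log (T / δ) = Real.log T + L := by
    rw [Real.log_div (by positivity) hδ.ne', hL, one_div, Real.log_inv]
    ring
  have hlogT0 : 0 ≤ Real.log T := Real.log_nonneg hT1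
  have hlogL : L ≤ Real.log (T / δ) := by linarith
  have hMle : (N : ℝ) * Real.log (T / δ) ≤ M := by rw [hM]; exact Nat.le_ceil _
  have hMp : 0 < M := by
    rw [hM]; exact Nat.ceil_pos.2 (mul_pos hN0 (by linarith))
  have hcQ1 : 1 ≤ cQ := by
    have : 0 ≤ (10 + b) / L₀ := by positivity
    rw [hcQ]; linarith
  have hmle : cQ * (N : ℝ) ^ (5 / 2 : ℝ) ≤ m := by rw [hm]; exact Nat.le_ceil _
  have hmp : 0 < m := by
    rw [hm]; exact Nat.ceil_pos.2 (by positivity)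
  have hpow : (N : ℝ) ^ (5 / 2 : ℝ) = N ^ 2 * √N := by
    rw [Real.sqrt_eq_rpow, ← Real.rpow_natCast (N : ℝ) 2, ← Real.rpow_add hN0]
    norm_num
  rw [hpow] at hmle
  have hν : 1 / √(N : ℝ) ≤ b * η := by
    rw [hb, hηe, div_mul_div_comm, one_mul, div_le_div_iff₀ hs0 (by positivity), one_mul]
    have : √L₀ ≤ √L := Real.sqrt_le_sqrt hLL
    gcongr
  -- With accuracy e = ην one has e² = L/N², so N^(5/2) shots leave a factor √N L in the exponent.
  -- The shape of `cQ` is read off from this bound, with L/L₀ ≥ 1 converting the second summand.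
  have hme : 2 * √N * L + (10 + b) * √N ≤ m * (η * (1 / √N)) ^ 2 / 8 := by
    have e1 : (η * (1 / √N)) ^ 2 = L / N ^ 2 := by
      rw [mul_pow, hηsq, div_pow, one_pow, sq √(N : ℝ), hss]
      field_simp
    rw [e1]
    have e2 : cQ * (N ^ 2 * √N) * (L / N ^ 2) ≤ m * (L / N ^ 2) := by gcongr
    have e3 : cQ * (N ^ 2 * √N) * (L / N ^ 2) = cQ * √N * L := by field_simp
    have e4 : cQ * √N * L = 8 * (2 * √N * L + (10 + b) * √N * (L / L₀)) := by
      rw [hcQ]; field_simp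
    have e5 : (10 + b) * √N * 1 ≤ (10 + b) * √N * (L / L₀) := by
      gcongr
      rwa [le_div_iff₀ hL₀p, one_mul]
    linarith
  have hsexp : √(N : ℝ) ≤ Real.exp √N := by linarith [Real.add_one_le_exp √(N : ℝ)]
  -- Q is the number of entries in the union bound. Crude bounds of the form exp(const · √N) suffice
  -- because the exponent above is of order √N.
  have hunion : ∀ (Q q : ℝ), Q ≤ Real.exp q → L + 3 + q ≤ 2 * √N * L + (10 + b) * √N →
      Q * (2 * Real.exp (-(m * (η * (1 / √N)) ^ 2 / 8))) ≤ δ / 8 := by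
    intro Q q hQ hq
    calc _ ≤ Real.exp q * (2 * Real.exp (-(m * (η * (1 / √N)) ^ 2 / 8))) := by gcongr
      _ = 2 * Real.exp (-(m * (η * (1 / √N)) ^ 2 / 8 - q)) := by
          rw [mul_left_comm, ← Real.exp_add]; congr 2; ring
      _ ≤ δ / 8 := two_mul_exp_neg_le hδ (by rw [← hL]; linarith)
  have hNL : L ≤ √N * L := le_mul_of_one_le_left hLp.le hs1
  have hNb : b ≤ b * √N := le_mul_of_one_le_right hb0.le hs1
  have hNN : (N : ℝ) ≤ Real.exp (2 * √N) := by
    calc (N : ℝ) = √N * √N := hss.symm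
      _ ≤ Real.exp √N * Real.exp √N := by gcongr
      _ = _ := by rw [← Real.exp_add]; ring_nf
  have hMexp : (M : ℝ) ≤ Real.exp (3 * √N + (b + 2 + L)) := by
    have h1 : (M : ℝ) < N * Real.log (T / δ) + 1 := by
      rw [hM]; exact Nat.ceil_lt_add_one (mul_nonneg hN0.le (by linarith))
    have h2 : (T : ℝ) < b * √N + 1 := by
      have : (T : ℝ) < √(N / L) + 1 := by rw [hT]; exact Nat.ceil_lt_add_one (Real.sqrt_nonneg _)
      have h3 : √(N / L) ≤ b * √N := by
        rw [hinv, div_le_iff₀ hη0]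
        rw [div_le_iff₀ hs0] at hν
        linarith
      linarith
    have h3 : Real.log T ≤ T - 1 := Real.log_le_sub_one_of_pos (by linarith)
    have h4 : (N : ℝ) * Real.log (T / δ) ≤ N * (b * √N + L) := by
      rw [hlogT]; gcongr; linarith
    have h5 : (N : ℝ) * (b * √N + L) + 1 ≤ N * √N * (b + 2 + L) := by
      have e1 : (N : ℝ) * L ≤ N * √N * L := by
        rw [mul_assoc]; gcongr
      have e2 : (1 : ℝ) ≤ N * √N := by nlinarith
      nlinarith
    have h6 : b + 2 + L ≤ Real.exp (b + 2 + L) := by linarith [Real.add_one_le_exp (b + 2 + L)]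
    calc (M : ℝ) ≤ N * √N * (b + 2 + L) := by linarith
      _ ≤ Real.exp (2 * √N) * Real.exp √N * Real.exp (b + 2 + L) := by gcongr
      _ = _ := by rw [← Real.exp_add, ← Real.exp_add]; ring_nf
  refine ⟨hL₀p, hLL, hη0, hTp, hMp, hmp, hν, hTη, hTη', ?_, ?_, ?_, ?_, ?_, ?_⟩
  · refine hunion _ (4 * √N) ?_ (by nlinarith)
    calc (N : ℝ) * N ≤ Real.exp (2 * √N) * Real.exp (2 * √N) := by gcongr
      _ = _ := by rw [← Real.exp_add]; ring_nf
  · refine hunion _ (5 * √N + (b + 2 + L)) ?_ (by linarith)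
    calc (N : ℝ) * M ≤ Real.exp (2 * √N) * Real.exp (3 * √N + (b + 2 + L)) := by gcongr
      _ = _ := by rw [← Real.exp_add]; ring_nf
  · have hM0 : (0 : ℝ) < M := by exact_mod_cast hMp
    have h16 : Real.log 16 ≤ 3 := by
      rw [Real.log_le_iff_le_exp (by norm_num)]
      have h4 : Real.exp 3 = Real.exp 1 ^ 3 := by rw [← Real.exp_nat_mul]; norm_num
      rw [h4]
      have := Real.exp_one_gt_d9
      calc (16 : ℝ) ≤ 2.7 ^ 3 := by norm_num
        _ ≤ _ := by gcongr; linarith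
    have h1 : Real.log (16 * T / δ) = Real.log 16 + Real.log (T / δ) := by
      rw [mul_div_assoc, Real.log_mul (by norm_num) (by positivity)]
    have h2 : 3 ≤ 3 / L₀ * Real.log (T / δ) := by
      rw [div_mul_eq_mul_div, le_div_iff₀ hL₀p]
      nlinarith
    rw [h1, div_le_iff₀ hM0]
    have h3 : (1 + 3 / L₀) * (1 / N) * (N * Real.log (T / δ)) ≤ (1 + 3 / L₀) * (1 / N) * M := by
      gcongr
    have h4 : (1 + 3 / L₀) * (1 / N) * (N * Real.log (T / δ)) = (1 + 3 / L₀) * Real.log (T / δ) := by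
      field_simp
    linarith
  · rw [Real.exp_neg, Real.exp_log (by positivity)]
    apply le_of_eq
    field_simp
    norm_num
  · intro t ht
    have h1 := hTη t ht
    rw [div_le_iff₀ hN0]
    have h2 : b * (1 / √N) * N = b * √N := by
      calc b * (1 / √N) * N = b * (1 / √N) * (√N * √N) := by rw [hss]
        _ = b * √N := by field_simp
    rw [h2]
    rw [div_le_iff₀ hs0] at hν
    have h4 : (t : ℝ) ≤ t * (b * η * √N) := le_mul_of_one_le_right (Nat.cast_nonneg t) hν
    have h5 : t * η * (b * √N) ≤ 1 * (b * √N) := by gcongr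
    linarith
  · intro t ht
    have h1 := hTη t ht
    have hm0 : (0 : ℝ) < m := by exact_mod_cast hmp
    have h2 : (t : ℝ) ^ 2 * L ≤ N := by
      have : (t * η) ^ 2 ≤ 1 := pow_le_one₀ (by positivity) h1
      rw [mul_pow, hηsq, ← mul_div_assoc, div_le_one hN0] at this
      exact this
    have h3 : (N : ℝ) * √N ≤ m := by
      have e1 : 1 * (N * √N) ≤ cQ * (N ^ 2 * √N) := by
        gcongr
        nlinarith
      linarith
    rw [div_le_iff₀ hm0]
    have h4 : 9 / L₀ * (1 / √N) * (N * √N) ≤ 9 / L₀ * (1 / √N) * m := by gcongr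
    have h5 : 9 / L₀ * (1 / √N) * (N * √N) = 9 * (N / L₀) := by field_simp
    have h6 : (t : ℝ) ^ 2 ≤ N / L₀ := by
      rw [le_div_iff₀ hL₀p]
      have : (t : ℝ) ^ 2 * L₀ ≤ t ^ 2 * L := by gcongr
      linarith
    nlinarith

end Numerics

/-! ### The comparison vector, and error terms against the rate. -/

section Assembly

theorem inner_weightVec_kernelComb {X : Type*} {n k : ℕ} (ψ : X → QState n) (p : Fin k → X)
    (α : Fin k → ℝ) (x : X) :
    inner ℝ (weightVec (fun i => feature (ψ (p i))) α) (feature (ψ x)) = kernelComb ψ p α x := by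
  simp only [inner_weightVec, inner_feature, kernelComb]

/-- The quadratic form bounded by B is the squared norm of the comparison vector; this is how B
becomes the initial potential of the descent, and why it is nonnegative. -/
theorem norm_weightVec_sq_eq {X : Type*} {n k : ℕ} (ψ : X → QState n) (p : Fin k → X)
    (α : Fin k → ℝ) : ‖weightVec (fun i => feature (ψ (p i))) α‖ ^ 2 =
      ∑ i, ∑ j, α i * α j * qKernel (ψ (p i)) (ψ (p j)) := by
  rw [← real_inner_self_eq_norm_sq, inner_weightVec]
  refine Finset.sum_congr rfl fun i _ => ?_
  rw [real_inner_comm, inner_weightVec, Finset.mul_sum]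
  refine Finset.sum_congr rfl fun j _ => ?_
  rw [real_inner_comm, inner_feature]
  ring

theorem measurable_kernelComb {X : Type*} [MeasurableSpace X] {n k : ℕ} {ψ : X → QState n}
    (hψ : Measurable ψ) (p : Fin k → X) (α : Fin k → ℝ) : Measurable (kernelComb ψ p α) := by
  have : kernelComb ψ p α =
      fun x => inner ℝ (weightVec (fun i => feature (ψ (p i))) α) (feature (ψ x)) := by
    funext x; rw [inner_weightVec_kernelComb]
  rw [this]
  fun_prop

theorem rate_nonneg {ε G B : ℝ} (hG : 0 ≤ G) (hB : 0 ≤ B) (N : ℕ) (δ : ℝ) (hδ : 0 ≤ Real.log (1 / δ)) :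
    0 ≤ rate ε G B N δ := by
  unfold rate; positivity

theorem rate_eq {ε G B : ℝ} (N : ℕ) {δ : ℝ} (hδ : 0 ≤ Real.log (1 / δ)) :
    rate ε G B N δ = √ε + G * √√(Real.log (1 / δ) / N) + B * √(Real.log (1 / δ) / N) := by
  rw [rate, Real.sqrt_eq_rpow √_, Real.sqrt_eq_rpow (_ / _), ← Real.rpow_mul (by positivity)]
  norm_num

/-- The individual error terms are controlled by the rate, as long as the rate is at most one. -/
theorem error_terms_le {ρ ε G B η ν G₀ b : ℝ} (hε0 : 0 ≤ ε) (hη : 0 < η) (hB : 0 ≤ B)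
    (hG₀ : 0 < G₀) (hG : G₀ ≤ G) (hb : 0 ≤ b) (hν : ν ≤ b * η) (hρ : ρ = √ε + G * √η + B * η)
    (hρ1 : ρ ≤ 1) {a : ℝ} (ha : a = 1 / G₀ + 1 / G₀ ^ 2 + 1 / G₀ ^ 4 + b / G₀ ^ 2) :
    ε ≤ ρ ∧ G ^ 2 * η ≤ ρ ∧ B * η ≤ ρ ∧ η ≤ a * ρ ∧ η ^ 2 ≤ a * ρ ∧ √η ≤ a * ρ ∧ ν ≤ a * ρ := by
  have hs := Real.sqrt_nonneg ε
  have hse : √ε ^ 2 = ε := Real.sq_sqrt hε0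
  have hr : 0 < √η := Real.sqrt_pos.2 hη
  have hrη : √η ^ 2 = η := Real.sq_sqrt hη.le
  set x := √ε
  set z := √η
  have hG0 : 0 < G := hG₀.trans_le hG
  have hGz : 0 ≤ G * z := by positivity
  have hBη : 0 ≤ B * η := by positivity
  have hρ0 : 0 ≤ ρ := by rw [hρ]; positivity
  have hz : z ≤ 1 / G₀ * ρ := by
    rw [one_div, le_inv_mul_iff₀ hG₀]
    have : G₀ * z ≤ G * z := by gcongr
    linarith
  have hz1 : z ≤ 1 / G₀ := hz.trans (mul_le_of_le_one_right (by positivity) hρ1)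
  have hη1 : η ≤ 1 / G₀ ^ 2 * ρ := by
    calc η = z * z := by rw [← hrη]; ring
      _ ≤ 1 / G₀ * (1 / G₀ * ρ) := by gcongr
      _ = _ := by field_simp
  have hη2 : η ≤ 1 / G₀ ^ 2 := hη1.trans (mul_le_of_le_one_right (by positivity) hρ1)
  have hη4 : η ^ 2 ≤ 1 / G₀ ^ 4 * ρ := by
    calc η ^ 2 = η * η := sq _
      _ ≤ 1 / G₀ ^ 2 * (1 / G₀ ^ 2 * ρ) := by gcongr
      _ = _ := by field_simp
  have hνρ : ν ≤ b / G₀ ^ 2 * ρ := by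
    calc ν ≤ b * η := hν
      _ ≤ b * (1 / G₀ ^ 2 * ρ) := by gcongr
      _ = _ := by ring
  have p1 : 0 ≤ 1 / G₀ * ρ := by positivity
  have p2 : 0 ≤ 1 / G₀ ^ 2 * ρ := by positivity
  have p3 : 0 ≤ 1 / G₀ ^ 4 * ρ := by positivity
  have p4 : 0 ≤ b / G₀ ^ 2 * ρ := by positivity
  have hae : a * ρ = 1 / G₀ * ρ + 1 / G₀ ^ 2 * ρ + 1 / G₀ ^ 4 * ρ + b / G₀ ^ 2 * ρ := by
    rw [ha]; ring
  rw [hae]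
  -- Both remaining terms are squares of summands of ρ, and a nonnegative number at most one
  -- dominates its square.
  refine ⟨?_, ?_, by linarith, by linarith, by linarith, by linarith, by linarith⟩
  · rw [← hse]; nlinarith
  · have : G ^ 2 * η = (G * z) ^ 2 := by rw [mul_pow, hrη]
    rw [this]; nlinarith

end Assembly

/-! ### The joint concentration event. -/

section Main

variable {X : Type*} [MeasurableSpace X] {n N M m : ℕ}

/-- The event that all concentration statements used in the analysis hold. -/
structure Concentrated (ψ : X → QState n) (D : Measure (X × ℝ)) (c g : X → ℝ) (G C₁ η e l : ℝ)
    (T : ℕ) (S : Submodule ℝ (Feature n)) (ω : Run X N M m) : Prop where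
  train : ∀ i, (ω.1.1 i).2 ∈ Set.Icc (0 : ℝ) 1 ∧ c (ω.1.1 i).1 ∈ Set.Icc (0 : ℝ) 1 ∧
    feature (ψ (ω.1.1 i).1) ∈ S
  val : ∀ j, (ω.1.2 j).2 ∈ Set.Icc (0 : ℝ) 1 ∧ c (ω.1.2 j).1 ∈ Set.Icc (0 : ℝ) 1 ∧
    feature (ψ (ω.1.2 j).1) ∈ S
  noise : ‖vavg fun i => ((ω.1.1 i).2 - c (ω.1.1 i).1) • feature (ψ (ω.1.1 i).1)‖ ≤ C₁ * η
  bias : ‖vavg (fun i => g (ω.1.1 i).1 ^ 2) - ∫ z, g z.1 ^ 2 ∂D‖ ≤ 2 * G ^ 2 * (C₁ * η)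
  second : ‖vavg (fun i => outer (feature (ψ (ω.1.1 i).1))) - ∫ z, outer (feature (ψ z.1)) ∂D‖ ≤
    2 * 1 * (C₁ * η)
  first : ‖vavg (fun i => c (ω.1.1 i).1 • feature (ψ (ω.1.1 i).1)) -
    ∫ z, c z.1 • feature (ψ z.1) ∂D‖ ≤ 2 * 1 * (C₁ * η)
  zeroth : ‖vavg (fun i => c (ω.1.1 i).1 ^ 2) - ∫ z, c z.1 ^ 2 ∂D‖ ≤ 2 * 1 * (C₁ * η)
  trainShots : ∀ i j, |kernelEst (ω.2.1 i j) - qKernel (ψ (ω.1.1 i).1) (ψ (ω.1.1 j).1)| ≤ e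
  valShots : ∀ i j, |kernelEst (ω.2.2 i j) - qKernel (ψ (ω.1.1 i).1) (ψ (ω.1.2 j).1)| ≤ e
  valid : ∀ t < T, |(avg fun j => excess (fun x => feature (ψ x)) c (runVec ψ ω t) (ω.1.2 j)) -
    popRisk D (fun x => feature (ψ x)) c (runVec ψ ω t)| ≤
    popRisk D (fun x => feature (ψ x)) c (runVec ψ ω t) / 2 +
      2 * (‖runVec ψ ω t‖ + 2) ^ 2 * l / M

/-- A union bound over one null event and eight events of probability at most δ/8: label noise,
bias, three empirical moments, two blocks of shots, and validation. -/
theorem runLaw_not_concentrated_le {ψ : X → QState n} (hψm : Measurable ψ) (hψ : ∀ x, ‖ψ x‖ = 1)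
    {D : Measure (X × ℝ)} [IsProbabilityMeasure D] {c g : X → ℝ} (hcm : Measurable c)
    (hgm : Measurable g) {G : ℝ} (hG0 : 0 < G) (hG : ∀ x, |g x| ≤ G)
    (hy : ∀ᵐ z ∂D, z.2 ∈ Set.Icc (0 : ℝ) 1) (hc : ∀ᵐ z ∂D, c z.1 ∈ Set.Icc (0 : ℝ) 1)
    (hce : D[fun z => z.2 | MeasurableSpace.comap Prod.fst inferInstance] =ᵐ[D] fun z => c z.1)
    {S : Submodule ℝ (Feature n)} (hS : ∀ᵐ z ∂D, feature (ψ z.1) ∈ S)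
    (hN : 0 < N) (hM : 0 < M) (hm : 0 < m) {C₁ η e l δ : ℝ} {T : ℕ} (hs : 0 ≤ C₁ * η) (he : 0 ≤ e)
    (hδ : 0 < δ) (h1 : 2 * Real.exp (-(N * (C₁ * η) ^ 2 / 2)) ≤ δ / 8)
    (h2 : N * N * (2 * Real.exp (-(m * e ^ 2 / 8))) ≤ δ / 8)
    (h3 : N * M * (2 * Real.exp (-(m * e ^ 2 / 8))) ≤ δ / 8)
    (h4 : T * (2 * Real.exp (-l)) ≤ δ / 8) :
    runLaw ψ D N M m {ω | ¬ Concentrated ψ D c g G C₁ η e l T S ω} ≤ ENNReal.ofReal δ := by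
  have hcb : ∀ᵐ z ∂D, |c z.1| ≤ 1 := by
    filter_upwards [hc] with z hz using abs_le.2 ⟨by linarith [hz.1], hz.2⟩
  have hΨ1 : ∀ x, ‖feature (ψ x)‖ = 1 := fun x => norm_feature (hψ x)
  have hae := ae_runLaw (N := N) (M := M) (m := m) ψ D
    (P := fun z => z.2 ∈ Set.Icc (0 : ℝ) 1 ∧ c z.1 ∈ Set.Icc (0 : ℝ) 1 ∧ feature (ψ z.1) ∈ S)
    (by filter_upwards [hy, hc, hS] with z a1 a2 a3 using ⟨a1, a2, a3⟩)
  have e0 : runLaw ψ D N M m _ = 0 := ae_iff.1 hae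
  have e1 := (runLaw_noise_le (M := M) (m := m) hψm hψ hcm hy hc hce hN hs).trans
    (ENNReal.ofReal_le_ofReal h1)
  have e2 := (runLaw_vavg_le (M := M) (m := m) hψm hψ D (fun z => g z.1 ^ 2) (by fun_prop)
    (R := G ^ 2) (by positivity) (Filter.Eventually.of_forall fun z => by
      rw [Real.norm_eq_abs, abs_pow]
      exact pow_le_pow_left₀ (abs_nonneg _) (hG z.1) 2) hN hs).trans (ENNReal.ofReal_le_ofReal h1)
  have e3 := (runLaw_vavg_le (M := M) (m := m) hψm hψ D (fun z => outer (feature (ψ z.1)))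
    (by fun_prop) one_pos (Filter.Eventually.of_forall fun z =>
      (norm_outer_feature hΨ1 z.1).le) hN hs).trans (ENNReal.ofReal_le_ofReal h1)
  have e4 := (runLaw_vavg_le (M := M) (m := m) hψm hψ D (fun z => c z.1 • feature (ψ z.1))
    (by fun_prop) one_pos (by
      filter_upwards [hcb] with z hz
      rwa [norm_smul, hΨ1, mul_one, Real.norm_eq_abs]) hN hs).trans (ENNReal.ofReal_le_ofReal h1)
  have e5 := (runLaw_vavg_le (M := M) (m := m) hψm hψ D (fun z => c z.1 ^ 2)
    (by fun_prop) one_pos (by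
      filter_upwards [hcb] with z hz
      rw [Real.norm_eq_abs, abs_pow]
      exact pow_le_one₀ (abs_nonneg _) hz) hN hs).trans (ENNReal.ofReal_le_ofReal h1)
  have e6 := (runLaw_trainShots_le (N := N) (M := M) hm hψm hψ D he).trans
    (ENNReal.ofReal_le_ofReal h2)
  have e7 := (runLaw_valShots_le (N := N) (M := M) hm hψm hψ D he).trans
    (ENNReal.ofReal_le_ofReal h3)
  have e8 := (runLaw_validation_le (N := N) (m := m) hψm hψ hcm hy hc hce hM T l).trans
    (ENNReal.ofReal_le_ofReal h4)
  have hsum : ENNReal.ofReal δ = 0 + ENNReal.ofReal (δ / 8) + ENNReal.ofReal (δ / 8) +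
      ENNReal.ofReal (δ / 8) + ENNReal.ofReal (δ / 8) + ENNReal.ofReal (δ / 8) +
      ENNReal.ofReal (δ / 8) + ENNReal.ofReal (δ / 8) + ENNReal.ofReal (δ / 8) := by
    have h0 : 0 ≤ δ / 8 := by positivity
    rw [zero_add, ← ENNReal.ofReal_add h0 h0]
    repeat rw [← ENNReal.ofReal_add (by positivity) h0]
    congr 1
    ring
  rw [hsum]
  refine (measure_mono ?_).trans ((measure_union_le _ _).trans (add_le_add ((measure_union_le _ _).trans
    (add_le_add ((measure_union_le _ _).trans (add_le_add ((measure_union_le _ _).trans (add_le_add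
    ((measure_union_le _ _).trans (add_le_add ((measure_union_le _ _).trans (add_le_add
    ((measure_union_le _ _).trans (add_le_add ((measure_union_le _ _).trans (add_le_add e0.le e1))
    e2)) e3)) e4)) e5)) e6)) e7)) e8))
  intro ω hω
  by_contra hcon
  simp only [Set.mem_union, not_or, Set.mem_ofPred_eq, not_not, not_lt, not_exists] at hcon
  obtain ⟨⟨⟨⟨⟨⟨⟨⟨c0, c1⟩, c2⟩, c3⟩, c4⟩, c5⟩, c6⟩, c7⟩, c8⟩ := hcon
  exact hω ⟨c0.1, c0.2, c1, c2, c3, c4, c5, c6, c7, fun t ht => not_lt.1 fun h => c8 t ⟨ht, h⟩⟩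

/-- On the good event the run satisfies the hypotheses of the deterministic analysis. -/
theorem Concentrated.goodRun {ψ : X → QState n} (hψm : Measurable ψ) (hψ : ∀ x, ‖ψ x‖ = 1)
    {D : Measure (X × ℝ)} [IsProbabilityMeasure D] {k : ℕ} {p : Fin k → X} {α : Fin k → ℝ}
    {g : X → ℝ} {G B ε : ℝ} (hgm : Measurable g) (hG : ∀ x, |g x| ≤ G)
    (hε : ∫ z, g z.1 ^ 2 ∂D ≤ ε)
    (hB : ∑ i, ∑ j, α i * α j * qKernel (ψ (p i)) (ψ (p j)) < B)
    (hc : ∀ᵐ z ∂D, kernelComb ψ p α z.1 + g z.1 ∈ Set.Icc (0 : ℝ) 1)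
    {S : Submodule ℝ (Feature n)} {C₁ η ν l L₁ b : ℝ} {T : ℕ} {ω : Run X N M m}
    (h : Concentrated ψ D (fun x => kernelComb ψ p α x + g x) g G C₁ η (η * ν) l T S ω)
    (hN : 0 < N) (hM : 0 < M) (hη : 0 < η) (hν0 : 0 < ν) (hν1 : ν ≤ 1) (hC₁ : 0 ≤ C₁)
    (hb : 0 ≤ b) (hL₁ : 0 ≤ L₁)
    (hT : ∀ t < T, t * η ≤ 1) (hT' : 1 ≤ T * η) (hNν : 1 / (N : ℝ) ≤ ν)
    (hl : l / M ≤ L₁ * (1 / N)) (htN : ∀ t < T, (t : ℝ) / N ≤ b * ν) :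
    GoodRun (fun i => feature (ψ (ω.1.1 i).1)) (fun i j => kernelEst (ω.2.1 i j))
      (fun i => (ω.1.1 i).2) (fun i => kernelComb ψ p α (ω.1.1 i).1 + g (ω.1.1 i).1)
      (fun i => g (ω.1.1 i).1) (fun j => feature (ψ (ω.1.2 j).1))
      (fun i j => kernelEst (ω.2.2 i j)) (fun j => (ω.1.2 j).2)
      (fun j => kernelComb ψ p α (ω.1.2 j).1 + g (ω.1.2 j).1)
      (weightVec (fun i => feature (ψ (p i))) α)
      (popRisk D (fun x => feature (ψ x)) fun x => kernelComb ψ p α x + g x)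
      (popSq D fun x => feature (ψ x)) T η ν C₁ (2 * (32 * b + 8) * L₁) ε G B := by
  have hΨ : Measurable fun x => feature (ψ x) := by fun_prop
  have hΨ1 : ∀ x, ‖feature (ψ x)‖ = 1 := fun x => norm_feature (hψ x)
  have hcm : Measurable fun x => kernelComb ψ p α x + g x :=
    (measurable_kernelComb hψm p α).add hgm
  have hcv : ∀ x, kernelComb ψ p α x + g x =
      inner ℝ (weightVec (fun i => feature (ψ (p i))) α) (feature (ψ x)) + g x := fun x => by
    rw [inner_weightVec_kernelComb]
  have hK : ∀ i j, |kernelEst (ω.2.1 i j) -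
      inner ℝ (feature (ψ (ω.1.1 i).1)) (feature (ψ (ω.1.1 j).1))| ≤ η * ν := fun i j => by
    rw [inner_feature]; exact h.trainShots i j
  have hbI : ∀ i, (ω.1.1 i).2 ∈ Set.Icc (0 : ℝ) 1 := fun i => (h.train i).1
  refine
    { hN := hN
      hM := hM
      hη := hη
      hν0 := hν0
      hν1 := hν1
      hC₁ := hC₁
      hτ := by positivity
      hΨ := fun i => hΨ1 _
      hK := hK
      hk := fun i j => by rw [inner_feature]; exact h.valShots i j
      hb := hbI
      hc := fun i => (h.train i).2.1
      hy := fun j => (h.val j).1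
      hcv := fun j => (h.val j).2.1
      hcg := fun i => hcv _
      hT := hT
      hT' := hT'
      hv := by rw [norm_weightVec_sq_eq]; exact hB.le
      hR := popRisk_nonneg D
      noise := h.noise
      bias := ?_
      second := fun u => ?_
      hRP := fun w => ?_
      hPR := fun w => ?_
      valid := fun t ht => ?_ }
  · have h1 := h.bias
    have hv : vavg (fun i => g (ω.1.1 i).1 ^ 2) = avg fun i => g (ω.1.1 i).1 ^ 2 := by
      rw [vavg, avg, smul_eq_mul, inv_mul_eq_div]
    rw [hv, Real.norm_eq_abs] at h1
    linarith [(abs_le.1 h1).2]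
  · have := abs_avg_sq_sub_popSq_le (D := D) hΨ hΨ1 ω.1.1 h.second u
    rwa [mul_one] at this
  · have := popRisk_le_popSq (D := D) hΨ hΨ1 _ hgm hG hcv w
    linarith
  · have := popSq_le_popRisk (D := D) hΨ hΨ1 hcm hc _ hgm hG hcv w
    linarith
  -- The Bernstein remainder is of order (‖w‖ + 2)² l/M with (‖w‖ + 2)² ≤ 32t + 8. Since l/M is
  -- O(1/N) and t/N ≤ bν, it is at most a constant times ν.
  · refine (h.valid t ht).trans (add_le_add le_rfl ?_)
    have hte : t * (η * ν) ≤ 1 := by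
      rw [← mul_assoc]
      exact (mul_le_of_le_one_left hν0.le (hT t ht)).trans hν1
    have h1 : ‖runVec ψ ω t‖ ^ 2 ≤ 16 * t :=
      norm_weightVec_sq_le hN (fun i => hΨ1 (ω.1.1 i).1) hK hbI hte
    have h2 : (‖runVec ψ ω t‖ + 2) ^ 2 ≤ 32 * t + 8 := by
      nlinarith [sq_nonneg (‖runVec ψ ω t‖ - 2)]
    calc 2 * (‖runVec ψ ω t‖ + 2) ^ 2 * l / M = 2 * (‖runVec ψ ω t‖ + 2) ^ 2 * (l / M) := by ring
      _ ≤ 2 * (‖runVec ψ ω t‖ + 2) ^ 2 * (L₁ * (1 / N)) := by gcongr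
      _ ≤ 2 * (32 * t + 8) * (L₁ * (1 / N)) := by gcongr
      _ = 2 * (32 * (t / N) + 8 * (1 / N)) * L₁ := by ring
      _ ≤ 2 * (32 * (b * ν) + 8 * ν) * L₁ := by
          have := htN t ht
          gcongr
      _ = _ := by ring

end Main

end QKA

end

/-! ### Choice of constants and conclusion. -/

theorem theorem3 (G₀ δ₀ : ℝ) (hG₀ : 0 < G₀) (hδ₀ : 0 < δ₀) (hδ₁ : δ₀ < 1) :
    ∃ cT cM cQ C : ℝ, 0 < cT ∧ 0 < cM ∧ 0 < cQ ∧ 0 < C ∧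
    ∀ (X : Type*) [MeasurableSpace X] (n : ℕ) (ψ : X → QKA.QState n)
      (D : Measure (X × ℝ)) [IsProbabilityMeasure D],
      Measurable ψ → (∀ x, ‖ψ x‖ = 1) → (∀ᵐ z ∂D, z.2 ∈ Set.Icc (0 : ℝ) 1) →
    ∃ K : ℝ, 0 < K ∧
    ∀ (k : ℕ) (p : Fin k → X) (α : Fin k → ℝ) (g : X → ℝ) (G B ε : ℝ) (N : ℕ) (δ : ℝ),
      Measurable g → (∀ x, |g x| ≤ G) → G₀ ≤ G →
      ∫ z, g z.1 ^ 2 ∂D ≤ ε →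
      ∑ i, ∑ j, α i * α j * QKA.qKernel (ψ (p i)) (ψ (p j)) < B →
      D[fun z => z.2 | MeasurableSpace.comap Prod.fst inferInstance]
        =ᵐ[D] (fun z => QKA.kernelComb ψ p α z.1 + g z.1) →
      1 ≤ N → 0 < δ → δ ≤ δ₀ →
      let c : X → ℝ := fun x => QKA.kernelComb ψ p α x + g x
      let T : ℕ := ⌈cT * √(N / Real.log (1 / δ))⌉₊
      let M : ℕ := ⌈cM * (N * Real.log (T / δ))⌉₊
      let m : ℕ := ⌈cQ * (N : ℝ) ^ (5 / 2 : ℝ)⌉₊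
      QKA.runLaw ψ D N M m
        {ω | ¬ ∀ r, QKA.IsOutput 1 T ω r →
          QKA.trainErr 1 c ω r ≤ C * QKA.rate ε G B N δ ∧
          QKA.genErr ψ D 1 c ω r ≤
            QKA.trainErr 1 c ω r + K * √(Real.log (2 / δ) / N) ∧
          QKA.genErr ψ D 1 c ω r ≤
            C * QKA.rate ε G B N δ + C * √(Real.log (2 / δ) / N)}
        ≤ ENNReal.ofReal δ := by
  obtain ⟨L₀, hL₀⟩ : ∃ x, x = Real.log (1 / δ₀) := ⟨_, rfl⟩
  have hL₀p : 0 < L₀ := by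
    rw [hL₀]
    exact Real.log_pos (by rw [lt_div_iff₀ hδ₀]; linarith)
  obtain ⟨b, hb⟩ : ∃ x, x = 1 / √L₀ := ⟨_, rfl⟩
  have hb0 : 0 < b := by rw [hb]; positivity
  -- C₁ makes the exponent N(C₁η)²/2 equal to L + 3L/L₀ ≥ L + 3, as a probability of δ/8 demands.
  obtain ⟨C₁, hC₁⟩ : ∃ x, x = √(2 * (1 + 3 / L₀)) := ⟨_, rfl⟩
  have hC₁0 : 0 ≤ C₁ := by rw [hC₁]; positivity
  obtain ⟨L₁, hL₁⟩ : ∃ x, x = 1 + 3 / L₀ := ⟨_, rfl⟩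
  have hL₁0 : 0 ≤ L₁ := by rw [hL₁]; positivity
  obtain ⟨τ, hτ⟩ : ∃ x, x = 2 * (32 * b + 8) * L₁ := ⟨_, rfl⟩
  have hτ0 : 0 ≤ τ := by rw [hτ]; positivity
  obtain ⟨a, ha⟩ : ∃ x, x = 1 / G₀ + 1 / G₀ ^ 2 + 1 / G₀ ^ 4 + b / G₀ ^ 2 := ⟨_, rfl⟩
  have ha0 : 0 ≤ a := by rw [ha]; positivity
  obtain ⟨κ₁, hκ₁⟩ : ∃ x, x = 4 + 9 * C₁ + 36 * a + 5 * C₁ ^ 2 * a + C₁ * a := ⟨_, rfl⟩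
  have hκ₁0 : 0 ≤ κ₁ := by rw [hκ₁]; positivity
  obtain ⟨κ₂, hκ₂⟩ : ∃ x, x = 4 * κ₁ + 6 + 4 * C₁ := ⟨_, rfl⟩
  have hκ₂0 : 0 ≤ κ₂ := by rw [hκ₂]; positivity
  obtain ⟨κ₃, hκ₃⟩ : ∃ x, x = 3 * κ₂ + (28 * τ + 36 * κ₂ + 96) * a := ⟨_, rfl⟩
  have hκ₃0 : 0 ≤ κ₃ := by rw [hκ₃]; positivity
  obtain ⟨κ₄, hκ₄⟩ : ∃ x, x = 5 * κ₁ + 4 * κ₃ + 4 * C₁ + 4 + 84 * a + 16 * C₁ * a := ⟨_, rfl⟩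
  have hκ₄0 : 0 ≤ κ₄ := by rw [hκ₄]; positivity
  -- C collects the bounds for rate at most one (κ₃, κ₄), the absolute bounds for rate above one (98
  -- + 2τ for the risk, 4² for the training error), and the variance of the fresh shots.
  obtain ⟨C, hC⟩ : ∃ x, x = κ₃ + κ₄ + (98 + 2 * τ) + 16 + 9 / L₀ * b := ⟨_, rfl⟩
  have h9 : 0 ≤ 9 / L₀ * b := by positivity
  obtain ⟨cQ, hcQ⟩ : ∃ x, x = 8 * (2 + (10 + b) / L₀) := ⟨_, rfl⟩
  refine ⟨1, 1, cQ, C, one_pos, one_pos, by rw [hcQ]; positivity, by rw [hC]; positivity, ?_⟩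
  intro X _ n ψ D _ hψm hψ hy
  have hΨ : Measurable fun x => QKA.feature (ψ x) := by fun_prop
  have hΨ1 : ∀ x, ‖QKA.feature (ψ x)‖ = 1 := fun x => QKA.norm_feature (hψ x)
  obtain ⟨σ, S, hσ, hS, hgap⟩ := QKA.exists_covariance_gap D
    (fun z : X × ℝ => QKA.feature (ψ z.1)) (by fun_prop) fun z => hΨ1 z.1
  obtain ⟨W, hW⟩ : ∃ x, x = (98 + 64 * C₁) / σ := ⟨_, rfl⟩
  have hW0 : 0 ≤ W := by rw [hW]; positivity
  -- The first summand pays for kernel estimation in the training error and for the fresh shots. The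
  -- second is the uniform deviation of the risk times (‖w‖ + 1)² ≤ 2(W + 1), with W from the
  -- covariance gap.
  refine ⟨(33 + 9 / L₀) * b + 2 * C₁ * (2 * (W + 1)), by positivity, ?_⟩
  intro k p α g G B ε N δ hgm hG hGG hε hB hce hN hδ hδδ c T M m
  obtain ⟨L, hL⟩ : ∃ L, L = Real.log (1 / δ) := ⟨_, rfl⟩
  have hT : T = ⌈√(N / L)⌉₊ := by rw [hL, ← one_mul √_]
  have hM : M = ⌈N * Real.log (T / δ)⌉₊ := by
    rw [← one_mul ((N : ℝ) * Real.log (T / δ))]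
  have hm : m = ⌈cQ * (N : ℝ) ^ (5 / 2 : ℝ)⌉₊ := rfl
  clear_value T M m
  obtain ⟨-, hLL, hη, hT0, hM0, hm0, hν, hTη, hTη', hu1, hu2, hl, hTl, htN, htm⟩ :=
    QKA.parameter_bounds hδ₀ hδ₁ hδ hδδ hN hL₀ hb hcQ hL hT hM hm
  obtain ⟨η, hηd⟩ : ∃ x, x = √(L / N) := ⟨_, rfl⟩
  obtain ⟨ν, hνd⟩ : ∃ x, x = 1 / √(N : ℝ) := ⟨_, rfl⟩
  rw [← hηd, ← hνd] at hν hu1 hu2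
  rw [← hηd] at hη hTη'
  simp only [← hηd, ← hνd] at hTη htN htm
  rw [← hL₁] at hl
  have hN1 : (1 : ℝ) ≤ N := by exact_mod_cast hN
  have hN0 : (0 : ℝ) < N := by linarith
  have hs1 : 1 ≤ √(N : ℝ) := Real.one_le_sqrt.2 hN1
  have hν0 : 0 < ν := by rw [hνd]; positivity
  have hν1 : ν ≤ 1 := by rw [hνd]; exact div_le_one_of_le₀ hs1 (by positivity)
  have hNν : 1 / (N : ℝ) ≤ ν := by
    rw [hνd]
    refine one_div_le_one_div_of_le (by positivity) ?_
    calc √(N : ℝ) ≤ √N * √N := le_mul_of_one_le_right (Real.sqrt_nonneg _) hs1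
      _ = N := Real.mul_self_sqrt hN0.le
  have hLp : 0 < L := hL₀p.trans_le hLL
  have hG0 : 0 < G := hG₀.trans_le hGG
  have hcm : Measurable fun x => QKA.kernelComb ψ p α x + g x :=
    (QKA.measurable_kernelComb hψm p α).add hgm
  have hc := QKA.ae_regression_mem_Icc (c := fun x => QKA.kernelComb ψ p α x + g x) hy hce
  have hB0 : 0 ≤ B := by
    rw [← QKA.norm_weightVec_sq_eq] at hB
    exact (sq_nonneg _).trans hB.le
  have hε0 : 0 ≤ ε := (integral_nonneg fun z => sq_nonneg _).trans hε
  have hdev : 2 * Real.exp (-(N * (C₁ * η) ^ 2 / 2)) ≤ δ / 8 := by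
    apply QKA.two_mul_exp_neg_le hδ
    have e1 : N * (C₁ * η) ^ 2 / 2 = L + 3 * (L / L₀) := by
      rw [mul_pow, hC₁, hηd, Real.sq_sqrt (by positivity), Real.sq_sqrt (by positivity)]
      field_simp
    rw [e1, ← hL]
    have : 1 ≤ L / L₀ := by rwa [le_div_iff₀ hL₀p, one_mul]
    linarith
  refine (measure_mono ?_).trans (QKA.runLaw_not_concentrated_le hψm hψ hcm hgm hG0 hG hy hc hce hS
    hN hM0 hm0 (by positivity) (by positivity) hδ hdev hu1 hu2 hTl)
  intro ω hω hcon
  refine hω fun r hr => ?_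
  obtain ⟨hrT, hmin⟩ := hr
  have h := hcon.goodRun hψm hψ hgm hG hε hB hc hN hM0 hη hν0 hν1 hC₁0 hb0.le hL₁0 hTη hTη' hNν hl
    htN
  rw [← hτ] at h
  have hρ0 := QKA.rate_nonneg (ε := ε) hG0.le hB0 N δ (hL ▸ hLp.le)
  have hρe := QKA.rate_eq (ε := ε) (G := G) (B := B) N (δ := δ) (hL ▸ hLp.le)
  rw [← hL, ← hηd] at hρe
  generalize QKA.rate ε G B N δ = ρ at *
  have htrain : QKA.trainErr 1 (fun x => QKA.kernelComb ψ p α x + g x) ω r = QKA.avg fun i =>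
      (∑ j, QKA.weights (fun i j => QKA.kernelEst (ω.2.1 i j)) (fun i => (ω.1.1 i).2) 1 r j *
        QKA.kernelEst (ω.2.1 j i) - (QKA.kernelComb ψ p α (ω.1.1 i).1 + g (ω.1.1 i).1)) ^ 2 := rfl
  obtain ⟨R, hR⟩ : ∃ x, x = QKA.popRisk D (fun x => QKA.feature (ψ x))
    (fun x => QKA.kernelComb ψ p α x + g x) (QKA.runVec ψ ω r) := ⟨_, rfl⟩
  have hmain : R ≤ (κ₃ + (98 + 2 * τ)) * ρ ∧
      QKA.trainErr 1 (fun x => QKA.kernelComb ψ p α x + g x) ω r ≤ (κ₄ + 16) * ρ := by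
    -- The descent analysis compares squares of error terms with ρ and so needs ρ ≤ 1; beyond that,
    -- the constant bounds are already below a multiple of ρ.
    rcases le_or_gt ρ 1 with hρ1 | hρ1
    · obtain ⟨q1, q2, q3, q4, q5, q6, q7⟩ := QKA.error_terms_le hε0 hη hB0 hG₀ hGG hb0.le hν hρe hρ1 ha
      obtain ⟨h1, h2⟩ := h.risk_and_trainErr_le hrT hmin ha0 hρ1 hε0 q1 q2 q3 q4 q5 q6 q7 hκ₁ hκ₂ hκ₃
      have h1' : R ≤ κ₃ * ρ := hR.trans_le h1
      rw [← hκ₄] at h2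
      rw [htrain]
      have p1 : 0 ≤ (98 + 2 * τ) * ρ := by positivity
      exact ⟨by linarith, by linarith⟩
    · have h1 : R ≤ 98 + 2 * τ := hR.trans_le (h.risk_le_const hrT hmin)
      have h2 := pow_le_pow_left₀ (QKA.rms_nonneg _) (h.trainErr_le_const hrT) 2
      rw [QKA.rms_sq] at h2
      rw [htrain]
      have p1 : 98 + 2 * τ ≤ (98 + 2 * τ) * ρ := le_mul_of_one_le_right (by positivity) hρ1.le
      have p2 : 0 ≤ κ₃ * ρ := by positivity
      have p3 : 0 ≤ κ₄ * ρ := by positivity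
      exact ⟨by linarith, by linarith⟩
  have hgen : QKA.genErr ψ D 1 (fun x => QKA.kernelComb ψ p α x + g x) ω r ≤ R + 9 / L₀ * ν := by
    rw [hR]
    refine (QKA.genErr_le hm0 hψm hψ D hcm hc ω r).trans (add_le_add le_rfl ?_)
    refine le_trans ?_ (htm r hrT)
    have : ∑ i, |QKA.runWeights 1 ω r i| ≤ 3 * r :=
      QKA.sum_abs_weights_le hN h.hΨ h.hK h.hb (h.time_mul_error_le_one hrT)
    gcongr
  obtain ⟨η', hη'⟩ : ∃ x, x = √(Real.log (2 / δ) / N) := ⟨_, rfl⟩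
  rw [← hη']
  have hηη' : η ≤ η' := by
    rw [hηd, hη', hL]
    apply Real.sqrt_le_sqrt
    gcongr
    norm_num
  have hνη' : ν ≤ b * η' := hν.trans (by gcongr)
  have hη'0 : 0 ≤ η' := by rw [hη']; positivity
  refine ⟨?_, ?_, ?_⟩
  · refine hmain.2.trans ?_
    gcongr
    rw [hC]
    linarith
  -- The weight vector is a combination of training features, which almost surely lie in the
  -- subspace where the covariance is coercive.
  · have hmem : QKA.runVec ψ ω r ∈ S :=
      Submodule.sum_mem S (t := Finset.univ) (f := fun i =>
        QKA.runWeights 1 ω r i • QKA.feature (ψ (ω.1.1 i).1)) fun i _ =>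
        Submodule.smul_mem _ _ (hcon.train i).2.2
    have hw : ‖QKA.runVec ψ ω r‖ ^ 2 ≤ W :=
      (h.norm_sq_le_of_gap hrT hσ (hgap _ hmem)).trans_eq hW.symm
    have h1 := QKA.popRisk_le_avg hΨ hΨ1 hcm hc ω.1.1 hcon.second hcon.first hcon.zeroth
      (QKA.runVec ψ ω r)
    rw [← hR] at h1
    have h2 := h.avg_clean_le hrT
    rw [← htrain] at h2
    have h3 : (‖QKA.runVec ψ ω r‖ + 1) ^ 2 ≤ 2 * (W + 1) := by
      calc _ ≤ 2 * (‖QKA.runVec ψ ω r‖ ^ 2 + 1 ^ 2) := add_sq_le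
        _ ≤ 2 * (W + 1) := by rw [one_pow]; gcongr
    have h4 : 2 * 1 * (C₁ * η) * (‖QKA.runVec ψ ω r‖ + 1) ^ 2 ≤ 2 * C₁ * (2 * (W + 1)) * η' := by
      calc _ ≤ 2 * 1 * (C₁ * η') * (2 * (W + 1)) := by gcongr
        _ = _ := by ring
    have h5 : (33 + 9 / L₀) * ν ≤ (33 + 9 / L₀) * (b * η') := by gcongr
    have h6 : (QKA.avg fun i => (inner ℝ (QKA.runVec ψ ω r) (QKA.feature (ψ (ω.1.1 i).1)) -
        (QKA.kernelComb ψ p α (ω.1.1 i).1 + g (ω.1.1 i).1)) ^ 2) ≤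
        QKA.trainErr 1 (fun x => QKA.kernelComb ψ p α x + g x) ω r + 33 * ν := h2
    linarith
  · have h1 : (κ₃ + (98 + 2 * τ)) * ρ ≤ C * ρ := by
      gcongr
      rw [hC]
      linarith
    have h2 : 9 / L₀ * ν ≤ C * η' := by
      calc 9 / L₀ * ν ≤ 9 / L₀ * (b * η') := by gcongr
        _ = 9 / L₀ * b * η' := by ring
        _ ≤ C * η' := by
          gcongr
          rw [hC]
          linarith
    linarith [hmain.1]
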